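/- **Setting.** Let $b,c,f\in C^3([0,1])$ and let $\lambda,\beta,\gamma>0$ be constants with $b\ge\lambda$ and $c\ge\beta$ on $[0,1]$. Let $p\in(0,1)$ and $\tau\ge \tfrac52$. For $\varepsilon_1,\varepsilon_2>0$ with $c-\tfrac12\varepsilon_2 b'\ge\gamma$ on $[0,1]$, consider $$-\varepsilon_1u''+\varepsilon_2 b u'+cu=f\ \text{ in }\Omega=(0,1),\qquad u(0)=u(1)=0,$$ in its weak form: $u\in H^1_0(\Omega)$ and $a(u,v)=(f,v)$ for all $v\in H_0^1(\Omega)$, where $a(u,v)=\varepsilon_1(u',v')+\varepsilon_2(bu',v)+(cu,v)$ and $(\cdot,\cdot)$ is the $L^2(\Omega)$ scalar product. The energy norm is $\|v\|_E=(\varepsilon_1\|v'\|_{L^2(\Omega)}^2+\|v\|_{L^2(\Omega)}^2)^{1/2}$. Let $g_0(x)<0<g_1(x)$ be the roots of $-\varepsilon_1g^2+\varepsilon_2b(x)g+c(x)=0$, and put $\mu_0=-\max_{[0,1]}g_0$, $\mu_1=\min_{[0,1]}g_1$, $\sigma_j=\frac{\tau}{p\mu_j}\ln\mu_j$ ($j=0,1$).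 Let $N\ge16$ be an integer divisible by $4$, and assume $\sigma_0,\sigma_1\le\frac14$ and $\mu_1^{-1}\le\mu_0^{-1}\le N^{-1}$. The Bakhvalov-type mesh is, with $t_i=i/N$, $$x_i=\begin{cases}-\frac{\tau}{p\mu_0}\ln\bigl(1-4(1-\mu_0^{-1})t_i\bigr), & 0\le i\le \frac N4,\\ \sigma_0+2(t_i-\frac14)(1-\sigma_0-\sigma_1), & \frac N4\le i\le\frac{3N}4,\\ 1+\frac{\tau}{p\mu_1}\ln\bigl(1-4(1-\mu_1^{-1})(1-t_i)\bigr), & \frac{3N}4\le i\le N.\end{cases}$$ Let $V^N$ be the space of continuous functions on $[0,1]$ that vanish at $0$ and $1$ and are affine on each $[x_i,x_{i+1}]$, and let $u^N\in V^N$ be the finite element solution: $a(u^N,v)=(f,v)$ for all $v\in V^N$. **Theorem (uniform convergence).** There is a constant $C>0$, independent of $\varepsilon_1$, $\varepsilon_2$ and $N$ (it may depend on $b,c,f,\lambda,\beta,\gamma,p,\tau$), such that for all $\varepsilon_1,\varepsilon_2,N$ as above $$\|u-u^N\|_E\le C\,(\varepsilon_2+\varepsilon_1^{1/2})^{1/2}N^{-1}+C\,N^{-2}.$$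 -/

import Mathlib

open MeasureTheory Set Filter Topology
open scoped ContDiff

noncomputable section

namespace TwoParam

/-! The Sobolev spaces H¹(0,1) and H₀¹(0,1), through weak derivatives. -/

/-- Lebesgue measure on `Ω = (0,1)`. -/
abbrev volΩ : Measure ℝ := volume.restrict (Ioo (0 : ℝ) 1)

/-- `φ ∈ C_c^∞(0,1)`. -/
def IsTestFunction (φ : ℝ → ℝ) : Prop :=
  ContDiff ℝ ∞ φ ∧ HasCompactSupport φ ∧ tsupport φ ⊆ Ioo (0 : ℝ) 1

/-- `g ∈ L²(0,1)` is the weak derivative of `v` on `(0,1)`. -/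
def HasWeakDeriv (v g : ℝ → ℝ) : Prop :=
  MemLp g 2 volΩ ∧
    ∀ φ : ℝ → ℝ, IsTestFunction φ →
      ∫ x in Ioo (0 : ℝ) 1, v x * deriv φ x = - ∫ x in Ioo (0 : ℝ) 1, g x * φ x

/-- `v ∈ H¹(0,1)`: `v` and its weak derivative are in `L²(0,1)`. -/
def MemH1 (v : ℝ → ℝ) : Prop :=
  MemLp v 2 volΩ ∧ ∃ g : ℝ → ℝ, HasWeakDeriv v g

open Classical in
/-- A representative of the weak derivative of `v ∈ H¹(0,1)`, unique almost everywhere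
(see `HasWeakDeriv.ae_eq`). -/
def weakDeriv (v : ℝ → ℝ) : ℝ → ℝ :=
  if h : ∃ g : ℝ → ℝ, HasWeakDeriv v g then h.choose else 0

theorem MemH1.hasWeakDeriv {v : ℝ → ℝ} (h : MemH1 v) : HasWeakDeriv v (weakDeriv v) := by
  unfold weakDeriv
  rw [dif_pos h.2]
  exact h.2.choose_spec

theorem HasWeakDeriv.ae_eq {v g₁ g₂ : ℝ → ℝ} (h₁ : HasWeakDeriv v g₁)
    (h₂ : HasWeakDeriv v g₂) : g₁ =ᵐ[volΩ] g₂ := by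
  have i₁ : IntegrableOn g₁ (Ioo (0 : ℝ) 1) := h₁.1.integrable (by norm_num)
  have i₂ : IntegrableOn g₂ (Ioo (0 : ℝ) 1) := h₂.1.integrable (by norm_num)
  have key := IsOpen.ae_eq_zero_of_integral_contDiff_smul_eq_zero (μ := volume)
    (f := fun x => g₁ x - g₂ x) (U := Ioo (0 : ℝ) 1) isOpen_Ioo
    ((i₁.sub i₂).locallyIntegrableOn) (by
      intro φ hφ hc hs
      have e₁ := h₁.2 φ ⟨hφ, hc, hs⟩
      have e₂ := h₂.2 φ ⟨hφ, hc, hs⟩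
      obtain ⟨M, hM⟩ := hc.exists_bound_of_continuous hφ.continuous
      have hmul : ∀ g : ℝ → ℝ, IntegrableOn g (Ioo (0 : ℝ) 1) →
          IntegrableOn (fun x => g x * φ x) (Ioo (0 : ℝ) 1) := fun g hg =>
        Integrable.mul_bdd (c := M) hg hφ.continuous.aestronglyMeasurable
          (Eventually.of_forall hM)
      rw [← setIntegral_eq_integral_of_forall_compl_eq_zero (s := Ioo (0 : ℝ) 1)]
      · have : ∀ x, φ x • (g₁ x - g₂ x) = g₁ x * φ x - g₂ x * φ x := fun x => by
          simp only [smul_eq_mul]; ring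
        simp only [this]
        rw [integral_sub (hmul g₁ i₁) (hmul g₂ i₂)]
        linarith
      · intro x hx
        have : φ x = 0 := image_eq_zero_of_notMem_tsupport fun h => hx (hs h)
        simp [this])
  rw [Filter.EventuallyEq, ae_restrict_iff' measurableSet_Ioo]
  filter_upwards [key] with x hx hxm
  exact sub_eq_zero.1 (hx hxm)

/-- `v ∈ H₀¹(0,1)`: `v` is an `H¹`-limit of functions in `C_c^∞(0,1)`. -/
def MemH10 (v : ℝ → ℝ) : Prop :=
  MemH1 v ∧ ∃ φ : ℕ → ℝ → ℝ, (∀ n, IsTestFunction (φ n)) ∧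
    Tendsto (fun n => (∫ x in Ioo (0 : ℝ) 1, (v x - φ n x) ^ 2) +
      ∫ x in Ioo (0 : ℝ) 1, (weakDeriv v x - deriv (φ n) x) ^ 2) atTop (𝓝 0)

/-- The energy norm `‖v‖_E = (ε₁ |v|₁² + ‖v‖²)^{1/2}`. -/
def energyNorm (ε₁ : ℝ) (v : ℝ → ℝ) : ℝ :=
  Real.sqrt (ε₁ * (∫ x in Ioo (0 : ℝ) 1, weakDeriv v x ^ 2) + ∫ x in Ioo (0 : ℝ) 1, v x ^ 2)

/-! The boundary value problem `-ε₁ u'' + ε₂ b u' + c u = f`, `u(0) = u(1) = 0`. -/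

/-- The bilinear form `a(u,v) = ε₁ (u',v') + ε₂ (b u',v) + (c u,v)`. -/
def bilin (ε₁ ε₂ : ℝ) (b c : ℝ → ℝ) (u v : ℝ → ℝ) : ℝ :=
  ε₁ * (∫ x in Ioo (0 : ℝ) 1, weakDeriv u x * weakDeriv v x) +
    ε₂ * (∫ x in Ioo (0 : ℝ) 1, b x * weakDeriv u x * v x) +
    ∫ x in Ioo (0 : ℝ) 1, c x * u x * v x

/-- `u ∈ H₀¹(0,1)` and `a(u,v) = (f,v)` for all `v ∈ H₀¹(0,1)`. -/
def IsWeakSolution (ε₁ ε₂ : ℝ) (b c f u : ℝ → ℝ) : Prop :=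
  MemH10 u ∧ ∀ v : ℝ → ℝ, MemH10 v →
    bilin ε₁ ε₂ b c u v = ∫ x in Ioo (0 : ℝ) 1, f x * v x

/-! The layer parameters `μ₀`, `μ₁`. -/

/-- The negative root `g₀(x)` of the characteristic equation `-ε₁ g² + ε₂ b(x) g + c(x) = 0`. -/
def charRoot0 (ε₁ ε₂ : ℝ) (b c : ℝ → ℝ) (x : ℝ) : ℝ :=
  (ε₂ * b x - Real.sqrt ((ε₂ * b x) ^ 2 + 4 * ε₁ * c x)) / (2 * ε₁)

/-- The positive root `g₁(x)` of the characteristic equation `-ε₁ g² + ε₂ b(x) g + c(x) = 0`. -/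
def charRoot1 (ε₁ ε₂ : ℝ) (b c : ℝ → ℝ) (x : ℝ) : ℝ :=
  (ε₂ * b x + Real.sqrt ((ε₂ * b x) ^ 2 + 4 * ε₁ * c x)) / (2 * ε₁)

theorem charRoot_spec {ε₁ ε₂ : ℝ} {b c : ℝ → ℝ} {x : ℝ} (h₁ : 0 < ε₁) (hc : 0 < c x) (g : ℝ) :
    -ε₁ * g ^ 2 + ε₂ * b x * g + c x = 0 ↔
      g = charRoot0 ε₁ ε₂ b c x ∨ g = charRoot1 ε₁ ε₂ b c x := by
  have hD : 0 ≤ (ε₂ * b x) ^ 2 + 4 * ε₁ * c x := by positivity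
  have hs := Real.mul_self_sqrt hD
  unfold charRoot0 charRoot1
  set s := Real.sqrt ((ε₂ * b x) ^ 2 + 4 * ε₁ * c x)
  rw [eq_div_iff (by positivity), eq_div_iff (by positivity)]
  constructor
  · intro h
    have : (g * (2 * ε₁) - (ε₂ * b x - s)) * (g * (2 * ε₁) - (ε₂ * b x + s)) = 0 := by
      linear_combination -4 * ε₁ * h - hs
    rcases mul_eq_zero.1 this with h | h
    · left; linarith
    · right; linarith
  · intro h
    have h4 : 4 * ε₁ * (-ε₁ * g ^ 2 + ε₂ * b x * g + c x) = 0 := by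
      rcases h with h | h
      · linear_combination (-(g * (2 * ε₁)) + ε₂ * b x + s) * h - hs
      · linear_combination (-(g * (2 * ε₁)) + ε₂ * b x - s) * h - hs
    exact (mul_eq_zero.1 h4).resolve_left (by positivity)

theorem charRoot_sign {ε₁ ε₂ : ℝ} {b c : ℝ → ℝ} {x : ℝ} (h₁ : 0 < ε₁) (hc : 0 < c x) :
    charRoot0 ε₁ ε₂ b c x < 0 ∧ 0 < charRoot1 ε₁ ε₂ b c x := by
  have hlt : |ε₂ * b x| < Real.sqrt ((ε₂ * b x) ^ 2 + 4 * ε₁ * c x) := by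
    apply Real.lt_sqrt_of_sq_lt
    rw [sq_abs]
    have : 0 < ε₁ * c x := by positivity
    linarith
  have := abs_lt.1 hlt
  exact ⟨div_neg_of_neg_of_pos (by linarith) (by positivity),
    div_pos (by linarith) (by positivity)⟩

/-- `μ₀ = - max_{[0,1]} g₀`. -/
def mu0 (ε₁ ε₂ : ℝ) (b c : ℝ → ℝ) : ℝ :=
  - sSup (charRoot0 ε₁ ε₂ b c '' Icc (0 : ℝ) 1)

/-- `μ₁ = min_{[0,1]} g₁`. -/
def mu1 (ε₁ ε₂ : ℝ) (b c : ℝ → ℝ) : ℝ :=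
  sInf (charRoot1 ε₁ ε₂ b c '' Icc (0 : ℝ) 1)

/-! The Bakhvalov-type mesh with layer parameters `μ₀`, `μ₁`. -/

/-- The length `σ = τ/(p μ) ln μ` of a layer region. -/
def sigma (τ p μ : ℝ) : ℝ := τ / (p * μ) * Real.log μ

/-- `φ₀(t) = -ln(1 - 4(1 - μ₀⁻¹)t)`. -/
def phi0 (μ₀ t : ℝ) : ℝ := - Real.log (1 - 4 * (1 - μ₀⁻¹) * t)

/-- `φ₁(t) = -ln(1 - 4(1 - μ₁⁻¹)(1 - t))`. -/
def phi1 (μ₁ t : ℝ) : ℝ := - Real.log (1 - 4 * (1 - μ₁⁻¹) * (1 - t))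

/-- The mesh point `x_i`, `0 ≤ i ≤ N`, where `4 ∣ N` (the neighbouring formulas agree at
`i = N/4` and `i = 3N/4`). -/
def meshPoint (τ p μ₀ μ₁ : ℝ) (N i : ℕ) : ℝ :=
  if i ≤ N / 4 then τ / (p * μ₀) * phi0 μ₀ ((i : ℝ) / N)
  else if i ≤ 3 * N / 4 then
    sigma τ p μ₀ + 2 * ((i : ℝ) / N - 1 / 4) * (1 - sigma τ p μ₀ - sigma τ p μ₁)
  else 1 - τ / (p * μ₁) * phi1 μ₁ ((i : ℝ) / N)

/-! The linear finite element method. -/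

/-- `w ∈ V^N` for the mesh `x₀, …, x_N` on `[0,1]`: continuous, zero at `0` and `1`, and affine on
each `[x_i, x_{i+1}]`. -/
def MemFESpace (N : ℕ) (x : ℕ → ℝ) (w : ℝ → ℝ) : Prop :=
  ContinuousOn w (Icc (0 : ℝ) 1) ∧ w 0 = 0 ∧ w 1 = 0 ∧
    ∀ i < N, ∃ m k : ℝ, ∀ y ∈ Icc (x i) (x (i + 1)), w y = m * y + k

/-- `u^N ∈ V^N` and `a(u^N,v) = (f,v)` for all `v ∈ V^N`. -/
def IsFESolution (ε₁ ε₂ : ℝ) (b c f : ℝ → ℝ) (N : ℕ) (x : ℕ → ℝ) (uN : ℝ → ℝ) : Prop :=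
  MemFESpace N x uN ∧ ∀ v : ℝ → ℝ, MemFESpace N x v →
    bilin ε₁ ε₂ b c uN v = ∫ y in Ioo (0 : ℝ) 1, f y * v y

end TwoParam

end

noncomputable section

namespace TwoParam

/-! Put `ν = ε₂ + √ε₁`. The argument needs no a priori bounds for derivatives of `u`: it compares
`u` with an explicit function `U` whose residual is already as small as the claimed error.

Both characteristic roots are governed by `rootSum`, which is comparable to `ν`; hence `μ₀ ≈ 1/ν`
and `μ₁ ≈ ν/ε₁`, and the root functions have derivatives of the same order as themselves. The
assumption `μ₀ ≥ N` therefore forces `ν ≤ C/N`. Take `U = S - S(0) w - S(1) z(1 - ·) + (affine)`,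
where `S = f/c + ε₂ s₁` is a two-term expansion without boundary conditions, `w` and `z` are
exponentials of integrals of the variable roots, and the affine part, of size `N⁻²`, restores the
zero boundary values. The residual of `S` is `O(ε₁ + ε₂²) = O(N⁻²)`. The roots satisfy the
characteristic equation at every point, so the layers leave only `ε₁ g' w`, of `L²` norm `O(ε₁ √μ)`,
which is at most `C √ν/N`. Coercivity turns the residual bound into a bound of `u - U`
(`energyNorm_sub_le_of_approx`).

The trial function `P` interpolates `S` everywhere. Each layer is interpolated only up to the last
but one node of its layer mesh and is then cut off to zero, because the last layer interval can be
too long for the layer estimate. With `κ = p/(2τ)` the mesh makes `exp(-2κμx_i)` affine in `i`, so a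
step `h` satisfies `κ μ h exp(-2κμ x_{i+1}) ≤ 2/N`. From `τ ≥ 5/2` and `p < 1` one gets `exp(-μx) ≤
exp(-κμx)^5`: four of the powers pay for `h²`, and the fifth survives and contributes a factor
`μ^(-1/2)` to `L²` norms (`IsLayer.exists_approx`).

By coercivity and Galerkin orthogonality it remains to bound `a(P - U, v)` for `v = P - uN`. Only
convection is delicate. For the smooth part and the left layer it is estimated directly, since `ε₂
√μ₀ ≤ C √ν`. For the right layer the derivative is moved to `v`; the factor `1/√ε₁` this costs is
recovered from the `μ₁^(-1/2)` in the `L²` error, because `ε₂ ≤ C √(ε₁ μ₁)` (`abs_bilin_add_le`,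
`robust_bound`). -/

/-! ### Square integrable functions on the unit interval -/

/-- The norm of `L²(0,1)`. -/
def l2 (f : ℝ → ℝ) : ℝ := Real.sqrt (∫ x in Ioo (0 : ℝ) 1, f x ^ 2)

lemma l2_nonneg (f : ℝ → ℝ) : 0 ≤ l2 f := Real.sqrt_nonneg _

lemma sq_l2 (f : ℝ → ℝ) : l2 f ^ 2 = ∫ x in Ioo (0 : ℝ) 1, f x ^ 2 :=
  Real.sq_sqrt (integral_nonneg fun _ => sq_nonneg _)

lemma inner_toLp {f g : ℝ → ℝ} (hf : MemLp f 2 volΩ) (hg : MemLp g 2 volΩ) :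
    inner ℝ (hf.toLp f) (hg.toLp g) = ∫ x in Ioo (0 : ℝ) 1, f x * g x := by
  rw [L2.inner_def]
  apply integral_congr_ae
  filter_upwards [hf.coeFn_toLp, hg.coeFn_toLp] with x h1 h2
  rw [h1, h2]
  simp [mul_comm]

lemma norm_toLp_eq_l2 {f : ℝ → ℝ} (hf : MemLp f 2 volΩ) : ‖hf.toLp f‖ = l2 f := by
  rw [l2, ← Real.sqrt_sq (norm_nonneg (hf.toLp f)), ← real_inner_self_eq_norm_sq, inner_toLp hf hf]
  simp only [sq]

lemma abs_integral_mul_le {f g : ℝ → ℝ} (hf : MemLp f 2 volΩ) (hg : MemLp g 2 volΩ) :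
    |∫ x in Ioo (0 : ℝ) 1, f x * g x| ≤ l2 f * l2 g := by
  rw [← inner_toLp hf hg, ← norm_toLp_eq_l2 hf, ← norm_toLp_eq_l2 hg]
  exact abs_real_inner_le_norm _ _

lemma MemLp.integrable_mul' {f g : ℝ → ℝ} (hf : MemLp f 2 volΩ) (hg : MemLp g 2 volΩ) :
    Integrable (fun x => f x * g x) volΩ := MemLp.integrable_mul hf hg

lemma tendsto_toLp {f : ℝ → ℝ} {F : ℕ → ℝ → ℝ} (hf : MemLp f 2 volΩ) (hF : ∀ n, MemLp (F n) 2 volΩ)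
    (h : Tendsto (fun n => ∫ x in Ioo (0 : ℝ) 1, (f x - F n x) ^ 2) atTop (𝓝 0)) :
    Tendsto (fun n => (hF n).toLp (F n)) atTop (𝓝 (hf.toLp f)) := by
  rw [tendsto_iff_norm_sub_tendsto_zero]
  have h2 := (Real.continuous_sqrt.tendsto 0).comp h
  rw [Real.sqrt_zero] at h2
  refine h2.congr fun n => ?_
  rw [norm_sub_rev, ← MemLp.toLp_sub, norm_toLp_eq_l2]
  rfl

lemma tendsto_integral_mul {f g : ℝ → ℝ} {F G : ℕ → ℝ → ℝ} (hf : MemLp f 2 volΩ)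
    (hg : MemLp g 2 volΩ) (hF : ∀ n, MemLp (F n) 2 volΩ) (hG : ∀ n, MemLp (G n) 2 volΩ)
    (hfF : Tendsto (fun n => ∫ x in Ioo (0 : ℝ) 1, (f x - F n x) ^ 2) atTop (𝓝 0))
    (hgG : Tendsto (fun n => ∫ x in Ioo (0 : ℝ) 1, (g x - G n x) ^ 2) atTop (𝓝 0)) :
    Tendsto (fun n => ∫ x in Ioo (0 : ℝ) 1, F n x * G n x) atTop
      (𝓝 (∫ x in Ioo (0 : ℝ) 1, f x * g x)) := by
  have := (tendsto_toLp hf hF hfF).inner (𝕜 := ℝ) (tendsto_toLp hg hG hgG)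
  simpa only [inner_toLp] using this

lemma memLp_of_bound {f : ℝ → ℝ} (hf : AEStronglyMeasurable f volΩ) {M : ℝ}
    (h : ∀ᵐ x ∂volΩ, |f x| ≤ M) : MemLp f 2 volΩ :=
  MemLp.of_bound hf M h

lemma ContinuousOn.memLp_two {f : ℝ → ℝ} (hf : ContinuousOn f (Icc 0 1)) : MemLp f 2 volΩ := by
  obtain ⟨M, hM⟩ := isCompact_Icc.exists_bound_of_continuousOn hf
  refine memLp_of_bound ((hf.mono Ioo_subset_Icc_self).aestronglyMeasurable measurableSet_Ioo)
    (M := M) ?_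
  filter_upwards [ae_restrict_mem measurableSet_Ioo] with x hx using hM x (Ioo_subset_Icc_self hx)

lemma _root_.ContinuousOn.mul_memLp_two {f g : ℝ → ℝ} (hf : ContinuousOn f (Icc 0 1))
    (hg : MemLp g 2 volΩ) : MemLp (fun x => f x * g x) 2 volΩ := by
  obtain ⟨M, hM⟩ := isCompact_Icc.exists_bound_of_continuousOn hf
  refine MemLp.of_le_mul (c := M) hg
    (((hf.mono Ioo_subset_Icc_self).aestronglyMeasurable measurableSet_Ioo).mul
      hg.aestronglyMeasurable) ?_
  filter_upwards [ae_restrict_mem measurableSet_Ioo] with x hx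
  rw [norm_mul]
  exact mul_le_mul_of_nonneg_right (hM x (Ioo_subset_Icc_self hx)) (norm_nonneg _)

lemma MemLp.sub_fun {f g : ℝ → ℝ} (hf : MemLp f 2 volΩ) (hg : MemLp g 2 volΩ) :
    MemLp (fun x => f x - g x) 2 volΩ := hf.sub hg

lemma MemLp.add_fun {f g : ℝ → ℝ} (hf : MemLp f 2 volΩ) (hg : MemLp g 2 volΩ) :
    MemLp (fun x => f x + g x) 2 volΩ := hf.add hg

lemma l2_add_le {f g : ℝ → ℝ} (hf : MemLp f 2 volΩ) (hg : MemLp g 2 volΩ) :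
    l2 (fun x => f x + g x) ≤ l2 f + l2 g := by
  have h := norm_add_le (hf.toLp f) (hg.toLp g)
  rw [← MemLp.toLp_add, norm_toLp_eq_l2, norm_toLp_eq_l2, norm_toLp_eq_l2] at h
  exact h

lemma l2_congr {f g : ℝ → ℝ} (h : f =ᵐ[volΩ] g) : l2 f = l2 g := by
  unfold l2
  congr 1
  apply integral_congr_ae
  filter_upwards [h] with x hx
  rw [hx]

lemma l2_mono {f g : ℝ → ℝ} (hg : MemLp g 2 volΩ) (h : ∀ᵐ x ∂volΩ, |f x| ≤ g x) :
    l2 f ≤ l2 g := by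
  apply Real.sqrt_le_sqrt
  apply integral_mono_of_nonneg (Eventually.of_forall fun x => sq_nonneg _) hg.integrable_sq
  filter_upwards [h] with x hx
  exact sq_le_sq' (by linarith [(abs_le.1 hx).1]) (abs_le.1 hx).2

lemma l2_const_mul {k : ℝ} (hk : 0 ≤ k) (f : ℝ → ℝ) : l2 (fun x => k * f x) = k * l2 f := by
  unfold l2
  simp only [mul_pow]
  rw [integral_const_mul, Real.sqrt_mul (sq_nonneg k), Real.sqrt_sq hk]

lemma l2_le_of_abs_le {f : ℝ → ℝ} {M : ℝ} (hM : 0 ≤ M) (h : ∀ᵐ x ∂volΩ, |f x| ≤ M) : l2 f ≤ M := by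
  refine (l2_mono (g := fun _ => M) (memLp_const M) h).trans_eq ?_
  simp [l2, Real.sqrt_sq hM]

/-! ### Test functions -/

namespace IsTestFunction

variable {φ ψ : ℝ → ℝ}

lemma zero : IsTestFunction fun _ => 0 :=
  ⟨contDiff_const, HasCompactSupport.zero, by
    rw [tsupport_eq_empty_iff.2 (by rfl)]; exact empty_subset _⟩

lemma continuous (h : IsTestFunction φ) : Continuous φ := h.1.continuous

lemma contDiff_deriv (h : IsTestFunction φ) : ContDiff ℝ ∞ (deriv φ) :=
  (contDiff_infty_iff_deriv.1 h.1).2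

lemma differentiable (h : IsTestFunction φ) : Differentiable ℝ φ :=
  (contDiff_infty_iff_deriv.1 h.1).1

lemma memLp (h : IsTestFunction φ) : MemLp φ 2 volΩ :=
  ContinuousOn.memLp_two h.continuous.continuousOn

lemma memLp_deriv (h : IsTestFunction φ) : MemLp (deriv φ) 2 volΩ :=
  ContinuousOn.memLp_two h.contDiff_deriv.continuous.continuousOn

lemma eq_zero (h : IsTestFunction φ) {x : ℝ} (hx : x ∉ Ioo (0 : ℝ) 1) : φ x = 0 :=
  image_eq_zero_of_notMem_tsupport fun h' => hx (h.2.2 h')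

lemma add (h : IsTestFunction φ) (h' : IsTestFunction ψ) : IsTestFunction (fun x => φ x + ψ x) :=
  ⟨h.1.add h'.1, h.2.1.add h'.2.1, (tsupport_add φ ψ).trans (union_subset h.2.2 h'.2.2)⟩

lemma const_mul (h : IsTestFunction φ) (k : ℝ) : IsTestFunction (fun x => k * φ x) := by
  refine ⟨contDiff_const.mul h.1, h.2.1.mul_left (f := fun _ => k), ?_⟩
  exact (tsupport_mul_subset_right (f := fun _ => k) (g := φ)).trans h.2.2

lemma sub (h : IsTestFunction φ) (h' : IsTestFunction ψ) : IsTestFunction (fun x => φ x - ψ x) := by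
  simpa [sub_eq_add_neg] using h.add (h'.const_mul (-1))

end IsTestFunction

/-- A test function with mean value zero is the derivative of a test function. -/
lemma IsTestFunction.exists_primitive {ψ : ℝ → ℝ} (h : IsTestFunction ψ)
    (h0 : ∫ x in Ioo (0 : ℝ) 1, ψ x = 0) : ∃ φ, IsTestFunction φ ∧ deriv φ = ψ := by
  rcases (tsupport ψ).eq_empty_or_nonempty with he | hne
  · have : ψ = 0 := by rwa [tsupport_eq_empty_iff] at he
    exact ⟨fun _ => 0, .zero, by rw [this]; ext; simp⟩
  have hK : IsCompact (tsupport ψ) := h.2.1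
  obtain ⟨a, ha, hal⟩ := hK.exists_isLeast hne
  obtain ⟨b, hb, hbl⟩ := hK.exists_isGreatest hne
  have ha' := h.2.2 ha
  have hb' := h.2.2 hb
  have hzl : ∀ x < a, ψ x = 0 := fun x hx =>
    image_eq_zero_of_notMem_tsupport fun h' => absurd (hal h') (not_le.2 hx)
  have hzr : ∀ x, b < x → ψ x = 0 := fun x hx =>
    image_eq_zero_of_notMem_tsupport fun h' => absurd (hbl h') (not_le.2 hx)
  have hd : ∀ x, HasDerivAt (fun y => ∫ t in (0 : ℝ)..y, ψ t) (ψ x) x := fun x =>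
    intervalIntegral.integral_hasDerivAt_right (h.continuous.intervalIntegrable _ _)
      (h.continuous.stronglyMeasurableAtFilter _ _) h.continuous.continuousAt
  have hde : deriv (fun y => ∫ t in (0 : ℝ)..y, ψ t) = ψ := funext fun x => (hd x).deriv
  have h01 : ∫ t in (0 : ℝ)..1, ψ t = 0 := by
    rw [intervalIntegral.integral_of_le zero_le_one, integral_Ioc_eq_integral_Ioo, h0]
  have hs : Function.support (fun y => ∫ t in (0 : ℝ)..y, ψ t) ⊆ Icc a b := by
    intro x hx
    by_contra hx'
    apply hx
    rw [mem_Icc, not_and_or, not_le, not_le] at hx'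
    rcases hx' with hx' | hx'
    · show ∫ t in (0 : ℝ)..x, ψ t = 0
      rw [intervalIntegral.integral_congr (g := fun _ => 0), intervalIntegral.integral_zero]
      intro t ht
      apply hzl
      exact lt_of_le_of_lt ht.2 (max_lt ha'.1 hx')
    -- To the right of the support the primitive has the value of the full integral over `(0,1)`,
    -- which is zero.
    · show ∫ t in (0 : ℝ)..x, ψ t = 0
      rw [← intervalIntegral.integral_add_adjacent_intervals (b := 1)
        (h.continuous.intervalIntegrable _ _) (h.continuous.intervalIntegrable _ _), h01,
        intervalIntegral.integral_congr (g := fun _ => 0), intervalIntegral.integral_zero, add_zero]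
      intro t ht
      apply hzr
      exact lt_of_lt_of_le (lt_min hb'.2 hx') ht.1
  refine ⟨_, ⟨?_, HasCompactSupport.of_support_subset_isCompact isCompact_Icc hs, ?_⟩, hde⟩
  · rw [contDiff_infty_iff_deriv, hde]
    exact ⟨fun x => (hd x).differentiableAt, h.1⟩
  · refine (closure_minimal hs isClosed_Icc).trans fun x hx => ⟨ha'.1.trans_le hx.1, hx.2.trans_lt hb'.2⟩

lemma exists_testFunction_integral_one :
    ∃ ρ, IsTestFunction ρ ∧ ∫ x in Ioo (0 : ℝ) 1, ρ x = 1 := by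
  let B : ContDiffBump (1 / 2 : ℝ) := ⟨1 / 8, 1 / 4, by norm_num, by norm_num⟩
  have hts : tsupport (B.normed volume) ⊆ Ioo (0 : ℝ) 1 := by
    rw [B.tsupport_normed_eq, Real.closedBall_eq_Icc]
    intro x hx
    constructor <;> norm_num [B] at hx ⊢ <;> linarith [hx.1, hx.2]
  refine ⟨B.normed volume, ⟨B.contDiff_normed, B.hasCompactSupport_normed, hts⟩, ?_⟩
  rw [setIntegral_eq_integral_of_forall_compl_eq_zero, B.integral_normed]
  exact fun x hx => image_eq_zero_of_notMem_tsupport fun h => hx (hts h)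

/-- Lemma of du Bois-Reymond. -/
lemma ae_eq_const_of_integral_deriv_eq_zero {h : ℝ → ℝ} (hh : MemLp h 2 volΩ)
    (H : ∀ φ, IsTestFunction φ → ∫ x in Ioo (0 : ℝ) 1, h x * deriv φ x = 0) :
    ∃ k : ℝ, h =ᵐ[volΩ] fun _ => k := by
  obtain ⟨ρ, hρ, hρ1⟩ := exists_testFunction_integral_one
  refine ⟨∫ x in Ioo (0 : ℝ) 1, h x * ρ x, ?_⟩
  set k := ∫ x in Ioo (0 : ℝ) 1, h x * ρ x with hk
  have hi : Integrable h volΩ := hh.integrable (by norm_num)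
  have key := IsOpen.ae_eq_zero_of_integral_contDiff_smul_eq_zero (μ := volume)
    (f := fun x => h x - k) (U := Ioo (0 : ℝ) 1) isOpen_Ioo
    (IntegrableOn.locallyIntegrableOn (hi.sub (integrable_const k))) (by
      intro φ hφ hc hs
      have hT : IsTestFunction φ := ⟨hφ, hc, hs⟩
      have iφ : Integrable φ volΩ := hT.memLp.integrable (by norm_num)
      have iρ : Integrable ρ volΩ := hρ.memLp.integrable (by norm_num)
      set m := ∫ x in Ioo (0 : ℝ) 1, φ x with hm
      -- Subtracting the multiple `m ρ` makes the mean value zero, so that the difference is an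
      -- admissible `χ'`. Testing `h` with it gives `∫ h φ = k ∫ φ`.
      obtain ⟨χ, hχ, hχd⟩ := (hT.sub (hρ.const_mul m)).exists_primitive (by
        rw [integral_sub iφ (iρ.const_mul m), integral_const_mul, hρ1, mul_one, sub_self])
      have e := H χ hχ
      rw [hχd] at e
      have i1 := MemLp.integrable_mul' hh hT.memLp
      have i2 := MemLp.integrable_mul' hh hρ.memLp
      have e2 : ∫ x in Ioo (0 : ℝ) 1, h x * (φ x - m * ρ x) =
          (∫ x in Ioo (0 : ℝ) 1, h x * φ x) - m * k := by
        rw [hk, ← integral_const_mul, ← integral_sub i1 (i2.const_mul m)]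
        congr 1; ext x; ring
      rw [e2] at e
      rw [← setIntegral_eq_integral_of_forall_compl_eq_zero (s := Ioo (0 : ℝ) 1)]
      · have : ∀ x, φ x • (h x - k) = h x * φ x - k * φ x := fun x => by
          simp only [smul_eq_mul]; ring
        simp only [this]
        rw [integral_sub i1 (iφ.const_mul k), integral_const_mul]
        linarith
      · intro x hx
        simp [hT.eq_zero hx])
  rw [Filter.EventuallyEq, ae_restrict_iff' measurableSet_Ioo]
  filter_upwards [key] with x hx hxm
  exact sub_eq_zero.1 (hx hxm)

lemma toLp_eq_of_eq {f g : ℝ → ℝ} (hf : MemLp f 2 volΩ) (hg : MemLp g 2 volΩ) (h : f = g) :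
    hf.toLp f = hg.toLp g := by subst h; rfl

/-- The derivatives of test functions, as a subspace of `L²(0,1)`. -/
def testDerivs : Submodule ℝ (Lp ℝ 2 volΩ) where
  carrier := {F | ∃ φ, ∃ h : IsTestFunction φ, h.memLp_deriv.toLp (deriv φ) = F}
  zero_mem' := by
    have h : IsTestFunction fun _ => 0 := .zero
    refine ⟨_, h, ?_⟩
    rw [toLp_eq_of_eq h.memLp_deriv MemLp.zero (by ext; simp)]
    exact MemLp.toLp_zero _
  add_mem' := by
    rintro _ _ ⟨φ, h, rfl⟩ ⟨ψ, h', rfl⟩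
    refine ⟨_, h.add h', ?_⟩
    rw [← MemLp.toLp_add]
    apply toLp_eq_of_eq
    ext x
    exact deriv_fun_add (h.differentiable x) (h'.differentiable x)
  smul_mem' := by
    rintro k _ ⟨φ, h, rfl⟩
    refine ⟨_, h.const_mul k, ?_⟩
    rw [← MemLp.toLp_const_smul]
    apply toLp_eq_of_eq
    ext x
    exact deriv_const_mul k (h.differentiable x)

/-- A square integrable function with mean value zero is the limit in `L²(0,1)` of derivatives of
test functions. -/
lemma exists_seq_testFunction_deriv {g : ℝ → ℝ} (hg : MemLp g 2 volΩ)
    (h0 : ∫ x in Ioo (0 : ℝ) 1, g x = 0) :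
    ∃ φ : ℕ → ℝ → ℝ, (∀ n, IsTestFunction (φ n)) ∧
      Tendsto (fun n => ∫ x in Ioo (0 : ℝ) 1, (g x - deriv (φ n) x) ^ 2) atTop (𝓝 0) := by
  -- Closure equals double orthogonal complement. By du Bois-Reymond, whatever is orthogonal to all
  -- derivatives of test functions is constant, and `g` is orthogonal to constants.
  have hmem : hg.toLp g ∈ testDerivs.topologicalClosure := by
    rw [← Submodule.orthogonal_orthogonal_eq_closure, Submodule.mem_orthogonal]
    intro h hh
    rw [Submodule.mem_orthogonal'] at hh
    have hL : MemLp h 2 volΩ := Lp.memLp h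
    have hh' : ∀ φ, IsTestFunction φ → ∫ x in Ioo (0 : ℝ) 1, h x * deriv φ x = 0 := by
      intro φ hφ
      rw [← inner_toLp hL hφ.memLp_deriv, Lp.toLp_coeFn]
      exact hh _ ⟨φ, hφ, rfl⟩
    obtain ⟨k, hk⟩ := ae_eq_const_of_integral_deriv_eq_zero hL hh'
    rw [← Lp.toLp_coeFn h hL, inner_toLp hL hg]
    have : ∫ x in Ioo (0 : ℝ) 1, h x * g x = ∫ x in Ioo (0 : ℝ) 1, k * g x := by
      apply integral_congr_ae
      filter_upwards [hk] with x hx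
      rw [hx]
    rw [this, integral_const_mul, h0, mul_zero]
  obtain ⟨F, hF, hFl⟩ := mem_closure_iff_seq_limit.1 hmem
  choose φ hφ hφF using hF
  refine ⟨φ, hφ, ?_⟩
  have h2 := (tendsto_iff_norm_sub_tendsto_zero.1 hFl).pow 2
  rw [zero_pow two_ne_zero] at h2
  refine h2.congr fun n => ?_
  rw [← hφF n, norm_sub_rev, ← MemLp.toLp_sub, norm_toLp_eq_l2, sq_l2]
  rfl

/-! ### Piecewise differentiable functions -/

/-- `v` is continuous on `[0,1]` and, off a countable set, differentiable on `(0,1)` with a bounded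
derivative. -/
def PiecewiseDiff (v : ℝ → ℝ) : Prop :=
  ContinuousOn v (Icc 0 1) ∧ ∃ s : Set ℝ, s.Countable ∧ ∃ M : ℝ,
    ∀ x ∈ Ioo (0 : ℝ) 1 \ s, DifferentiableAt ℝ v x ∧ |deriv v x| ≤ M

lemma ae_of_forall_diff_countable {s : Set ℝ} (hs : s.Countable) {P : ℝ → Prop}
    (h : ∀ x ∈ Ioo (0 : ℝ) 1 \ s, P x) : ∀ᵐ x ∂volΩ, P x := by
  rw [ae_restrict_iff' measurableSet_Ioo]
  filter_upwards [hs.ae_notMem volume] with x hx hx' using h x ⟨hx', hx⟩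

namespace PiecewiseDiff

variable {u v : ℝ → ℝ}

lemma of_hasDerivAt {v' : ℝ → ℝ} {M : ℝ} (hv : ContinuousOn v (Icc 0 1)) {s : Set ℝ}
    (hs : s.Countable) (h : ∀ x ∈ Ioo (0 : ℝ) 1 \ s, HasDerivAt v (v' x) x)
    (hM : ∀ x ∈ Ioo (0 : ℝ) 1 \ s, |v' x| ≤ M) : PiecewiseDiff v :=
  ⟨hv, s, hs, M, fun x hx => ⟨(h x hx).differentiableAt, by rw [(h x hx).deriv]; exact hM x hx⟩⟩

lemma ae_differentiableAt (hv : PiecewiseDiff v) : ∀ᵐ x ∂volΩ, DifferentiableAt ℝ v x := by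
  obtain ⟨_, s, hs, M, h⟩ := hv
  exact ae_of_forall_diff_countable hs fun x hx => (h x hx).1

lemma memLp (hv : PiecewiseDiff v) : MemLp v 2 volΩ := ContinuousOn.memLp_two hv.1

lemma memLp_deriv (hv : PiecewiseDiff v) : MemLp (deriv v) 2 volΩ := by
  obtain ⟨_, s, hs, M, h⟩ := hv
  exact memLp_of_bound (measurable_deriv v).aestronglyMeasurable
    (ae_of_forall_diff_countable hs fun x hx => (h x hx).2)

lemma add (hu : PiecewiseDiff u) (hv : PiecewiseDiff v) : PiecewiseDiff (fun x => u x + v x) := by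
  obtain ⟨c, s, hs, M, h⟩ := hu
  obtain ⟨c', s', hs', M', h'⟩ := hv
  refine of_hasDerivAt (v' := fun x => deriv u x + deriv v x) (M := M + M') (c.add c')
    (hs.union hs') (fun x hx => ?_) fun x hx => ?_ <;>
    (rw [← sdiff_sdiff] at hx
     have h1 := h x hx.1
     have h2 := h' x ⟨hx.1.1, hx.2⟩)
  · exact h1.1.hasDerivAt.add h2.1.hasDerivAt
  · exact (abs_add_le _ _).trans (add_le_add h1.2 h2.2)

lemma mul (hu : PiecewiseDiff u) (hv : PiecewiseDiff v) : PiecewiseDiff (fun x => u x * v x) := by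
  obtain ⟨c, s, hs, M, h⟩ := hu
  obtain ⟨c', s', hs', M', h'⟩ := hv
  obtain ⟨K, hK⟩ := isCompact_Icc.exists_bound_of_continuousOn c
  obtain ⟨K', hK'⟩ := isCompact_Icc.exists_bound_of_continuousOn c'
  refine of_hasDerivAt (v' := fun x => deriv u x * v x + u x * deriv v x) (M := M * K' + K * M')
    (c.mul c') (hs.union hs') (fun x hx => ?_) fun x hx => ?_ <;>
    (rw [← sdiff_sdiff] at hx
     have h1 := h x hx.1
     have h2 := h' x ⟨hx.1.1, hx.2⟩)
  · exact h1.1.hasDerivAt.mul h2.1.hasDerivAt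
  · have k1 := hK x (Ioo_subset_Icc_self hx.1.1)
    have k2 := hK' x (Ioo_subset_Icc_self hx.1.1)
    rw [Real.norm_eq_abs] at k1 k2
    refine (abs_add_le _ _).trans (add_le_add ?_ ?_) <;> rw [abs_mul]
    · exact mul_le_mul h1.2 k2 (abs_nonneg _) ((abs_nonneg _).trans h1.2)
    · exact mul_le_mul k1 h2.2 (abs_nonneg _) ((abs_nonneg _).trans k1)

lemma const (k : ℝ) : PiecewiseDiff fun _ => k :=
  of_hasDerivAt (v' := fun _ => 0) (M := 0) continuousOn_const countable_empty
    (fun x _ => hasDerivAt_const x k) (by simp)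

lemma const_mul (k : ℝ) (hv : PiecewiseDiff v) : PiecewiseDiff fun x => k * v x :=
  (const k).mul hv

lemma sub (hu : PiecewiseDiff u) (hv : PiecewiseDiff v) : PiecewiseDiff (fun x => u x - v x) := by
  simpa [sub_eq_add_neg] using hu.add (hv.const_mul (-1))

lemma deriv_sub_ae (hu : PiecewiseDiff u) (hv : PiecewiseDiff v) :
    deriv (fun x => u x - v x) =ᵐ[volΩ] fun x => deriv u x - deriv v x := by
  filter_upwards [hu.ae_differentiableAt, hv.ae_differentiableAt] with x h1 h2
  exact deriv_fun_sub h1 h2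

lemma deriv_mul_ae (hu : PiecewiseDiff u) (hv : PiecewiseDiff v) :
    deriv (fun x => u x * v x) =ᵐ[volΩ] fun x => deriv u x * v x + u x * deriv v x := by
  filter_upwards [hu.ae_differentiableAt, hv.ae_differentiableAt] with x h1 h2
  exact deriv_fun_mul h1 h2

lemma integral_deriv_eq_sub (hv : PiecewiseDiff v) {x : ℝ} (hx : x ∈ Icc (0 : ℝ) 1) :
    ∫ t in (0 : ℝ)..x, deriv v t = v x - v 0 := by
  have hi : Integrable (deriv v) volΩ := hv.memLp_deriv.integrable (by norm_num)
  obtain ⟨c, s, hs, M, h⟩ := hv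
  refine integral_eq_of_hasDerivAt_off_countable_of_le v (deriv v) hx.1 hs
    (c.mono (Icc_subset_Icc_right hx.2))
    (fun t ht => (h t ⟨⟨ht.1.1, ht.1.2.trans_le hx.2⟩, ht.2⟩).1.hasDerivAt) ?_
  rw [intervalIntegrable_iff_integrableOn_Ioo_of_le hx.1]
  exact IntegrableOn.mono_set hi (Ioo_subset_Ioo_right hx.2)

lemma integral_deriv (hv : PiecewiseDiff v) :
    ∫ t in Ioo (0 : ℝ) 1, deriv v t = v 1 - v 0 := by
  rw [← hv.integral_deriv_eq_sub (right_mem_Icc.2 zero_le_one),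
    intervalIntegral.integral_of_le zero_le_one, integral_Ioc_eq_integral_Ioo]

/-- Integration by parts. -/
lemma integral_deriv_mul (hu : PiecewiseDiff u) (hv : PiecewiseDiff v) :
    ∫ x in Ioo (0 : ℝ) 1, deriv u x * v x =
      u 1 * v 1 - u 0 * v 0 - ∫ x in Ioo (0 : ℝ) 1, u x * deriv v x := by
  have h := (hu.mul hv).integral_deriv
  rw [integral_congr_ae (hu.deriv_mul_ae hv), integral_add
    (MemLp.integrable_mul' hu.memLp_deriv hv.memLp)
    (MemLp.integrable_mul' hu.memLp hv.memLp_deriv)] at h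
  linarith

/-- Fundamental theorem of calculus from the left end point, then Cauchy-Schwarz against `1` on an
interval of length one. -/
lemma abs_le_l2_deriv (hv : PiecewiseDiff v) (h0 : v 0 = 0) {x : ℝ} (hx : x ∈ Icc (0 : ℝ) 1) :
    |v x| ≤ l2 (deriv v) := by
  have hi : Integrable (deriv v) volΩ := hv.memLp_deriv.integrable (by norm_num)
  have e := hv.integral_deriv_eq_sub hx
  rw [h0, sub_zero, intervalIntegral.integral_of_le hx.1, integral_Ioc_eq_integral_Ioo] at e
  rw [← e]
  calc |∫ t in Ioo 0 x, deriv v t| ≤ ∫ t in Ioo 0 x, |deriv v t| := abs_integral_le_integral_abs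
    _ ≤ ∫ t in Ioo (0 : ℝ) 1, |deriv v t| :=
      setIntegral_mono_set hi.abs (Eventually.of_forall fun _ => abs_nonneg _)
        (Ioo_subset_Ioo_right hx.2).eventuallyLE
    _ ≤ |∫ t in Ioo (0 : ℝ) 1, |deriv v t| * 1| := by simp only [mul_one]; exact le_abs_self _
    _ ≤ l2 (fun t => |deriv v t|) * l2 (fun _ => 1) :=
      abs_integral_mul_le hv.memLp_deriv.abs (memLp_const 1)
    _ = l2 (deriv v) := by simp [l2]

end PiecewiseDiff

lemma IsTestFunction.piecewiseDiff {φ : ℝ → ℝ} (h : IsTestFunction φ) : PiecewiseDiff φ := by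
  obtain ⟨M, hM⟩ := isCompact_Icc.exists_bound_of_continuousOn
    (s := Icc (0 : ℝ) 1) h.contDiff_deriv.continuous.continuousOn
  exact ⟨h.continuous.continuousOn, ∅, countable_empty, M, fun x hx =>
    ⟨h.differentiable x, hM x (Ioo_subset_Icc_self hx.1)⟩⟩

namespace PiecewiseDiff

variable {u v : ℝ → ℝ}

lemma hasWeakDeriv (hv : PiecewiseDiff v) : HasWeakDeriv v (deriv v) := by
  refine ⟨hv.memLp_deriv, fun φ hφ => ?_⟩
  have := hv.integral_deriv_mul hφ.piecewiseDiff
  rw [hφ.eq_zero (by simp), hφ.eq_zero (by simp)] at this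
  linarith

lemma memH1 (hv : PiecewiseDiff v) : MemH1 v := ⟨hv.memLp, _, hv.hasWeakDeriv⟩

lemma weakDeriv_ae (hv : PiecewiseDiff v) : weakDeriv v =ᵐ[volΩ] deriv v :=
  hv.memH1.hasWeakDeriv.ae_eq hv.hasWeakDeriv

/-- Equal end values give `v'` mean value zero, hence `v'` is an `L²` limit of some `φ n'`. Since `v
- φ n` vanishes at `0`, it is bounded by the `L²` norm of its derivative, so the functions converge
along with the derivatives. This is what places finite element functions and `U` in `H₀¹`. -/
lemma memH10 (hv : PiecewiseDiff v) (h0 : v 0 = 0) (h1 : v 1 = 0) : MemH10 v := by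
  refine ⟨hv.memH1, ?_⟩
  obtain ⟨φ, hφ, hl⟩ := exists_seq_testFunction_deriv hv.memLp_deriv (by
    rw [hv.integral_deriv, h0, h1, sub_zero])
  refine ⟨φ, hφ, ?_⟩
  have e : ∀ n, ∫ x in Ioo (0 : ℝ) 1, (weakDeriv v x - deriv (φ n) x) ^ 2 =
      ∫ x in Ioo (0 : ℝ) 1, (deriv v x - deriv (φ n) x) ^ 2 := fun n => by
    apply integral_congr_ae
    filter_upwards [hv.weakDeriv_ae] with x hx
    rw [hx]
  simp only [e]
  have hb : ∀ n, ∫ x in Ioo (0 : ℝ) 1, (v x - φ n x) ^ 2 ≤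
      ∫ x in Ioo (0 : ℝ) 1, (deriv v x - deriv (φ n) x) ^ 2 := fun n => by
    have hw := hv.sub (hφ n).piecewiseDiff
    rw [← sq_l2 fun x => v x - φ n x, ← sq_l2 fun x => deriv v x - deriv (φ n) x,
      ← l2_congr (hv.deriv_sub_ae (hφ n).piecewiseDiff)]
    refine pow_le_pow_left₀ (l2_nonneg _) (l2_le_of_abs_le (l2_nonneg _) ?_) 2
    filter_upwards [ae_restrict_mem measurableSet_Ioo] with x hx
    exact hw.abs_le_l2_deriv (by simp [h0, (hφ n).eq_zero]) (Ioo_subset_Icc_self hx)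
  have := (squeeze_zero (fun n => integral_nonneg fun x => sq_nonneg _) hb hl).add hl
  rwa [add_zero] at this

end PiecewiseDiff

/-! ### Functions in `H₀¹(0,1)` -/

namespace MemH10

variable {v w : ℝ → ℝ}

lemma memLp (h : MemH10 v) : MemLp v 2 volΩ := h.1.1

lemma memLp_weakDeriv (h : MemH10 v) : MemLp (weakDeriv v) 2 volΩ := h.1.hasWeakDeriv.1

lemma exists_seq (h : MemH10 v) : ∃ φ : ℕ → ℝ → ℝ, (∀ n, IsTestFunction (φ n)) ∧
    Tendsto (fun n => ∫ x in Ioo (0 : ℝ) 1, (v x - φ n x) ^ 2) atTop (𝓝 0) ∧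
    Tendsto (fun n => ∫ x in Ioo (0 : ℝ) 1, (weakDeriv v x - deriv (φ n) x) ^ 2) atTop (𝓝 0) := by
  obtain ⟨_, φ, hφ, hl⟩ := h
  refine ⟨φ, hφ, squeeze_zero (fun n => integral_nonneg fun x => sq_nonneg _) (fun n => ?_) hl,
    squeeze_zero (fun n => integral_nonneg fun x => sq_nonneg _) (fun n => ?_) hl⟩
  · exact le_add_of_nonneg_right (integral_nonneg fun x => sq_nonneg _)
  · exact le_add_of_nonneg_left (integral_nonneg fun x => sq_nonneg _)

lemma _root_.TwoParam.HasWeakDeriv.sub {g g' : ℝ → ℝ} (hv : MemLp v 2 volΩ) (hw : MemLp w 2 volΩ)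
    (h : HasWeakDeriv v g) (h' : HasWeakDeriv w g') :
    HasWeakDeriv (fun x => v x - w x) (fun x => g x - g' x) := by
  refine ⟨MemLp.sub_fun h.1 h'.1, fun φ hφ => ?_⟩
  simp only [sub_mul]
  rw [integral_sub (MemLp.integrable_mul' hv hφ.memLp_deriv)
    (MemLp.integrable_mul' hw hφ.memLp_deriv), integral_sub
    (MemLp.integrable_mul' h.1 hφ.memLp) (MemLp.integrable_mul' h'.1 hφ.memLp), h.2 φ hφ, h'.2 φ hφ]
  ring

lemma weakDeriv_sub_ae (hv : MemH10 v) (hw : MemH10 w) :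
    weakDeriv (fun x => v x - w x) =ᵐ[volΩ] fun x => weakDeriv v x - weakDeriv w x := by
  have h := HasWeakDeriv.sub hv.memLp hw.memLp hv.1.hasWeakDeriv hw.1.hasWeakDeriv
  exact (MemH1.hasWeakDeriv ⟨MemLp.sub_fun hv.memLp hw.memLp, _, h⟩).ae_eq h

lemma integral_sq_sub_sub_le {f g F G : ℝ → ℝ} (hf : MemLp f 2 volΩ) (hg : MemLp g 2 volΩ)
    (hF : MemLp F 2 volΩ) (hG : MemLp G 2 volΩ) :
    ∫ x in Ioo (0 : ℝ) 1, ((f x - g x) - (F x - G x)) ^ 2 ≤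
      2 * (∫ x in Ioo (0 : ℝ) 1, (f x - F x) ^ 2) + 2 * ∫ x in Ioo (0 : ℝ) 1, (g x - G x) ^ 2 := by
  have h1 := (MemLp.sub_fun hf hF).integrable_sq
  have h2 := (MemLp.sub_fun hg hG).integrable_sq
  rw [← integral_const_mul, ← integral_const_mul, ← integral_add (h1.const_mul 2) (h2.const_mul 2)]
  apply integral_mono (MemLp.sub_fun (MemLp.sub_fun hf hg) (MemLp.sub_fun hF hG)).integrable_sq
    ((h1.const_mul 2).add (h2.const_mul 2))
  intro x
  simp only [Pi.add_apply]
  nlinarith [sq_nonneg (f x - F x + (g x - G x))]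

lemma sub (hv : MemH10 v) (hw : MemH10 w) : MemH10 (fun x => v x - w x) := by
  have hd := hv.weakDeriv_sub_ae hw
  refine ⟨⟨MemLp.sub_fun hv.memLp hw.memLp, _,
    HasWeakDeriv.sub hv.memLp hw.memLp hv.1.hasWeakDeriv hw.1.hasWeakDeriv⟩, ?_⟩
  obtain ⟨φ, hφ, h1, h2⟩ := hv.exists_seq
  obtain ⟨ψ, hψ, h3, h4⟩ := hw.exists_seq
  refine ⟨fun n x => φ n x - ψ n x, fun n => (hφ n).sub (hψ n), ?_⟩
  have l1 := ((h1.const_mul 2).add (h3.const_mul 2)).add ((h2.const_mul 2).add (h4.const_mul 2))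
  simp only [mul_zero, add_zero] at l1
  refine squeeze_zero (fun n => add_nonneg (integral_nonneg fun x => sq_nonneg _)
    (integral_nonneg fun x => sq_nonneg _)) (fun n => add_le_add ?_ ?_) l1
  · exact integral_sq_sub_sub_le hv.memLp hw.memLp (hφ n).memLp (hψ n).memLp
  · refine le_trans (le_of_eq ?_) (integral_sq_sub_sub_le hv.memLp_weakDeriv hw.memLp_weakDeriv
      (hφ n).memLp_deriv (hψ n).memLp_deriv)
    apply integral_congr_ae
    filter_upwards [hd] with x hx
    rw [hx, deriv_fun_sub ((hφ n).differentiable x) ((hψ n).differentiable x)]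

/-- Integration by parts against a function in `H₀¹(0,1)`. -/
lemma integral_deriv_mul {u : ℝ → ℝ} (hu : PiecewiseDiff u) (hv : MemH10 v) :
    ∫ x in Ioo (0 : ℝ) 1, u x * weakDeriv v x = - ∫ x in Ioo (0 : ℝ) 1, deriv u x * v x := by
  obtain ⟨φ, hφ, h1, h2⟩ := hv.exists_seq
  have l1 := tendsto_integral_mul (F := fun _ => u) hu.memLp hv.memLp_weakDeriv (fun _ => hu.memLp)
    (fun n => (hφ n).memLp_deriv) (by simp) h2
  have l2 := tendsto_integral_mul (F := fun _ => deriv u) hu.memLp_deriv hv.memLp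
    (fun _ => hu.memLp_deriv) (fun n => (hφ n).memLp) (by simp) h1
  refine tendsto_nhds_unique l1 (l2.neg.congr fun n => ?_)
  have := hu.integral_deriv_mul (hφ n).piecewiseDiff
  rw [(hφ n).eq_zero (by simp), (hφ n).eq_zero (by simp)] at this
  linarith

lemma tendsto_integral_sq_sub_mul {f b : ℝ → ℝ} {F : ℕ → ℝ → ℝ} (hb : ContinuousOn b (Icc 0 1))
    (hf : MemLp f 2 volΩ) (hF : ∀ n, MemLp (F n) 2 volΩ)
    (h : Tendsto (fun n => ∫ x in Ioo (0 : ℝ) 1, (f x - F n x) ^ 2) atTop (𝓝 0)) :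
    Tendsto (fun n => ∫ x in Ioo (0 : ℝ) 1, (b x * f x - b x * F n x) ^ 2) atTop (𝓝 0) := by
  obtain ⟨M, hM⟩ := isCompact_Icc.exists_bound_of_continuousOn hb
  have l := h.const_mul (M ^ 2)
  rw [mul_zero] at l
  refine squeeze_zero (fun n => integral_nonneg fun x => sq_nonneg _) (fun n => ?_) l
  rw [← integral_const_mul]
  apply integral_mono_of_nonneg (Eventually.of_forall fun x => sq_nonneg _)
    ((MemLp.sub_fun hf (hF n)).integrable_sq.const_mul _)
  filter_upwards [ae_restrict_mem measurableSet_Ioo] with x hx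
  have := hM x (Ioo_subset_Icc_self hx)
  rw [← mul_sub, mul_pow]
  apply mul_le_mul_of_nonneg_right _ (sq_nonneg _)
  rw [Real.norm_eq_abs] at this
  exact sq_le_sq' (by linarith [(abs_le.1 this).1]) (abs_le.1 this).2

/-- `(b v', v) = -½ (b' v, v)` for `v ∈ H₀¹(0,1)`. -/
lemma integral_mul_weakDeriv_mul_self {b : ℝ → ℝ} (hb : PiecewiseDiff b) {b' : ℝ → ℝ}
    (hb' : ContinuousOn b' (Icc 0 1)) (hbb' : deriv b =ᵐ[volΩ] b') (hv : MemH10 v) :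
    ∫ x in Ioo (0 : ℝ) 1, b x * weakDeriv v x * v x =
      - (1 / 2 * ∫ x in Ioo (0 : ℝ) 1, b' x * v x * v x) := by
  obtain ⟨φ, hφ, h1, h2⟩ := hv.exists_seq
  have l1 := tendsto_integral_mul (hb.1.mul_memLp_two hv.memLp_weakDeriv) hv.memLp
    (fun n => hb.1.mul_memLp_two (hφ n).memLp_deriv) (fun n => (hφ n).memLp)
    (tendsto_integral_sq_sub_mul hb.1 hv.memLp_weakDeriv (fun n => (hφ n).memLp_deriv) h2) h1
  have l2 := tendsto_integral_mul (hb'.mul_memLp_two hv.memLp) hv.memLp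
    (fun n => hb'.mul_memLp_two (hφ n).memLp) (fun n => (hφ n).memLp)
    (tendsto_integral_sq_sub_mul hb' hv.memLp (fun n => (hφ n).memLp) h1) h1
  refine tendsto_nhds_unique l1 ((l2.const_mul (1 / 2)).neg.congr fun n => ?_)
  have hp := (hφ n).piecewiseDiff
  -- Integration by parts of `b` against `φ²`, whose derivative is `2 φ φ'`; the limit then
  -- transfers the identity to `v`.
  have e := hb.integral_deriv_mul (hp.mul hp)
  rw [(hφ n).eq_zero (by simp), (hφ n).eq_zero (by simp)] at e
  have e1 : ∫ x in Ioo (0 : ℝ) 1, b' x * φ n x * φ n x =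
      ∫ x in Ioo (0 : ℝ) 1, deriv b x * (φ n x * φ n x) := by
    apply integral_congr_ae
    filter_upwards [hbb'] with x hx
    rw [hx]; ring
  have e2 : ∫ x in Ioo (0 : ℝ) 1, b x * deriv (fun x => φ n x * φ n x) x =
      2 * ∫ x in Ioo (0 : ℝ) 1, b x * deriv (φ n) x * φ n x := by
    rw [← integral_const_mul]
    apply integral_congr_ae
    filter_upwards [hp.deriv_mul_ae hp] with x hx
    rw [hx]; ring
  rw [e1, e, e2]; ring

end MemH10

/-! ### The energy norm and the bilinear form -/

lemma energyNorm_nonneg (ε : ℝ) (v : ℝ → ℝ) : 0 ≤ energyNorm ε v := Real.sqrt_nonneg _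

lemma sq_energyNorm {ε : ℝ} (hε : 0 ≤ ε) (v : ℝ → ℝ) :
    energyNorm ε v ^ 2 = ε * l2 (weakDeriv v) ^ 2 + l2 v ^ 2 := by
  rw [sq_l2, sq_l2, energyNorm, Real.sq_sqrt]
  exact add_nonneg (mul_nonneg hε (integral_nonneg fun _ => sq_nonneg _))
    (integral_nonneg fun _ => sq_nonneg _)

lemma l2_le_energyNorm {ε : ℝ} (hε : 0 ≤ ε) (v : ℝ → ℝ) : l2 v ≤ energyNorm ε v := by
  refine le_of_abs_le (abs_le_of_sq_le_sq ?_ (energyNorm_nonneg _ _))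
  rw [sq_energyNorm hε]
  nlinarith [sq_nonneg (l2 (weakDeriv v))]

lemma sqrt_mul_l2_weakDeriv_le_energyNorm {ε : ℝ} (hε : 0 ≤ ε) (v : ℝ → ℝ) :
    Real.sqrt ε * l2 (weakDeriv v) ≤ energyNorm ε v := by
  refine le_of_abs_le (abs_le_of_sq_le_sq ?_ (energyNorm_nonneg _ _))
  rw [sq_energyNorm hε, mul_pow, Real.sq_sqrt hε]
  nlinarith [sq_nonneg (l2 v)]

lemma energyNorm_le {ε : ℝ} (hε : 0 ≤ ε) (v : ℝ → ℝ) :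
    energyNorm ε v ≤ Real.sqrt ε * l2 (weakDeriv v) + l2 v := by
  have h1 : 0 ≤ Real.sqrt ε * l2 (weakDeriv v) := mul_nonneg (Real.sqrt_nonneg _) (l2_nonneg _)
  refine le_of_abs_le (abs_le_of_sq_le_sq ?_ (add_nonneg h1 (l2_nonneg _)))
  rw [sq_energyNorm hε, add_sq, mul_pow, Real.sq_sqrt hε]
  nlinarith [mul_nonneg h1 (l2_nonneg v)]

lemma l2_sub_le {f g : ℝ → ℝ} (hf : MemLp f 2 volΩ) (hg : MemLp g 2 volΩ) :
    l2 (fun x => f x - g x) ≤ l2 f + l2 g := by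
  have h := norm_sub_le (hf.toLp f) (hg.toLp g)
  rw [← MemLp.toLp_sub, norm_toLp_eq_l2, norm_toLp_eq_l2, norm_toLp_eq_l2] at h
  exact h

/-- The factor `2` comes from passing through the equivalent norm `√ε ‖v'‖ + ‖v‖`; the sharp
triangle inequality is not needed. -/
lemma energyNorm_sub_le {ε : ℝ} (hε : 0 ≤ ε) {v w : ℝ → ℝ} (hv : MemH10 v) (hw : MemH10 w) :
    energyNorm ε (fun x => v x - w x) ≤ 2 * (energyNorm ε v + energyNorm ε w) := by
  refine (energyNorm_le hε _).trans ?_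
  rw [l2_congr (hv.weakDeriv_sub_ae hw)]
  have h1 := mul_le_mul_of_nonneg_left (l2_sub_le hv.memLp_weakDeriv hw.memLp_weakDeriv)
    (Real.sqrt_nonneg ε)
  have h2 := l2_sub_le hv.memLp hw.memLp
  linarith [sqrt_mul_l2_weakDeriv_le_energyNorm hε v, sqrt_mul_l2_weakDeriv_le_energyNorm hε w,
    l2_le_energyNorm hε v, l2_le_energyNorm hε w]

lemma bilin_sub {ε₁ ε₂ : ℝ} {b c : ℝ → ℝ} (hb : ContinuousOn b (Icc 0 1))
    (hc : ContinuousOn c (Icc 0 1)) {u w v : ℝ → ℝ} (hu : MemH10 u) (hw : MemH10 w)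
    (hv : MemH10 v) :
    bilin ε₁ ε₂ b c (fun x => u x - w x) v = bilin ε₁ ε₂ b c u v - bilin ε₁ ε₂ b c w v := by
  have hd := hu.weakDeriv_sub_ae hw
  have e1 : ∫ x in Ioo (0 : ℝ) 1, weakDeriv (fun x => u x - w x) x * weakDeriv v x =
      (∫ x in Ioo (0 : ℝ) 1, weakDeriv u x * weakDeriv v x) -
      ∫ x in Ioo (0 : ℝ) 1, weakDeriv w x * weakDeriv v x := by
    rw [← integral_sub (MemLp.integrable_mul' hu.memLp_weakDeriv hv.memLp_weakDeriv)
      (MemLp.integrable_mul' hw.memLp_weakDeriv hv.memLp_weakDeriv)]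
    apply integral_congr_ae
    filter_upwards [hd] with x hx
    rw [hx]; ring
  have e2 : ∫ x in Ioo (0 : ℝ) 1, b x * weakDeriv (fun x => u x - w x) x * v x =
      (∫ x in Ioo (0 : ℝ) 1, b x * weakDeriv u x * v x) -
      ∫ x in Ioo (0 : ℝ) 1, b x * weakDeriv w x * v x := by
    rw [← integral_sub (MemLp.integrable_mul' (hb.mul_memLp_two hu.memLp_weakDeriv) hv.memLp)
      (MemLp.integrable_mul' (hb.mul_memLp_two hw.memLp_weakDeriv) hv.memLp)]
    apply integral_congr_ae
    filter_upwards [hd] with x hx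
    rw [hx]; ring
  have e3 : ∫ x in Ioo (0 : ℝ) 1, c x * (u x - w x) * v x =
      (∫ x in Ioo (0 : ℝ) 1, c x * u x * v x) -
      ∫ x in Ioo (0 : ℝ) 1, c x * w x * v x := by
    rw [← integral_sub (MemLp.integrable_mul' (hc.mul_memLp_two hu.memLp) hv.memLp)
      (MemLp.integrable_mul' (hc.mul_memLp_two hw.memLp) hv.memLp)]
    congr 1; ext x; ring
  unfold bilin
  rw [e1, e2, e3]
  ring

/-- Coercivity of the bilinear form. -/
lemma le_bilin_self {ε₁ ε₂ γ : ℝ} (hε₁ : 0 ≤ ε₁) {b c b' : ℝ → ℝ} (hb : PiecewiseDiff b)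
    (hb' : ContinuousOn b' (Icc 0 1)) (hbb' : deriv b =ᵐ[volΩ] b') (hc : ContinuousOn c (Icc 0 1))
    (hγ : ∀ x ∈ Icc (0 : ℝ) 1, γ ≤ c x - 1 / 2 * ε₂ * b' x) {v : ℝ → ℝ} (hv : MemH10 v) :
    min 1 γ * energyNorm ε₁ v ^ 2 ≤ bilin ε₁ ε₂ b c v v := by
  have i1 := MemLp.integrable_mul' (hb'.mul_memLp_two hv.memLp) hv.memLp
  have i2 := MemLp.integrable_mul' (hc.mul_memLp_two hv.memLp) hv.memLp
  have i3 := hv.memLp.integrable_sq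
  -- After integration by parts convection acts as the reaction term `-½ ε₂ b'`, and `c - ½ ε₂ b'`
  -- is bounded below by `γ`.
  have key : γ * ∫ x in Ioo (0 : ℝ) 1, v x ^ 2 ≤
      ε₂ * (∫ x in Ioo (0 : ℝ) 1, b x * weakDeriv v x * v x) +
        ∫ x in Ioo (0 : ℝ) 1, c x * v x * v x := by
    rw [MemH10.integral_mul_weakDeriv_mul_self hb hb' hbb' hv]
    have e : ε₂ * -(1 / 2 * ∫ x in Ioo (0 : ℝ) 1, b' x * v x * v x) +
        ∫ x in Ioo (0 : ℝ) 1, c x * v x * v x =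
        ∫ x in Ioo (0 : ℝ) 1, (c x * v x * v x - 1 / 2 * ε₂ * (b' x * v x * v x)) := by
      rw [integral_sub i2 (i1.const_mul _), integral_const_mul]; ring
    rw [e, ← integral_const_mul]
    apply integral_mono_ae (i3.const_mul _) (i2.sub (i1.const_mul _))
    filter_upwards [ae_restrict_mem measurableSet_Ioo] with x hx
    have := mul_le_mul_of_nonneg_right (hγ x (Ioo_subset_Icc_self hx)) (sq_nonneg (v x))
    simp only [Pi.sub_apply]
    linarith
  rw [sq_energyNorm hε₁, sq_l2, sq_l2]
  unfold bilin
  have h1 : ∫ x in Ioo (0 : ℝ) 1, weakDeriv v x * weakDeriv v x =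
      ∫ x in Ioo (0 : ℝ) 1, weakDeriv v x ^ 2 := by simp only [sq]
  have p1 : 0 ≤ ε₁ * ∫ x in Ioo (0 : ℝ) 1, weakDeriv v x ^ 2 :=
    mul_nonneg hε₁ (integral_nonneg fun _ => sq_nonneg _)
  have p2 : 0 ≤ ∫ x in Ioo (0 : ℝ) 1, v x ^ 2 := integral_nonneg fun _ => sq_nonneg _
  rw [h1]
  have m1 := mul_le_mul_of_nonneg_right (min_le_left 1 γ) p1
  have m2 := mul_le_mul_of_nonneg_right (min_le_right 1 γ) p2
  linarith

/-- If `U` is twice differentiable, then `a(U,v) = (LU,v)` for the differential operator `L`. -/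
lemma bilin_eq_integral {ε₁ ε₂ : ℝ} {b c : ℝ → ℝ} (hb : ContinuousOn b (Icc 0 1))
    (hc : ContinuousOn c (Icc 0 1)) {U U' U'' : ℝ → ℝ} (hU : PiecewiseDiff U)
    (hU' : PiecewiseDiff U') (hUd : deriv U =ᵐ[volΩ] U') (hUd' : deriv U' =ᵐ[volΩ] U'')
    {v : ℝ → ℝ} (hv : MemH10 v) :
    bilin ε₁ ε₂ b c U v =
      ∫ x in Ioo (0 : ℝ) 1, (-ε₁ * U'' x + ε₂ * (b x * U' x) + c x * U x) * v x := by
  have hL'' : MemLp U'' 2 volΩ := (memLp_congr_ae hUd').1 hU'.memLp_deriv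
  have hw : weakDeriv U =ᵐ[volΩ] U' := hU.weakDeriv_ae.trans hUd
  have e1 : ∫ x in Ioo (0 : ℝ) 1, weakDeriv U x * weakDeriv v x =
      - ∫ x in Ioo (0 : ℝ) 1, U'' x * v x := by
    have : ∫ x in Ioo (0 : ℝ) 1, weakDeriv U x * weakDeriv v x =
        ∫ x in Ioo (0 : ℝ) 1, U' x * weakDeriv v x := by
      apply integral_congr_ae
      filter_upwards [hw] with x hx
      rw [hx]
    rw [this, MemH10.integral_deriv_mul hU' hv, neg_inj]
    apply integral_congr_ae
    filter_upwards [hUd'] with x hx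
    rw [hx]
  have e2 : ∫ x in Ioo (0 : ℝ) 1, b x * weakDeriv U x * v x =
      ∫ x in Ioo (0 : ℝ) 1, b x * U' x * v x := by
    apply integral_congr_ae
    filter_upwards [hw] with x hx
    rw [hx]
  have i1 := MemLp.integrable_mul' hL'' hv.memLp
  have i2 := MemLp.integrable_mul' (hb.mul_memLp_two hU'.memLp) hv.memLp
  have i3 := MemLp.integrable_mul' (hc.mul_memLp_two hU.memLp) hv.memLp
  have e : ∀ x, (-ε₁ * U'' x + ε₂ * (b x * U' x) + c x * U x) * v x =
      (-ε₁ * (U'' x * v x) + ε₂ * (b x * U' x * v x)) + c x * U x * v x := fun x => by ring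
  unfold bilin
  simp only [e]
  have i12 : Integrable (fun x => -ε₁ * (U'' x * v x) + ε₂ * (b x * U' x * v x)) volΩ :=
    (i1.const_mul _).add (i2.const_mul _)
  rw [e1, e2, integral_add i12 i3,
    integral_add (i1.const_mul _) (i2.const_mul _), integral_const_mul, integral_const_mul]
  ring

lemma le_div_of_mul_sq_le {α x D : ℝ} (hα : 0 < α) (hx : 0 ≤ x) (hD : 0 ≤ D)
    (h : α * x ^ 2 ≤ D * x) : x ≤ D / α := by
  rcases hx.eq_or_lt with rfl | hx
  · positivity
  · rw [le_div_iff₀ hα]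
    have : x * (x * α) ≤ x * D := by linarith
    exact le_of_mul_le_mul_left this hx

/-- The error of a Galerkin method is bounded by the residual of an approximation `U` of the
solution and by the distance between `U` and an element `P` of the trial space. -/
theorem energyNorm_sub_le_of_approx {ε₁ ε₂ γ : ℝ} (hε₁ : 0 ≤ ε₁) (hγ0 : 0 < γ)
    {b c f b' : ℝ → ℝ} (hb : PiecewiseDiff b)
    (hb' : ContinuousOn b' (Icc 0 1)) (hbb' : deriv b =ᵐ[volΩ] b') (hc : ContinuousOn c (Icc 0 1))
    (hf : ContinuousOn f (Icc 0 1))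
    (hγ : ∀ x ∈ Icc (0 : ℝ) 1, γ ≤ c x - 1 / 2 * ε₂ * b' x) {u uN P U U' U'' : ℝ → ℝ}
    (hu : IsWeakSolution ε₁ ε₂ b c f u) (huN : MemH10 uN) (hP : MemH10 P)
    (hGal : bilin ε₁ ε₂ b c uN (fun x => P x - uN x) =
      ∫ x in Ioo (0 : ℝ) 1, f x * (P x - uN x))
    (hU0 : U 0 = 0) (hU1 : U 1 = 0) (hU : PiecewiseDiff U) (hU' : PiecewiseDiff U')
    (hUd : deriv U =ᵐ[volΩ] U') (hUd' : deriv U' =ᵐ[volΩ] U'') {D E R : ℝ}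
    (hR : l2 (fun x => f x - (-ε₁ * U'' x + ε₂ * (b x * U' x) + c x * U x)) ≤ R)
    (hD0 : 0 ≤ D)
    (hD : |bilin ε₁ ε₂ b c (fun x => P x - U x) (fun x => P x - uN x)| ≤
      D * energyNorm ε₁ (fun x => P x - uN x))
    (hE : energyNorm ε₁ (fun x => P x - U x) ≤ E) :
    energyNorm ε₁ (fun x => u x - uN x) ≤ 4 * (E + (D + 2 * R) / min 1 γ) := by
  have hα : 0 < min 1 γ := lt_min one_pos hγ0
  have hUH := hU.memH10 hU0 hU1
  have hL'' : MemLp U'' 2 volΩ := (memLp_congr_ae hUd').1 hU'.memLp_deriv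
  set ρ : ℝ → ℝ := fun x => f x - (-ε₁ * U'' x + ε₂ * (b x * U' x) + c x * U x) with hρ
  have hLU : MemLp (fun x => -ε₁ * U'' x + ε₂ * (b x * U' x) + c x * U x) 2 volΩ :=
    ((hL''.const_mul _).add ((hb.1.mul_memLp_two hU'.memLp).const_mul _)).add
      (hc.mul_memLp_two hU.memLp)
  have hρL : MemLp ρ 2 volΩ := MemLp.sub_fun (ContinuousOn.memLp_two hf) hLU
  have hres : ∀ v, MemH10 v →
      bilin ε₁ ε₂ b c (fun x => u x - U x) v = ∫ x in Ioo (0 : ℝ) 1, ρ x * v x := fun v hv => by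
    rw [bilin_sub hb.1 hc hu.1 hUH hv, hu.2 v hv, bilin_eq_integral hb.1 hc hU hU' hUd hUd' hv,
      ← integral_sub (MemLp.integrable_mul' (ContinuousOn.memLp_two hf) hv.memLp)
      (MemLp.integrable_mul' hLU hv.memLp)]
    congr 1; ext x; rw [hρ]; ring
  have hR0 : 0 ≤ R := (l2_nonneg _).trans hR
  have hres' : ∀ v, MemH10 v →
      |bilin ε₁ ε₂ b c (fun x => u x - U x) v| ≤ R * energyNorm ε₁ v := fun v hv => by
    rw [hres v hv]
    refine (abs_integral_mul_le hρL hv.memLp).trans ?_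
    exact mul_le_mul hR (l2_le_energyNorm hε₁ v) (l2_nonneg _) hR0
  have hw := hu.1.sub hUH
  have b1 : energyNorm ε₁ (fun x => u x - U x) ≤ R / min 1 γ := by
    refine le_div_of_mul_sq_le hα (energyNorm_nonneg _ _) hR0 ?_
    exact (le_bilin_self hε₁ hb hb' hbb' hc hγ hw).trans ((le_abs_self _).trans (hres' _ hw))
  have hv := hP.sub huN
  have hPU := hP.sub hUH
  have b2 : energyNorm ε₁ (fun x => P x - uN x) ≤ (D + R) / min 1 γ := by
    refine le_div_of_mul_sq_le hα (energyNorm_nonneg _ _) (by positivity) ?_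
    refine (le_bilin_self hε₁ hb hb' hbb' hc hγ hv).trans ?_
    -- Galerkin orthogonality: `uN` and `u` have the same right-hand side on `v = P - uN`, so `uN`
    -- may be replaced by `u`, and `U` is inserted.
    have e : bilin ε₁ ε₂ b c (fun x => P x - uN x) (fun x => P x - uN x) =
        bilin ε₁ ε₂ b c (fun x => P x - U x) (fun x => P x - uN x) -
        bilin ε₁ ε₂ b c (fun x => u x - U x) (fun x => P x - uN x) := by
      rw [bilin_sub hb.1 hc hP huN hv, bilin_sub hb.1 hc hP hUH hv, bilin_sub hb.1 hc hu.1 hUH hv,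
        hGal, hu.2 _ hv]
      ring
    rw [e, add_mul]
    linarith [(abs_le.1 (hres' _ hv)).1, (abs_le.1 hD).2]
  -- Two subtractions, each with the factor `2` of `energyNorm_sub_le`, produce the constant `4`.
  have e1 : (fun x => u x - uN x) =
      fun x => (u x - U x) - ((P x - U x) - (P x - uN x)) := by ext x; ring
  rw [e1]
  have t1 := energyNorm_sub_le hε₁ hw (hPU.sub hv)
  have t2 := energyNorm_sub_le hε₁ hPU hv
  have e2 : (D + R) / min 1 γ = D / min 1 γ + R / min 1 γ := add_div _ _ _
  have e3 : (D + 2 * R) / min 1 γ = D / min 1 γ + 2 * (R / min 1 γ) := by rw [add_div]; ring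
  have : 0 ≤ R / min 1 γ := by positivity
  rw [e3]
  linarith

/-- Bound of the bilinear form; the convective term of `η₁` is integrated by parts. -/
lemma abs_bilin_add_le {ε₁ ε₂ B : ℝ} (hε₁ : 0 < ε₁) (hε₂ : 0 ≤ ε₂) {b c b' : ℝ → ℝ}
    (hb : PiecewiseDiff b) (hb' : ContinuousOn b' (Icc 0 1)) (hbb' : deriv b =ᵐ[volΩ] b')
    (hc : ContinuousOn c (Icc 0 1)) (hB0 : 0 ≤ B) (hB : ∀ x ∈ Icc (0 : ℝ) 1, |b x| ≤ B)
    (hB' : ∀ x ∈ Icc (0 : ℝ) 1, |b' x| ≤ B) (hCB : ∀ x ∈ Icc (0 : ℝ) 1, |c x| ≤ B)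
    {η₀ η₁ v : ℝ → ℝ} (h₀ : PiecewiseDiff η₀) (h₁ : PiecewiseDiff η₁) (hv : PiecewiseDiff v)
    (hv0 : v 0 = 0) (hv1 : v 1 = 0) :
    |bilin ε₁ ε₂ b c (fun x => η₀ x + η₁ x) v| ≤
      (Real.sqrt ε₁ * (l2 (deriv η₀) + l2 (deriv η₁)) + ε₂ * B * l2 (deriv η₀) +
        ε₂ * B * (l2 η₁ * (1 / Real.sqrt ε₁ + 1)) + B * (l2 η₀ + l2 η₁)) * energyNorm ε₁ v := by
  have hdη : weakDeriv (fun x => η₀ x + η₁ x) =ᵐ[volΩ] fun x => deriv η₀ x + deriv η₁ x := by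
    filter_upwards [(h₀.add h₁).weakDeriv_ae, h₀.ae_differentiableAt, h₁.ae_differentiableAt]
      with x h1 h2 h3
    rw [h1, deriv_fun_add h2 h3]
  have hs : 0 < Real.sqrt ε₁ := Real.sqrt_pos.2 hε₁
  have hdv := hv.weakDeriv_ae
  have hv' : l2 (deriv v) ≤ energyNorm ε₁ v / Real.sqrt ε₁ := by
    rw [le_div_iff₀ hs, ← l2_congr hdv, mul_comm]
    exact sqrt_mul_l2_weakDeriv_le_energyNorm hε₁.le v
  have hvE := l2_le_energyNorm hε₁.le v
  set n := energyNorm ε₁ v with hn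
  have l2bd : ∀ {k g : ℝ → ℝ}, (∀ x ∈ Icc (0 : ℝ) 1, |k x| ≤ B) → MemLp g 2 volΩ →
      l2 (fun x => k x * g x) ≤ B * l2 g := fun {k g} hk hg => by
    have e : B * l2 g = l2 (fun x => B * |g x|) := by
      rw [l2_const_mul hB0]; simp [l2]
    rw [e]
    refine l2_mono (hg.abs.const_mul B) ?_
    filter_upwards [ae_restrict_mem measurableSet_Ioo] with x hx
    rw [abs_mul]
    exact mul_le_mul_of_nonneg_right (hk x (Ioo_subset_Icc_self hx)) (abs_nonneg _)
  -- diffusion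
  have T1 : |∫ x in Ioo (0 : ℝ) 1, weakDeriv (fun x => η₀ x + η₁ x) x * weakDeriv v x| ≤
      (l2 (deriv η₀) + l2 (deriv η₁)) * (n / Real.sqrt ε₁) := by
    have e : ∫ x in Ioo (0 : ℝ) 1, weakDeriv (fun x => η₀ x + η₁ x) x * weakDeriv v x =
        ∫ x in Ioo (0 : ℝ) 1, (deriv η₀ x + deriv η₁ x) * deriv v x := by
      apply integral_congr_ae
      filter_upwards [hdη, hdv] with x h1 h2
      rw [h1, h2]
    rw [e]
    refine (abs_integral_mul_le (MemLp.add_fun h₀.memLp_deriv h₁.memLp_deriv)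
      hv.memLp_deriv).trans ?_
    exact mul_le_mul (l2_add_le h₀.memLp_deriv h₁.memLp_deriv) hv' (l2_nonneg _)
      (add_nonneg (l2_nonneg _) (l2_nonneg _))
  -- convection
  have T2 : |∫ x in Ioo (0 : ℝ) 1, b x * weakDeriv (fun x => η₀ x + η₁ x) x * v x| ≤
      B * l2 (deriv η₀) * n + l2 η₁ * (B * n + B * (n / Real.sqrt ε₁)) := by
    have i0 := MemLp.integrable_mul' (hb.1.mul_memLp_two h₀.memLp_deriv) hv.memLp
    have i1 := MemLp.integrable_mul' (hb.1.mul_memLp_two h₁.memLp_deriv) hv.memLp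
    have e : ∫ x in Ioo (0 : ℝ) 1, b x * weakDeriv (fun x => η₀ x + η₁ x) x * v x =
        (∫ x in Ioo (0 : ℝ) 1, b x * deriv η₀ x * v x) +
        ∫ x in Ioo (0 : ℝ) 1, b x * deriv η₁ x * v x := by
      rw [← integral_add i0 i1]
      apply integral_congr_ae
      filter_upwards [hdη] with x h1
      rw [h1]; ring
    have hbv := hb.mul hv
    -- The boundary terms vanish with `v`. Only `η₁` itself remains, at the price of `‖v'‖ ≤ n /
    -- √ε₁`.
    have e1 : ∫ x in Ioo (0 : ℝ) 1, b x * deriv η₁ x * v x =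
        - ∫ x in Ioo (0 : ℝ) 1, η₁ x * (b' x * v x + b x * deriv v x) := by
      have := h₁.integral_deriv_mul hbv
      rw [hv0, hv1, mul_zero, mul_zero, mul_zero, mul_zero, sub_zero, zero_sub] at this
      have e3 : ∫ x in Ioo (0 : ℝ) 1, b x * deriv η₁ x * v x =
          ∫ x in Ioo (0 : ℝ) 1, deriv η₁ x * (b x * v x) := by congr 1; ext x; ring
      rw [e3, this, neg_inj]
      apply integral_congr_ae
      filter_upwards [hb.deriv_mul_ae hv, hbb'] with x h1 h2
      rw [h1, h2]
    rw [e, e1]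
    refine (abs_add_le _ _).trans (add_le_add ?_ ?_)
    · refine (abs_integral_mul_le (hb.1.mul_memLp_two h₀.memLp_deriv) hv.memLp).trans ?_
      exact mul_le_mul (l2bd hB h₀.memLp_deriv) hvE (l2_nonneg _) (mul_nonneg hB0 (l2_nonneg _))
    · rw [abs_neg]
      have m1 := hb'.mul_memLp_two hv.memLp
      have m2 := hb.1.mul_memLp_two hv.memLp_deriv
      refine (abs_integral_mul_le h₁.memLp (MemLp.add_fun m1 m2)).trans ?_
      apply mul_le_mul_of_nonneg_left _ (l2_nonneg _)
      refine (l2_add_le m1 m2).trans (add_le_add ?_ ?_)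
      · exact (l2bd hB' hv.memLp).trans (mul_le_mul_of_nonneg_left hvE hB0)
      · exact (l2bd hB hv.memLp_deriv).trans (mul_le_mul_of_nonneg_left hv' hB0)
  -- reaction
  have T3 : |∫ x in Ioo (0 : ℝ) 1, c x * (η₀ x + η₁ x) * v x| ≤
      B * (l2 η₀ + l2 η₁) * n := by
    have m := MemLp.add_fun h₀.memLp h₁.memLp
    refine (abs_integral_mul_le (hc.mul_memLp_two m) hv.memLp).trans ?_
    refine mul_le_mul ((l2bd hCB m).trans ?_) hvE (l2_nonneg _)
      (mul_nonneg hB0 (add_nonneg (l2_nonneg _) (l2_nonneg _)))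
    exact mul_le_mul_of_nonneg_left (l2_add_le h₀.memLp h₁.memLp) hB0
  have hss : ε₁ / Real.sqrt ε₁ = Real.sqrt ε₁ := Real.div_sqrt
  have T1' := mul_le_mul_of_nonneg_left T1 hε₁.le
  have e : ε₁ * ((l2 (deriv η₀) + l2 (deriv η₁)) * (n / Real.sqrt ε₁)) =
      Real.sqrt ε₁ * (l2 (deriv η₀) + l2 (deriv η₁)) * n :=
    calc _ = ε₁ / Real.sqrt ε₁ * (l2 (deriv η₀) + l2 (deriv η₁)) * n := by ring
      _ = _ := by rw [hss]
  rw [e, ← abs_of_pos hε₁, ← abs_mul, abs_of_pos hε₁] at T1'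
  have T2' := mul_le_mul_of_nonneg_left T2 hε₂
  rw [← abs_of_nonneg hε₂, ← abs_mul, abs_of_nonneg hε₂] at T2'
  unfold bilin
  refine (abs_add_three _ _ _).trans ((add_le_add_three T1' T2' T3).trans_eq ?_)
  ring

/-! ### Piecewise affine functions -/

/-- The points `x 0 = 0 < x 1 < ⋯ < x N = 1`. -/
structure IsMesh (N : ℕ) (x : ℕ → ℝ) : Prop where
  zero : x 0 = 0
  one : x N = 1
  lt : ∀ i < N, x i < x (i + 1)

/-- Continuous on `[0,1]` and affine on the mesh intervals. -/
def PiecewiseAffine (N : ℕ) (x : ℕ → ℝ) (w : ℝ → ℝ) : Prop :=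
  ContinuousOn w (Icc (0 : ℝ) 1) ∧
    ∀ i < N, ∃ m k : ℝ, ∀ y ∈ Icc (x i) (x (i + 1)), w y = m * y + k

/-- The piecewise affine function with the values `d i` at the mesh points `x i`. -/
def nodalInterp (N : ℕ) (x d : ℕ → ℝ) (y : ℝ) : ℝ :=
  d 0 + ∑ i ∈ Finset.range N,
    (d (i + 1) - d i) / (x (i + 1) - x i) * max 0 (min (y - x i) (x (i + 1) - x i))

namespace IsMesh

variable {N : ℕ} {x : ℕ → ℝ}

lemma le (h : IsMesh N x) {i j : ℕ} (hij : i ≤ j) (hj : j ≤ N) : x i ≤ x j := by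
  induction j, hij using Nat.le_induction with
  | base => exact le_rfl
  | succ k hk ih => exact (ih (by omega)).trans (h.lt k (by omega)).le

lemma mem_Icc (h : IsMesh N x) {i : ℕ} (hi : i ≤ N) : x i ∈ Icc (0 : ℝ) 1 :=
  ⟨h.zero ▸ h.le (Nat.zero_le i) hi, h.one ▸ h.le hi le_rfl⟩

lemma pos (h : IsMesh N x) : 0 < N := by
  rcases Nat.eq_zero_or_pos N with rfl | h0
  · have := h.zero.symm.trans h.one; norm_num at this
  · exact h0

lemma exists_mem_Icc (h : IsMesh N x) {y : ℝ} (hy : y ∈ Icc (0 : ℝ) 1) :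
    ∃ i < N, y ∈ Icc (x i) (x (i + 1)) := by
  have hN := h.pos
  have key : ∀ n ≤ N, 0 < n → y ≤ x n → ∃ i < n, y ∈ Icc (x i) (x (i + 1)) := by
    intro n
    induction n with
    | zero => intro _ h0; omega
    | succ n ih =>
      intro hn _ hyn
      rcases le_total (x n) y with hny | hny
      · exact ⟨n, by omega, hny, hyn⟩
      · rcases Nat.eq_zero_or_pos n with rfl | hn0
        · exact ⟨0, by omega, by rw [h.zero]; exact hy.1, hyn⟩
        · obtain ⟨i, hi, hiy⟩ := ih (by omega) hn0 hny
          exact ⟨i, by omega, hiy⟩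
  exact key N le_rfl hN (by rw [h.one]; exact hy.2)

lemma exists_mem_Ioo (h : IsMesh N x) {y : ℝ} (hy : y ∈ Icc (0 : ℝ) 1) (hyx : y ∉ range x) :
    ∃ i < N, y ∈ Ioo (x i) (x (i + 1)) := by
  obtain ⟨i, hi, h1, h2⟩ := h.exists_mem_Icc hy
  exact ⟨i, hi, lt_of_le_of_ne h1 fun e => hyx ⟨i, e⟩, lt_of_le_of_ne h2 fun e => hyx ⟨i + 1, e.symm⟩⟩

lemma Ioo_subset (h : IsMesh N x) {i : ℕ} (hi : i < N) : Ioo (x i) (x (i + 1)) ⊆ Ioo 0 1 :=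
  Ioo_subset_Ioo (h.mem_Icc hi.le).1 (h.mem_Icc hi).2

/-- The reflection `x ↦ 1 - x` turns the layer at `1` into a layer at `0`, so the layer estimates
are needed at one end only. -/
lemma reflect (h : IsMesh N x) : IsMesh N fun i => 1 - x (N - i) where
  zero := by simp [h.one]
  one := by simp [h.zero]
  lt i hi := by
    have := h.lt (N - (i + 1)) (by omega)
    rw [show N - (i + 1) + 1 = N - i by omega] at this
    linarith

/-- Each summand is a ramp that varies only on its own mesh interval. The ramps to the left of `y`
are saturated and telescope to `d j - d 0`; those to the right have not started. -/
lemma nodalInterp_eq (h : IsMesh N x) (d : ℕ → ℝ) {j : ℕ} (hj : j < N) {y : ℝ}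
    (hy : y ∈ Icc (x j) (x (j + 1))) :
    nodalInterp N x d y = d j + (d (j + 1) - d j) / (x (j + 1) - x j) * (y - x j) := by
  have key : ∀ n ≤ N, ∑ i ∈ Finset.range n,
      (d (i + 1) - d i) / (x (i + 1) - x i) * max 0 (min (y - x i) (x (i + 1) - x i)) =
      if n ≤ j then d n - d 0
      else d j - d 0 + (d (j + 1) - d j) / (x (j + 1) - x j) * (y - x j) := by
    intro n
    induction n with
    | zero => simp
    | succ n ih =>
      intro hn
      have hlt := h.lt n (by omega)
      rw [Finset.sum_range_succ, ih (by omega)]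
      rcases lt_trichotomy n j with hnj | rfl | hnj
      · rw [if_pos (by omega), if_pos (by omega)]
        have : x (n + 1) ≤ x j := h.le hnj hj.le
        rw [min_eq_right (by linarith [hy.1]), max_eq_right (by linarith),
          div_mul_cancel₀ _ (by linarith)]
        ring
      · rw [if_pos le_rfl, if_neg (by omega), min_eq_left (by linarith [hy.2]),
          max_eq_right (by linarith [hy.1])]
      · rw [if_neg (by omega), if_neg (by omega)]
        have : x (j + 1) ≤ x n := h.le hnj (by omega)
        rw [max_eq_left, mul_zero, add_zero]
        exact (min_le_left _ _).trans (by linarith [hy.2])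
  rw [nodalInterp, key N le_rfl, if_neg (by omega)]
  ring

lemma nodalInterp_node (h : IsMesh N x) (d : ℕ → ℝ) {j : ℕ} (hj : j ≤ N) :
    nodalInterp N x d (x j) = d j := by
  rcases hj.lt_or_eq with hj | rfl
  · rw [h.nodalInterp_eq d hj ⟨le_rfl, (h.lt j hj).le⟩]; simp
  · have h0 := h.pos
    obtain ⟨k, rfl⟩ : ∃ k, j = k + 1 := ⟨j - 1, by omega⟩
    have hlt := h.lt k (by omega)
    rw [h.nodalInterp_eq d (Nat.lt_succ_self k) ⟨hlt.le, le_rfl⟩,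
      div_mul_cancel₀ _ (by linarith)]
    ring

lemma piecewiseAffine_nodalInterp (h : IsMesh N x) (d : ℕ → ℝ) :
    PiecewiseAffine N x (nodalInterp N x d) := by
  refine ⟨Continuous.continuousOn ?_, fun i hi =>
    ⟨(d (i + 1) - d i) / (x (i + 1) - x i), d i - (d (i + 1) - d i) / (x (i + 1) - x i) * x i,
      fun y hy => ?_⟩⟩
  · unfold nodalInterp
    fun_prop
  · rw [h.nodalInterp_eq d hi hy]; ring

end IsMesh

namespace PiecewiseAffine

variable {N : ℕ} {x : ℕ → ℝ} {v w : ℝ → ℝ}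

lemma add (hv : PiecewiseAffine N x v) (hw : PiecewiseAffine N x w) :
    PiecewiseAffine N x fun y => v y + w y := by
  refine ⟨hv.1.add hw.1, fun i hi => ?_⟩
  obtain ⟨m, k, h⟩ := hv.2 i hi
  obtain ⟨m', k', h'⟩ := hw.2 i hi
  exact ⟨m + m', k + k', fun y hy => by
    show v y + w y = _
    rw [h y hy, h' y hy]; ring⟩

lemma const_mul (a : ℝ) (hv : PiecewiseAffine N x v) : PiecewiseAffine N x fun y => a * v y := by
  refine ⟨hv.1.const_mul a, fun i hi => ?_⟩
  obtain ⟨m, k, h⟩ := hv.2 i hi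
  exact ⟨a * m, a * k, fun y hy => by
    show a * v y = _
    rw [h y hy]; ring⟩

lemma sub (hv : PiecewiseAffine N x v) (hw : PiecewiseAffine N x w) :
    PiecewiseAffine N x fun y => v y - w y := by
  simpa [sub_eq_add_neg] using hv.add (hw.const_mul (-1))

lemma hasDerivAt {m k y a b : ℝ} (h : ∀ y ∈ Icc a b, w y = m * y + k) (hy : y ∈ Ioo a b) :
    HasDerivAt w m y := by
  have h1 : HasDerivAt (fun y => m * y + k) m y := by
    simpa using ((hasDerivAt_id y).const_mul m).add_const k
  refine h1.congr_of_eventuallyEq ?_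
  filter_upwards [Icc_mem_nhds hy.1 hy.2] with z hz using h z hz

lemma piecewiseDiff (hx : IsMesh N x) (hw : PiecewiseAffine N x w) : PiecewiseDiff w := by
  choose! m k h using hw.2
  refine ⟨hw.1, range x, countable_range x, ∑ i ∈ Finset.range N, |m i|, fun y hy => ?_⟩
  obtain ⟨i, hi, hiy⟩ := hx.exists_mem_Ioo (Ioo_subset_Icc_self hy.1) hy.2
  have hd := hasDerivAt (h i hi) hiy
  refine ⟨hd.differentiableAt, ?_⟩
  rw [hd.deriv]
  exact Finset.single_le_sum (f := fun i => |m i|) (fun _ _ => abs_nonneg _)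
    (Finset.mem_range.2 hi)

lemma reflect (hw : PiecewiseAffine N (fun i => 1 - x (N - i)) w) :
    PiecewiseAffine N x fun y => w (1 - y) := by
  refine ⟨hw.1.comp (continuous_const.sub continuous_id).continuousOn fun y hy =>
    ⟨sub_nonneg.2 hy.2, sub_le_self _ hy.1⟩, fun i hi => ?_⟩
  obtain ⟨m, k, h⟩ := hw.2 (N - (i + 1)) (by omega)
  simp only [show N - (N - (i + 1)) = i + 1 by omega,
    show N - (N - (i + 1) + 1) = i by omega] at h
  exact ⟨-m, m + k, fun y hy => by
    show w (1 - y) = _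
    rw [h (1 - y) ⟨by linarith [hy.2], by linarith [hy.1]⟩]; ring⟩

end PiecewiseAffine

/-! ### Interpolation errors -/

/-- The chord slope `m` is attained by `w'` at some `ξ`, so `w' - m` is at most `M (b - a)`; a
second mean value theorem, started at `a`, bounds the function. The constants are not sharp. -/
lemma abs_sub_affine_le {a b m k M : ℝ} {w w' w'' : ℝ → ℝ} (hab : a < b)
    (hw : ContinuousOn w (Icc a b)) (hd : ∀ x ∈ Ioo a b, HasDerivAt w (w' x) x)
    (hd' : ∀ x ∈ Ioo a b, HasDerivAt w' (w'' x) x) (hM : ∀ x ∈ Ioo a b, |w'' x| ≤ M)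
    (ha : w a = m * a + k) (hb : w b = m * b + k) {x : ℝ} (hx : x ∈ Ioo a b) :
    |w x - (m * x + k)| ≤ M * (b - a) ^ 2 ∧ |w' x - m| ≤ M * (b - a) := by
  obtain ⟨ξ, hξ, hξe⟩ := exists_hasDerivAt_eq_slope w w' hab hw hd
  have hm : w' ξ = m := by
    rw [hξe, ha, hb, div_eq_iff (by linarith)]; ring
  have hM0 : 0 ≤ M := (abs_nonneg _).trans (hM x hx)
  have hder : ∀ z ∈ Ioo a b, |w' z - m| ≤ M * (b - a) := fun z hz => by
    have h := Convex.norm_image_sub_le_of_norm_hasDerivWithin_le (f := w') (f' := w'')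
      (s := Ioo a b) (C := M) (fun y hy => (hd' y hy).hasDerivWithinAt) hM (convex_Ioo a b) hξ hz
    rw [hm] at h
    refine h.trans (mul_le_mul_of_nonneg_left ?_ hM0)
    rw [Real.norm_eq_abs, abs_le]
    constructor <;> linarith [hξ.1, hξ.2, hz.1, hz.2]
  refine ⟨?_, hder x hx⟩
  have hl : ∀ y, HasDerivAt (fun y => m * y + k) m y := fun y => by
    simpa using ((hasDerivAt_id y).const_mul m).add_const k
  obtain ⟨ζ, hζ, hζe⟩ := exists_hasDerivAt_eq_slope (fun y => w y - (m * y + k))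
    (fun y => w' y - m) hx.1
    ((hw.mono (Icc_subset_Icc_right hx.2.le)).sub
      (continuous_iff_continuousAt.2 fun y => (hl y).continuousAt).continuousOn)
    (fun y hy => (hd y ⟨hy.1, hy.2.trans hx.2⟩).sub (hl y))
  rw [ha, sub_self, sub_zero, eq_div_iff (by linarith [hx.1])] at hζe
  rw [← hζe, abs_mul, abs_of_pos (sub_pos.2 hx.1), sq, ← mul_assoc]
  exact mul_le_mul (hder ζ ⟨hζ.1, hζ.2.trans hx.2⟩) (by linarith [hx.2])
    (by linarith [hx.1]) (mul_nonneg hM0 (by linarith))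

/-- `w` is a boundary layer function at `0` with layer parameter `μ`. -/
structure IsLayer (A μ : ℝ) (w w' w'' : ℝ → ℝ) : Prop where
  cont : ContinuousOn w (Icc 0 1)
  d1 : ∀ x ∈ Ioo (0 : ℝ) 1, HasDerivAt w (w' x) x
  d2 : ∀ x ∈ Ioo (0 : ℝ) 1, HasDerivAt w' (w'' x) x
  b0 : ∀ x ∈ Icc (0 : ℝ) 1, |w x| ≤ A * Real.exp (-(μ * x))
  b1 : ∀ x ∈ Ioo (0 : ℝ) 1, |w' x| ≤ A * μ * Real.exp (-(μ * x))
  b2 : ∀ x ∈ Ioo (0 : ℝ) 1, |w'' x| ≤ A * μ ^ 2 * Real.exp (-(μ * x))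

/-- Five powers is the exact need: two for each of the two mesh-width factors in an interpolation
error, and one left over for the `L²` norm. -/
lemma exp_neg_le_pow {κ μ x : ℝ} (hκ : κ ≤ 1 / 5) (hμ : 0 ≤ μ) (hx : 0 ≤ x) :
    Real.exp (-(μ * x)) ≤ Real.exp (-(κ * μ * x)) ^ 5 := by
  rw [← Real.exp_nat_mul]
  apply Real.exp_le_exp.2
  push_cast
  nlinarith [mul_nonneg hμ hx]

/-! ### Errors of a layer function on a single mesh interval -/

section LocalEstimates

variable {κ μ A a b N : ℝ} {w w' w'' : ℝ → ℝ}

/-- With `r` and `s` the weights at the two ends, `w''` is at most `A μ² r⁵`, each factor `h` is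
traded for `2 / (κ μ N s²)`, and `r² ≤ 2 s²` lets powers of `r` cancel those of `s`. One factor `r`
survives and is comparable to the weight at `x`. -/
lemma IsLayer.interp_le (hw : IsLayer A μ w w' w'') (hκ0 : 0 < κ) (hκ : κ ≤ 1 / 5) (hμ : 0 < μ)
    (hA : 0 ≤ A) (hN : 0 < N) (ha : 0 ≤ a) (hab : a < b) (hb : b ≤ 1)
    (hq : Real.exp (-(κ * μ * a)) ^ 2 ≤ 2 * Real.exp (-(κ * μ * b)) ^ 2)
    (hq' : Real.exp (-(κ * μ * a)) ^ 2 - Real.exp (-(κ * μ * b)) ^ 2 ≤ 4 / N)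
    {m k : ℝ} (hma : w a = m * a + k) (hmb : w b = m * b + k) {x : ℝ} (hx : x ∈ Ioo a b) :
    |w x - (m * x + k)| ≤ 324 / κ ^ 2 * (A / N ^ 2) * Real.exp (-(κ * μ * x)) ∧
    |w' x - m| ≤ 324 / κ ^ 2 * (A * μ / N) * Real.exp (-(κ * μ * x)) := by
  have hsub : Ioo a b ⊆ Ioo 0 1 := Ioo_subset_Ioo ha hb
  have hκμ : 0 < κ * μ := mul_pos hκ0 hμ
  set r := Real.exp (-(κ * μ * a)) with hr
  set s := Real.exp (-(κ * μ * b)) with hs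
  have hs0 : 0 < s := Real.exp_pos _
  have hs1 : s ≤ 1 := Real.exp_le_one_iff.2 (by nlinarith)
  have hM : ∀ y ∈ Ioo a b, |w'' y| ≤ A * μ ^ 2 * r ^ 5 := fun y hy => by
    refine (hw.b2 y (hsub hy)).trans (mul_le_mul_of_nonneg_left ?_ (by positivity))
    refine (exp_neg_le_pow hκ hμ.le (ha.trans hy.1.le)).trans ?_
    refine pow_le_pow_left₀ (Real.exp_pos _).le (Real.exp_le_exp.2 ?_) 5
    nlinarith [hy.1]
  obtain ⟨h1, h2⟩ := abs_sub_affine_le hab (hw.cont.mono (Icc_subset_Icc ha hb))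
    (fun y hy => hw.d1 y (hsub hy)) (fun y hy => hw.d2 y (hsub hy)) hM hma hmb hx
  -- From `r² = s² exp(2κμh) ≥ s² (1 + 2κμh)`: the decrement of the squared weight controls the mesh
  -- step.
  have hstep : κ * μ * (b - a) * s ^ 2 ≤ 2 / N := by
    have e : r ^ 2 = s ^ 2 * Real.exp (2 * (κ * μ * (b - a))) := by
      rw [hr, hs, ← Real.exp_nat_mul, ← Real.exp_nat_mul, ← Real.exp_add]
      congr 1; push_cast; ring
    have := Real.add_one_le_exp (2 * (κ * μ * (b - a)))
    have h3 : s ^ 2 * (2 * (κ * μ * (b - a)) + 1) ≤ r ^ 2 := by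
      rw [e]; exact mul_le_mul_of_nonneg_left this (by positivity)
    have : (4 : ℝ) / N = 2 * (2 / N) := by ring
    linarith
  have hrx : r ≤ 2 * Real.exp (-(κ * μ * x)) := by
    have h3 : s ≤ Real.exp (-(κ * μ * x)) := Real.exp_le_exp.2 (by nlinarith [hx.2])
    have h4 : r ≤ 2 * s := le_of_abs_le (abs_le_of_sq_le_sq (by nlinarith) (by positivity))
    linarith
  set h := b - a with hh
  have hr4 : r ^ 4 ≤ 4 * s ^ 4 := by nlinarith [sq_nonneg r, sq_nonneg s]
  have hst0 : 0 ≤ κ * μ * h * s ^ 2 := by positivity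
  constructor
  · refine h1.trans ?_
    have e1 : (κ * μ * h * s ^ 2) ^ 2 ≤ (2 / N) ^ 2 := pow_le_pow_left₀ hst0 hstep 2
    have e2 : κ ^ 2 * s ^ 4 * (A * μ ^ 2 * r ^ 5 * h ^ 2) ≤ s ^ 4 * (16 * A / N ^ 2 * r) :=
      calc κ ^ 2 * s ^ 4 * (A * μ ^ 2 * r ^ 5 * h ^ 2)
          = (κ * μ * h * s ^ 2) ^ 2 * (A * r * r ^ 4) := by ring
        _ ≤ (2 / N) ^ 2 * (A * r * (4 * s ^ 4)) := by gcongr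
        _ = s ^ 4 * (16 * A / N ^ 2 * r) := by ring
    have e3 : κ ^ 2 * (A * μ ^ 2 * r ^ 5 * h ^ 2) ≤ 16 * A / N ^ 2 * r := by
      refine le_of_mul_le_mul_left ?_ (pow_pos hs0 4)
      linarith
    have e4 : 16 * A / N ^ 2 * r ≤ 16 * A / N ^ 2 * (2 * Real.exp (-(κ * μ * x))) := by gcongr
    have e5 : 0 ≤ A / N ^ 2 * Real.exp (-(κ * μ * x)) := by positivity
    rw [show 324 / κ ^ 2 * (A / N ^ 2) * Real.exp (-(κ * μ * x)) =
      324 * (A / N ^ 2 * Real.exp (-(κ * μ * x))) / κ ^ 2 by ring, le_div_iff₀ (by positivity)]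
    have e6 : 16 * A / N ^ 2 * (2 * Real.exp (-(κ * μ * x))) =
      32 * (A / N ^ 2 * Real.exp (-(κ * μ * x))) := by ring
    linarith
  · refine h2.trans ?_
    have e2 : κ * s ^ 2 * (A * μ ^ 2 * r ^ 5 * h) ≤ s ^ 2 * (8 * (A * μ / N) * r) :=
      calc κ * s ^ 2 * (A * μ ^ 2 * r ^ 5 * h)
          = (κ * μ * h * s ^ 2) * (A * μ * r * r ^ 4) := by ring
        _ ≤ (2 / N) * (A * μ * r * (4 * s ^ 4)) := by gcongr
        _ = s ^ 2 * (8 * (A * μ / N) * r) * s ^ 2 := by ring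
        _ ≤ s ^ 2 * (8 * (A * μ / N) * r) * 1 := by
          gcongr
          exact pow_le_one₀ hs0.le hs1
        _ = _ := mul_one _
    have e3 : κ * (A * μ ^ 2 * r ^ 5 * h) ≤ 8 * (A * μ / N) * r := by
      refine le_of_mul_le_mul_left ?_ (pow_pos hs0 2)
      linarith
    have e4 : 8 * (A * μ / N) * r ≤ 8 * (A * μ / N) * (2 * Real.exp (-(κ * μ * x))) := by gcongr
    have e5 : 0 ≤ A * μ / N * Real.exp (-(κ * μ * x)) := by positivity
    rw [show 324 / κ ^ 2 * (A * μ / N) * Real.exp (-(κ * μ * x)) =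
      324 * (A * μ / N * Real.exp (-(κ * μ * x))) / κ ^ 2 by ring, le_div_iff₀ (by positivity)]
    have e7 : κ ^ 2 * (A * μ ^ 2 * r ^ 5 * h) ≤ κ * (A * μ ^ 2 * r ^ 5 * h) := by
      gcongr
      nlinarith
    linarith

/-- On the transition interval the interpolant descends from `w a` to zero. No cancellation is used:
`w` and the chord are separately small, since `r⁴ ≤ 81 / N²`. The constant `324 = 2 · 81 · 2` used
in all three local bounds originates here. -/
lemma IsLayer.cutoff_le (hw : IsLayer A μ w w' w'') (hκ0 : 0 < κ) (hκ : κ ≤ 1 / 5) (hμ : 0 < μ)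
    (hA : 0 ≤ A) (hN : 0 < N) (ha : 0 ≤ a) (hab : a < b) (hb : b ≤ 1)
    (hq : Real.exp (-(κ * μ * a)) ^ 2 ≤ 2 * Real.exp (-(κ * μ * b)) ^ 2)
    (hq9 : Real.exp (-(κ * μ * a)) ^ 2 ≤ 9 / N) (hh : 1 ≤ 6 * (κ * μ * (b - a)))
    {m k : ℝ} (hma : w a = m * a + k) (hmb : 0 = m * b + k) {x : ℝ} (hx : x ∈ Ioo a b) :
    |w x - (m * x + k)| ≤ 324 / κ ^ 2 * (A / N ^ 2) * Real.exp (-(κ * μ * x)) ∧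
    |w' x - m| ≤ 324 / κ ^ 2 * (A * μ / N) * Real.exp (-(κ * μ * x)) := by
  have hsub : Ioo a b ⊆ Ioo 0 1 := Ioo_subset_Ioo ha hb
  have hκμ : 0 < κ * μ := mul_pos hκ0 hμ
  have hwa := (hw.b0 a ⟨ha, hab.le.trans hb⟩).trans
    (mul_le_mul_of_nonneg_left (exp_neg_le_pow hκ hμ.le ha) hA)
  set r := Real.exp (-(κ * μ * a)) with hr
  set s := Real.exp (-(κ * μ * b)) with hs
  have hr0 : 0 < r := Real.exp_pos _
  have hr1 : r ≤ 1 := Real.exp_le_one_iff.2 (by nlinarith)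
  have hrx : r ≤ 2 * Real.exp (-(κ * μ * x)) := by
    have h3 : s ≤ Real.exp (-(κ * μ * x)) := Real.exp_le_exp.2 (by nlinarith [hx.2])
    have h4 : r ≤ 2 * s := le_of_abs_le (abs_le_of_sq_le_sq (by nlinarith) (by positivity))
    linarith
  have hexp : Real.exp (-(μ * x)) ≤ r ^ 5 := by
    refine (exp_neg_le_pow hκ hμ.le (ha.trans hx.1.le)).trans ?_
    refine pow_le_pow_left₀ (Real.exp_pos _).le (Real.exp_le_exp.2 ?_) 5
    nlinarith [hx.1]
  have hwx : |w x| ≤ A * r ^ 5 := (hw.b0 x (Ioo_subset_Icc_self (hsub hx))).trans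
    (mul_le_mul_of_nonneg_left hexp hA)
  have hwx' : |w' x| ≤ A * μ * r ^ 5 := (hw.b1 x (hsub hx)).trans
    (mul_le_mul_of_nonneg_left hexp (by positivity))
  have hm : m * (b - a) = - w a := by linarith
  have hh0 : 0 < b - a := sub_pos.2 hab
  have hmabs : |m| * (b - a) = |w a| := by
    have := congrArg abs hm
    rwa [abs_mul, abs_of_pos hh0, abs_neg] at this
  have hℓ : |m * x + k| ≤ |w a| := by
    have : m * x + k = m * (x - b) := by linarith
    rw [this, abs_mul, ← hmabs, abs_of_neg (show x - b < 0 by linarith [hx.2])]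
    exact mul_le_mul_of_nonneg_left (by linarith [hx.1]) (abs_nonneg _)
  -- The interval is not too short: its length is at least `1 / (6κμ)`, so the descent to zero is no
  -- steeper than the layer itself.
  have hm' : |m| ≤ A * r ^ 5 * (6 * (κ * μ)) := by
    have h1 : |m| * 1 ≤ |m| * (6 * (κ * μ * (b - a))) :=
      mul_le_mul_of_nonneg_left hh (abs_nonneg _)
    calc |m| ≤ |m| * (b - a) * (6 * (κ * μ)) := by linarith
      _ ≤ A * r ^ 5 * (6 * (κ * μ)) := by rw [hmabs]; gcongr
  have hκ25 : 25 ≤ 1 / κ ^ 2 := by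
    rw [le_div_iff₀ (by positivity)]; nlinarith
  have hr4 : r ^ 4 ≤ 81 / N ^ 2 := by
    calc r ^ 4 = (r ^ 2) ^ 2 := by ring
      _ ≤ (9 / N) ^ 2 := pow_le_pow_left₀ (by positivity) hq9 2
      _ = 81 / N ^ 2 := by ring
  have e5 : r ^ 5 ≤ 162 / N ^ 2 * Real.exp (-(κ * μ * x)) :=
    calc r ^ 5 = r ^ 4 * r := by ring
      _ ≤ 81 / N ^ 2 * (2 * Real.exp (-(κ * μ * x))) := by gcongr
      _ = _ := by ring
  have e5' : r ^ 5 ≤ 18 / N * Real.exp (-(κ * μ * x)) :=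
    calc r ^ 5 = r ^ 2 * r * r ^ 2 := by ring
      _ ≤ 9 / N * (2 * Real.exp (-(κ * μ * x))) * 1 := by
        gcongr
        exact pow_le_one₀ hr0.le hr1
      _ = _ := by ring
  constructor
  · calc |w x - (m * x + k)| ≤ |w x| + |m * x + k| := abs_sub _ _
      _ ≤ A * r ^ 5 + A * r ^ 5 := add_le_add hwx (hℓ.trans hwa)
      _ = 2 * A * r ^ 5 := by ring
      _ ≤ 2 * A * (162 / N ^ 2 * Real.exp (-(κ * μ * x))) := by gcongr
      _ = 1 * (324 * (A / N ^ 2 * Real.exp (-(κ * μ * x)))) := by ring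
      _ ≤ 1 / κ ^ 2 * (324 * (A / N ^ 2 * Real.exp (-(κ * μ * x)))) := by
        gcongr; linarith
      _ = _ := by ring
  · calc |w' x - m| ≤ |w' x| + |m| := abs_sub _ _
      _ ≤ A * μ * r ^ 5 + A * r ^ 5 * (6 * (κ * μ)) := add_le_add hwx' hm'
      _ = A * μ * r ^ 5 * (1 + 6 * κ) := by ring
      _ ≤ A * μ * (18 / N * Real.exp (-(κ * μ * x))) * (1 + 6 * (1 / 5)) := by gcongr
      _ = 11 / 5 * 18 * (A * μ / N * Real.exp (-(κ * μ * x))) := by ring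
      _ ≤ 1 / κ ^ 2 * 324 * (A * μ / N * Real.exp (-(κ * μ * x))) := by
        gcongr ?_ * _
        linarith
      _ = _ := by ring

/-- Beyond the cut-off the approximation is zero and `w` is the error; four of its five powers of
the weight already supply `N⁻²`. -/
lemma IsLayer.outer_le (hw : IsLayer A μ w w' w'') (hκ0 : 0 < κ) (hκ : κ ≤ 1 / 5) (hμ : 0 < μ)
    (hA : 0 ≤ A) (hN : 0 < N) {x : ℝ} (hx : x ∈ Ioo (0 : ℝ) 1)
    (hq9 : Real.exp (-(κ * μ * x)) ^ 2 ≤ 9 / N) :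
    |w x| ≤ 324 / κ ^ 2 * (A / N ^ 2) * Real.exp (-(κ * μ * x)) ∧
    |w' x| ≤ 324 / κ ^ 2 * (A * μ / N) * Real.exp (-(κ * μ * x)) := by
  have hexp := exp_neg_le_pow hκ hμ.le hx.1.le
  have hr1 : Real.exp (-(κ * μ * x)) ≤ 1 :=
    Real.exp_le_one_iff.2 (by nlinarith [mul_pos (mul_pos hκ0 hμ) hx.1])
  set r := Real.exp (-(κ * μ * x)) with hr
  have hr0 : 0 < r := Real.exp_pos _
  have hκ25 : 25 ≤ 1 / κ ^ 2 := by
    rw [le_div_iff₀ (by positivity)]; nlinarith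
  have hr4 : r ^ 4 ≤ 81 / N ^ 2 := by
    calc r ^ 4 = (r ^ 2) ^ 2 := by ring
      _ ≤ (9 / N) ^ 2 := pow_le_pow_left₀ (by positivity) hq9 2
      _ = 81 / N ^ 2 := by ring
  constructor
  · calc |w x| ≤ A * r ^ 5 := (hw.b0 x (Ioo_subset_Icc_self hx)).trans (by gcongr)
      _ = A * (r ^ 4 * r) := by ring
      _ ≤ A * (81 / N ^ 2 * r) := by gcongr
      _ = 81 * (A / N ^ 2 * r) := by ring
      _ ≤ 1 / κ ^ 2 * 324 * (A / N ^ 2 * r) := by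
        gcongr ?_ * _
        linarith
      _ = _ := by ring
  · calc |w' x| ≤ A * μ * r ^ 5 := (hw.b1 x hx).trans (by gcongr)
      _ = A * μ * (r ^ 2 * r * r ^ 2) := by ring
      _ ≤ A * μ * (9 / N * r * 1) := by
        gcongr
        exact pow_le_one₀ hr0.le hr1
      _ = 9 * (A * μ / N * r) := by ring
      _ ≤ 1 / κ ^ 2 * 324 * (A * μ / N * r) := by
        gcongr ?_ * _
        linarith
      _ = _ := by ring

end LocalEstimates

/-- A boundary layer function is approximated by its interpolant inside of the layer, continued by
zero. -/
theorem IsLayer.exists_approx {κ μ A : ℝ} {n : ℕ} {y : ℕ → ℝ} {w w' w'' : ℝ → ℝ}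
    (hw : IsLayer A μ w w' w'') (hκ0 : 0 < κ) (hκ : κ ≤ 1 / 5) (hA : 0 ≤ A) (hn : 4 ≤ n)
    (hnμ : 4 * (n : ℝ) ≤ μ) (hy : IsMesh (4 * n) y)
    (hyq : ∀ i < n, Real.exp (-(κ * μ * y i)) ^ 2 = 1 - (1 - μ⁻¹) * (i / n)) :
    ∃ P : ℝ → ℝ, PiecewiseAffine (4 * n) y P ∧ P 0 = w 0 ∧ P 1 = 0 ∧
      ∀ x ∈ Ioo (0 : ℝ) 1 \ range y,
        |w x - P x| ≤ 324 / κ ^ 2 * (A / (4 * n) ^ 2) * Real.exp (-(κ * μ * x)) ∧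
        |w' x - deriv P x| ≤ 324 / κ ^ 2 * (A * μ / (4 * n)) * Real.exp (-(κ * μ * x)) := by
  have hn4 : (4 : ℝ) ≤ n := by exact_mod_cast hn
  have hn0 : (0 : ℝ) < n := by linarith
  have hμ : 0 < μ := by linarith
  have hN0 : (0 : ℝ) < 4 * n := by linarith
  -- The last interpolated node is `n - 2`, and the value at `n - 1` is already zero. On the
  -- interval from `n - 1` to `n` the squared weight drops from `μ⁻¹ + δ` to `μ⁻¹`, a ratio
  -- unbounded in `μ / N`, so interpolation there is avoided.
  set d : ℕ → ℝ := fun i => if i + 2 ≤ n then w (y i) else 0 with hd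
  have hPa := hy.piecewiseAffine_nodalInterp d
  have hp0 := hy.nodalInterp_node d (Nat.zero_le _)
  have hp1 := hy.nodalInterp_node d le_rfl
  rw [hy.zero, hd] at hp0
  rw [hy.one, hd] at hp1
  simp only [show 0 + 2 ≤ n by omega, if_true, hy.zero] at hp0
  simp only [show ¬ (4 * n + 2 ≤ n) by omega, if_false] at hp1
  refine ⟨nodalInterp (4 * n) y d, hPa, hp0, hp1, fun x hx => ?_⟩
  obtain ⟨i, hi, hix⟩ := hy.exists_mem_Ioo (Ioo_subset_Icc_self hx.1) hx.2
  obtain ⟨m, k, hmk⟩ := hPa.2 i hi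
  have hlt := hy.lt i hi
  have hPx := hmk x (Ioo_subset_Icc_self hix)
  have hdP : deriv (nodalInterp (4 * n) y d) x = m := (PiecewiseAffine.hasDerivAt hmk hix).deriv
  have hA1 := (hy.nodalInterp_node d hi.le).symm.trans (hmk (y i) ⟨le_rfl, hlt.le⟩)
  have hB1 := (hy.nodalInterp_node d hi).symm.trans (hmk (y (i + 1)) ⟨hlt.le, le_rfl⟩)
  rw [hPx, hdP]
  have ha := (hy.mem_Icc hi.le).1
  have hb := (hy.mem_Icc hi).2
  -- The constant decrement of the squared weight from node to node; `μ ≥ 4n ≥ 16` places it between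
  -- `3 / (4n)` and `4 / (4n)`.
  set δ := (1 - μ⁻¹) / n with hδ
  have hμi : μ⁻¹ ≤ 1 / (4 * n) := by
    rw [inv_eq_one_div]; exact one_div_le_one_div_of_le hN0 hnμ
  have hμi16 : 1 / (4 * (n : ℝ)) ≤ 1 / 16 := one_div_le_one_div_of_le (by norm_num) (by linarith)
  have hμi0 : 0 < μ⁻¹ := inv_pos.2 hμ
  have hδn : n * δ = 1 - μ⁻¹ := mul_div_cancel₀ _ hn0.ne'
  have hδ1 : δ ≤ 4 / (4 * n) := by
    rw [hδ, div_le_div_iff₀ hn0 hN0]; nlinarith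
  have hδ3 : 3 / (4 * n) ≤ δ := by
    rw [hδ, div_le_div_iff₀ hN0 hn0]; nlinarith
  have hδ0 : 0 < δ := lt_of_lt_of_le (by positivity) hδ3
  have hq : ∀ i < n, Real.exp (-(κ * μ * y i)) ^ 2 = μ⁻¹ + (n - i) * δ := fun i hi => by
    rw [hyq i hi]
    have : (1 - μ⁻¹) * (i / n) = i * δ := by rw [hδ]; ring
    rw [this, sub_mul, hδn]; ring
  have h9 : μ⁻¹ + 2 * δ ≤ 9 / (4 * n) := by
    have : (9 : ℝ) / (4 * n) = 1 / (4 * n) + 2 * (4 / (4 * n)) := by ring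
    linarith
  rcases le_or_gt (i + 2) n with hin | hin
  · have q1 := hq i (by omega)
    have q2 := hq (i + 1) (by omega)
    push_cast at q2
    have hin' : (i : ℝ) + 2 ≤ n := by exact_mod_cast hin
    -- Here `n - i ≥ 2` is decisive: `(n - i) δ ≤ 2 (n - i - 1) δ`.
    have hratio : Real.exp (-(κ * μ * y i)) ^ 2 ≤ 2 * Real.exp (-(κ * μ * y (i + 1))) ^ 2 := by
      rw [q1, q2]; nlinarith
    have hA2 : w (y i) = m * y i + k := by rw [← hA1, hd]; simp only [hin, if_true]
    rcases hin.lt_or_eq with hlt3 | heq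
    · have hB2 : w (y (i + 1)) = m * y (i + 1) + k := by
        rw [← hB1, hd]; simp only [show i + 1 + 2 ≤ n by omega, if_true]
      refine hw.interp_le hκ0 hκ hμ hA hN0 ha hlt hb hratio ?_ hA2 hB2 hix
      rw [q1, q2]; linarith
    · have hB2 : 0 = m * y (i + 1) + k := by
        rw [← hB1, hd]; simp only [show ¬ (i + 1 + 2 ≤ n) by omega, if_false]
      have heq' : (n : ℝ) - i = 2 := by rw [← heq]; push_cast; ring
      have q9 : Real.exp (-(κ * μ * y i)) ^ 2 ≤ 9 / (4 * n) := by rw [q1, heq']; exact h9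
      refine hw.cutoff_le hκ0 hκ hμ hA hN0 ha hlt hb hratio q9 ?_ hA2 hB2 hix
      -- Lower bound of the step: with `Q` the squared weight on the left and `H = κμh`, the
      -- decrement is at most `2 H Q`. It is at least `3 / (4n)` while `Q ≤ 9 / (4n)`, hence `1 ≤ 6
      -- H`.
      have e : Real.exp (-(κ * μ * y (i + 1))) ^ 2 =
          Real.exp (-(κ * μ * y i)) ^ 2 * Real.exp (-(2 * (κ * μ * (y (i + 1) - y i)))) := by
        rw [← Real.exp_nat_mul, ← Real.exp_nat_mul, ← Real.exp_add]
        congr 1; push_cast; ring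
      have e1 := Real.add_one_le_exp (-(2 * (κ * μ * (y (i + 1) - y i))))
      have e2 := mul_le_mul_of_nonneg_left e1 (sq_nonneg (Real.exp (-(κ * μ * y i))))
      rw [← e] at e2
      set Q := Real.exp (-(κ * μ * y i)) ^ 2
      set H := κ * μ * (y (i + 1) - y i) with hH
      have hH0 : 0 < H := mul_pos (mul_pos hκ0 hμ) (sub_pos.2 hlt)
      have e4 : 3 / (4 * n) ≤ 9 / (4 * n) * (2 * H) := by
        have := mul_le_mul_of_nonneg_right q9 (by linarith : 0 ≤ 2 * H)
        linarith
      have e5 : 3 / (4 * n) * 1 ≤ 3 / (4 * n) * (6 * H) := by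
        have : 3 / (4 * n) * (6 * H) = 9 / (4 * (n : ℝ)) * (2 * H) := by ring
        linarith
      exact le_of_mul_le_mul_left e5 (by positivity)
  -- Every interval from node `n - 1` onwards, including the coarse mesh and the opposite layer
  -- mesh; the interpolant vanishes and the squared weight is at most that at node `n - 1`.
  · have d0 : d i = 0 := by rw [hd]; simp only [show ¬ (i + 2 ≤ n) by omega, if_false]
    have d1 : d (i + 1) = 0 := by rw [hd]; simp only [show ¬ (i + 1 + 2 ≤ n) by omega, if_false]
    rw [d0] at hA1
    rw [d1] at hB1
    have hm : m = 0 := by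
      have : m * (y (i + 1) - y i) = 0 := by linarith
      exact (mul_eq_zero.1 this).resolve_right (by linarith)
    have hk : k = 0 := by rw [hm] at hA1; linarith
    rw [hm, hk, zero_mul, add_zero, sub_zero, sub_zero]
    refine hw.outer_le hκ0 hκ hμ hA hN0 hx.1 ?_
    have hqn := hq (n - 1) (by omega)
    rw [Nat.cast_sub (by omega)] at hqn
    have hle : y (n - 1) ≤ x := (hy.le (by omega) hi.le).trans hix.1.le
    have : Real.exp (-(κ * μ * x)) ^ 2 ≤ Real.exp (-(κ * μ * y (n - 1))) ^ 2 := by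
      refine pow_le_pow_left₀ (Real.exp_pos _).le (Real.exp_le_exp.2 ?_) 2
      nlinarith [mul_pos hκ0 hμ]
    rw [hqn] at this
    push_cast at this
    linarith

/-- The interpolation error of a smooth function. -/
theorem exists_interp_of_mesh {N : ℕ} {y : ℕ → ℝ} (hy : IsMesh N y) {H M : ℝ} (hM : 0 ≤ M)
    (hH : ∀ i < N, y (i + 1) - y i ≤ H) {w w' w'' : ℝ → ℝ} (hw : ContinuousOn w (Icc 0 1))
    (hd : ∀ x ∈ Ioo (0 : ℝ) 1, HasDerivAt w (w' x) x)
    (hd' : ∀ x ∈ Ioo (0 : ℝ) 1, HasDerivAt w' (w'' x) x)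
    (hM : ∀ x ∈ Ioo (0 : ℝ) 1, |w'' x| ≤ M) :
    ∃ P : ℝ → ℝ, PiecewiseAffine N y P ∧ P 0 = w 0 ∧ P 1 = w 1 ∧
      ∀ x ∈ Ioo (0 : ℝ) 1 \ range y, |w x - P x| ≤ M * H ^ 2 ∧ |w' x - deriv P x| ≤ M * H := by
  set d : ℕ → ℝ := fun i => w (y i) with hdd
  have hPa := hy.piecewiseAffine_nodalInterp d
  have hp0 := hy.nodalInterp_node d (Nat.zero_le _)
  have hp1 := hy.nodalInterp_node d le_rfl
  simp only [hdd, hy.zero] at hp0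
  simp only [hdd, hy.one] at hp1
  refine ⟨nodalInterp N y d, hPa, hp0, hp1, fun x hx => ?_⟩
  obtain ⟨i, hi, hix⟩ := hy.exists_mem_Ioo (Ioo_subset_Icc_self hx.1) hx.2
  obtain ⟨m, k, hmk⟩ := hPa.2 i hi
  have hlt := hy.lt i hi
  have hsub := hy.Ioo_subset hi
  have hA1 := (hy.nodalInterp_node d hi.le).symm.trans (hmk (y i) ⟨le_rfl, hlt.le⟩)
  have hB1 := (hy.nodalInterp_node d hi).symm.trans (hmk (y (i + 1)) ⟨hlt.le, le_rfl⟩)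
  obtain ⟨h1, h2⟩ := abs_sub_affine_le hlt
    (hw.mono (Icc_subset_Icc (hy.mem_Icc hi.le).1 (hy.mem_Icc hi).2))
    (fun z hz => hd z (hsub hz)) (fun z hz => hd' z (hsub hz)) (fun z hz => hM z (hsub hz))
    hA1 hB1 hix
  rw [hmk x (Ioo_subset_Icc_self hix), (PiecewiseAffine.hasDerivAt hmk hix).deriv]
  have hh := hH i hi
  exact ⟨h1.trans (by gcongr), h2.trans (by gcongr)⟩

/-! ### The Bakhvalov-type mesh -/

section Bakhvalov

variable {τ p μ μ₀ μ₁ : ℝ} {n : ℕ}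

lemma phi0_arg (hn : 0 < n) (μ : ℝ) (i : ℕ) :
    1 - 4 * (1 - μ⁻¹) * ((i : ℝ) / ((4 * n : ℕ) : ℝ)) = 1 - (1 - μ⁻¹) * (i / n) := by
  have : (n : ℝ) ≠ 0 := by exact_mod_cast hn.ne'
  push_cast
  field_simp

lemma inv_le_phi0_arg (hn : 0 < n) (hμ : 1 ≤ μ) {i : ℕ} (hi : i ≤ n) :
    μ⁻¹ ≤ 1 - (1 - μ⁻¹) * ((i : ℝ) / n) := by
  have h1 : (i : ℝ) / n ≤ 1 := by
    rw [div_le_one (by exact_mod_cast hn)]; exact_mod_cast hi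
  have h2 : μ⁻¹ ≤ 1 := inv_le_one_of_one_le₀ hμ
  nlinarith

/-- By `log t ≤ t - 1` and because the argument of the logarithm never falls below `μ⁻¹`, the
prefactor `1 / μ` compensates the worst quotient. So even the longest layer step is `O(1/N)`, which
is all that the smooth part requires. -/
lemma layer_step (hτ : 0 < τ) (hp : 0 < p) (hn : 0 < n) (hμ : 1 < μ) {i : ℕ} (hi : i < n) :
    0 < τ / (p * μ) * phi0 μ (((i + 1 : ℕ) : ℝ) / ((4 * n : ℕ) : ℝ)) -
      τ / (p * μ) * phi0 μ ((i : ℝ) / ((4 * n : ℕ) : ℝ)) ∧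
    τ / (p * μ) * phi0 μ (((i + 1 : ℕ) : ℝ) / ((4 * n : ℕ) : ℝ)) -
      τ / (p * μ) * phi0 μ ((i : ℝ) / ((4 * n : ℕ) : ℝ)) ≤ τ / p / n := by
  have hμ0 : 0 < μ := by linarith
  have hn' : (0 : ℝ) < n := by exact_mod_cast hn
  have hinv : 0 < μ⁻¹ := inv_pos.2 hμ0
  have hinv1 : μ⁻¹ < 1 := inv_lt_one_of_one_lt₀ hμ
  unfold phi0
  rw [phi0_arg hn, phi0_arg hn]
  have hq' := inv_le_phi0_arg hn hμ.le (Nat.succ_le_of_lt hi)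
  set q := 1 - (1 - μ⁻¹) * ((i : ℝ) / n) with hq
  set q' := 1 - (1 - μ⁻¹) * (((i + 1 : ℕ) : ℝ) / n) with hq'd
  have hqq : q - q' = (1 - μ⁻¹) / n := by
    rw [hq, hq'd]; push_cast; field_simp; ring
  have hq'0 : 0 < q' := hinv.trans_le hq'
  have hδ : 0 < (1 - μ⁻¹) / n := div_pos (by linarith) hn'
  have hlt : q' < q := by linarith
  have e : τ / (p * μ) * -Real.log q' - τ / (p * μ) * -Real.log q =
      τ / (p * μ) * Real.log (q / q') := by
    rw [Real.log_div (by linarith) hq'0.ne']; ring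
  rw [e]
  constructor
  · apply mul_pos (by positivity)
    apply Real.log_pos
    rwa [one_lt_div hq'0]
  · have h1 : Real.log (q / q') ≤ μ / n := by
      refine (Real.log_le_sub_one_of_pos (div_pos (hq'0.trans hlt) hq'0)).trans ?_
      rw [div_sub_one hq'0.ne', hqq, div_le_iff₀ hq'0]
      calc (1 - μ⁻¹) / n ≤ 1 / n := by gcongr; linarith
        _ = μ / n * μ⁻¹ := by field_simp
        _ ≤ μ / n * q' := by gcongr
    calc τ / (p * μ) * Real.log (q / q') ≤ τ / (p * μ) * (μ / n) := by gcongr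
      _ = τ / p / n := by field_simp

lemma meshPoint_left {i : ℕ} (hi : i ≤ n) :
    meshPoint τ p μ₀ μ₁ (4 * n) i = τ / (p * μ₀) * phi0 μ₀ ((i : ℝ) / ((4 * n : ℕ) : ℝ)) := by
  unfold meshPoint
  rw [if_pos (by omega)]

lemma meshPoint_mid (hn : 0 < n) {i : ℕ} (hi : n ≤ i) (hi' : i ≤ 3 * n) :
    meshPoint τ p μ₀ μ₁ (4 * n) i = sigma τ p μ₀ +
      2 * ((i : ℝ) / ((4 * n : ℕ) : ℝ) - 1 / 4) * (1 - sigma τ p μ₀ - sigma τ p μ₁) := by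
  have hn' : (n : ℝ) ≠ 0 := by exact_mod_cast hn.ne'
  rcases hi.eq_or_lt with rfl | hlt
  · rw [meshPoint_left le_rfl, phi0, phi0_arg hn, div_self hn']
    have : (n : ℝ) / ((4 * n : ℕ) : ℝ) - 1 / 4 = 0 := by push_cast; field_simp; ring
    rw [this, sigma]
    simp
  · unfold meshPoint
    rw [if_neg (by omega), if_pos (by omega)]

lemma phi1_eq (hn : 0 < n) {i : ℕ} (hi : i ≤ 4 * n) :
    phi1 μ ((i : ℝ) / ((4 * n : ℕ) : ℝ)) =
      phi0 μ (((4 * n - i : ℕ) : ℝ) / ((4 * n : ℕ) : ℝ)) := by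
  have hn' : (n : ℝ) ≠ 0 := by exact_mod_cast hn.ne'
  have : (1 : ℝ) - (i : ℝ) / ((4 * n : ℕ) : ℝ) = ((4 * n - i : ℕ) : ℝ) / ((4 * n : ℕ) : ℝ) := by
    rw [Nat.cast_sub hi]
    push_cast
    field_simp
  rw [phi1, phi0, this]

lemma meshPoint_right (hn : 0 < n) {i : ℕ} (hi : 3 * n ≤ i) (hi' : i ≤ 4 * n) :
    meshPoint τ p μ₀ μ₁ (4 * n) i = 1 - τ / (p * μ₁) *
      phi0 μ₁ (((4 * n - i : ℕ) : ℝ) / ((4 * n : ℕ) : ℝ)) := by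
  have hn' : (n : ℝ) ≠ 0 := by exact_mod_cast hn.ne'
  rcases hi.eq_or_lt with rfl | hlt
  · rw [meshPoint_mid hn (by omega) le_rfl, phi0, phi0_arg hn,
      show 4 * n - 3 * n = n by omega, div_self hn']
    have : ((3 * n : ℕ) : ℝ) / ((4 * n : ℕ) : ℝ) - 1 / 4 = 1 / 2 := by push_cast; field_simp; ring
    rw [this, sigma, sigma]
    simp
    ring
  · rw [← phi1_eq hn hi']
    unfold meshPoint
    rw [if_neg (by omega), if_neg (by omega)]

lemma sigma_nonneg (hτ : 0 < τ) (hp : 0 < p) (hμ : 1 < μ) : 0 ≤ sigma τ p μ :=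
  mul_nonneg (by positivity) (Real.log_nonneg hμ.le)

lemma meshPoint_step (hτ : 5 / 2 ≤ τ) (hp : 0 < p) (hp1 : p < 1) (hn : 0 < n) (hμ₀ : 1 < μ₀)
    (hμ₁ : 1 < μ₁) (hσ₀ : sigma τ p μ₀ ≤ 1 / 4) (hσ₁ : sigma τ p μ₁ ≤ 1 / 4) {i : ℕ}
    (hi : i < 4 * n) :
    0 < meshPoint τ p μ₀ μ₁ (4 * n) (i + 1) - meshPoint τ p μ₀ μ₁ (4 * n) i ∧
    meshPoint τ p μ₀ μ₁ (4 * n) (i + 1) - meshPoint τ p μ₀ μ₁ (4 * n) i ≤ τ / p / n := by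
  have hτ0 : 0 < τ := by linarith
  have hn' : (0 : ℝ) < n := by exact_mod_cast hn
  rcases lt_or_ge i n with h1 | h1
  · rw [meshPoint_left h1.le, meshPoint_left h1]
    exact layer_step hτ0 hp hn hμ₀ h1
  rcases lt_or_ge i (3 * n) with h2 | h2
  · rw [meshPoint_mid hn h1 h2.le, meshPoint_mid hn (by omega) h2]
    have s0 := sigma_nonneg hτ0 hp hμ₀
    have s1 := sigma_nonneg hτ0 hp hμ₁
    set σ₀ := sigma τ p μ₀
    set σ₁ := sigma τ p μ₁
    have e : σ₀ + 2 * (((i + 1 : ℕ) : ℝ) / ((4 * n : ℕ) : ℝ) - 1 / 4) * (1 - σ₀ - σ₁) -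
        (σ₀ + 2 * ((i : ℝ) / ((4 * n : ℕ) : ℝ) - 1 / 4) * (1 - σ₀ - σ₁)) =
        1 / 2 * (1 - σ₀ - σ₁) / n := by
      push_cast; field_simp; ring
    rw [e]
    -- The coarse step is at most `1 / (2n)`, so the layer bound `τ / (p n)` serves for all
    -- intervals.
    have hτp : 1 ≤ τ / p := by rw [one_le_div hp]; linarith
    refine ⟨div_pos (by linarith) hn', ?_⟩
    gcongr
    linarith
  · rw [meshPoint_right hn h2 hi.le, meshPoint_right hn (by omega) hi]
    have := layer_step hτ0 hp hn hμ₁ (i := 4 * n - (i + 1)) (by omega)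
    rw [show 4 * n - (i + 1) + 1 = 4 * n - i by omega] at this
    constructor <;> linarith [this.1, this.2]

lemma isMesh_meshPoint (hτ : 5 / 2 ≤ τ) (hp : 0 < p) (hp1 : p < 1) (hn : 0 < n) (hμ₀ : 1 < μ₀)
    (hμ₁ : 1 < μ₁) (hσ₀ : sigma τ p μ₀ ≤ 1 / 4) (hσ₁ : sigma τ p μ₁ ≤ 1 / 4) :
    IsMesh (4 * n) (meshPoint τ p μ₀ μ₁ (4 * n)) where
  zero := by rw [meshPoint_left (Nat.zero_le _)]; simp [phi0]
  one := by rw [meshPoint_right hn (by omega) le_rfl]; simp [phi0]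
  lt i hi := by
    have := (meshPoint_step hτ hp hp1 hn hμ₀ hμ₁ hσ₀ hσ₁ hi).1
    linarith

/-- The rate `p / (2τ)` is chosen so that the squared weight undoes the logarithm in the mesh
generating function and becomes affine in `i`. -/
lemma exp_layer_point (hτ : 0 < τ) (hp : 0 < p) (hn : 0 < n) (hμ : 1 ≤ μ) {i : ℕ} (hi : i ≤ n) :
    Real.exp (-(p / (2 * τ) * μ *
      (τ / (p * μ) * phi0 μ ((i : ℝ) / ((4 * n : ℕ) : ℝ))))) ^ 2 = 1 - (1 - μ⁻¹) * (i / n) := by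
  have hμ0 : 0 < μ := by linarith
  have hq : 0 < 1 - (1 - μ⁻¹) * ((i : ℝ) / n) :=
    (inv_pos.2 hμ0).trans_le (inv_le_phi0_arg hn hμ hi)
  rw [phi0, phi0_arg hn, ← Real.exp_nat_mul]
  conv_rhs => rw [← Real.exp_log hq]
  congr 1
  push_cast
  field_simp

end Bakhvalov

/-! ### The characteristic roots and the layer parameters -/

lemma exists_deriv_of_contDiffOn {g : ℝ → ℝ} {k : ℕ} (hg : ContDiffOn ℝ (k + 1 : ℕ) g (Icc 0 1)) :
    ContDiffOn ℝ k (derivWithin g (Icc 0 1)) (Icc 0 1) ∧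
      ∀ x ∈ Ioo (0 : ℝ) 1, HasDerivAt g (derivWithin g (Icc 0 1) x) x := by
  refine ⟨hg.derivWithin (uniqueDiffOn_Icc one_pos) (by norm_cast), fun x hx => ?_⟩
  have hn : Icc (0 : ℝ) 1 ∈ 𝓝 x := Icc_mem_nhds hx.1 hx.2
  rw [derivWithin_of_mem_nhds hn]
  exact ((hg.differentiableOn (by norm_cast)).differentiableAt hn).hasDerivAt

lemma exists_bound {g : ℝ → ℝ} (hg : ContinuousOn g (Icc 0 1)) :
    ∃ M : ℝ, ∀ x ∈ Icc (0 : ℝ) 1, |g x| ≤ M :=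
  isCompact_Icc.exists_bound_of_continuousOn hg

/-- Bounds of the coefficients and of their first derivatives. -/
structure CoeffBounds (b b' c c' : ℝ → ℝ) (lam β B : ℝ) : Prop where
  b_cont : ContinuousOn b (Icc 0 1)
  c_cont : ContinuousOn c (Icc 0 1)
  b_deriv : ∀ x ∈ Ioo (0 : ℝ) 1, HasDerivAt b (b' x) x
  c_deriv : ∀ x ∈ Ioo (0 : ℝ) 1, HasDerivAt c (c' x) x
  lam_pos : 0 < lam
  beta_pos : 0 < β
  b_lower : ∀ x ∈ Icc (0 : ℝ) 1, lam ≤ b x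
  c_lower : ∀ x ∈ Icc (0 : ℝ) 1, β ≤ c x
  one_le : 1 ≤ B
  b_le : ∀ x ∈ Icc (0 : ℝ) 1, |b x| ≤ B
  b'_le : ∀ x ∈ Icc (0 : ℝ) 1, |b' x| ≤ B
  c_le : ∀ x ∈ Icc (0 : ℝ) 1, |c x| ≤ B
  c'_le : ∀ x ∈ Icc (0 : ℝ) 1, |c' x| ≤ B

/-- The quantity `ε₂ b + √((ε₂ b)² + 4 ε₁ c)`. -/
def rootSum (ε₁ ε₂ : ℝ) (b c : ℝ → ℝ) (x : ℝ) : ℝ :=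
  ε₂ * b x + Real.sqrt ((ε₂ * b x) ^ 2 + 4 * ε₁ * c x)

section Roots

variable {b b' c c' : ℝ → ℝ} {lam β B : ℝ}

/-- The square root is comparable to `ε₂ b + √(ε₁ c)`, hence to `ν`. Its derivative has a numerator
of order `ν²` over a denominator of order `ν`, so differentiation does not change the order. -/
lemma CoeffBounds.rootSum_bounds (h : CoeffBounds b b' c c' lam β B) :
    ∃ K : ℝ, 1 ≤ K ∧ ∀ ε₁ ε₂ : ℝ, 0 < ε₁ → 0 < ε₂ →
      ContinuousOn (rootSum ε₁ ε₂ b c) (Icc 0 1) ∧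
      (∀ x ∈ Icc (0 : ℝ) 1, (ε₂ + Real.sqrt ε₁) / K ≤ rootSum ε₁ ε₂ b c x ∧
        rootSum ε₁ ε₂ b c x ≤ K * (ε₂ + Real.sqrt ε₁)) ∧
      ∃ q' : ℝ → ℝ, ∀ x ∈ Ioo (0 : ℝ) 1, HasDerivAt (rootSum ε₁ ε₂ b c) (q' x) x ∧
        |q' x| ≤ K * (ε₂ + Real.sqrt ε₁) := by
  -- `b ≥ lam` controls the part `ε₂` and `c ≥ β` the part `√ε₁`.
  set k := min lam (2 * Real.sqrt β) with hk
  have hk0 : 0 < k := lt_min h.lam_pos (by have := Real.sqrt_pos.2 h.beta_pos; positivity)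
  have hB := h.one_le
  set K := 2 * B + 4 * B ^ 2 / k + 1 / k with hK
  have hKk : 1 / k ≤ K := by
    have : 0 ≤ 4 * B ^ 2 / k := by positivity
    linarith
  have hKB : 2 * B ≤ K := by
    have : 0 ≤ 4 * B ^ 2 / k := by positivity
    have : 0 ≤ 1 / k := by positivity
    linarith
  have hK0 : 0 < K := by linarith
  refine ⟨K, by linarith, fun ε₁ ε₂ hε₁ hε₂ => ?_⟩
  have hs : 0 < Real.sqrt ε₁ := Real.sqrt_pos.2 hε₁
  have hss : Real.sqrt ε₁ ^ 2 = ε₁ := Real.sq_sqrt hε₁.le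
  set ν := ε₂ + Real.sqrt ε₁ with hν
  have hν0 : 0 < ν := by positivity
  have hr : ∀ x ∈ Icc (0 : ℝ) 1, k * ν / 2 ≤ Real.sqrt ((ε₂ * b x) ^ 2 + 4 * ε₁ * c x) ∧
      k * ν ≤ rootSum ε₁ ε₂ b c x ∧ rootSum ε₁ ε₂ b c x ≤ 2 * B * ν := fun x hx => by
    have hb := h.b_lower x hx
    have hc := h.c_lower x hx
    have hbB := le_of_abs_le (h.b_le x hx)
    have hcB := le_of_abs_le (h.c_le x hx)
    have hb0 : 0 < b x := h.lam_pos.trans_le hb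
    have hc0 : 0 < c x := h.beta_pos.trans_le hc
    have hβ0 := h.beta_pos.le
    have r1 : ε₂ * b x ≤ Real.sqrt ((ε₂ * b x) ^ 2 + 4 * ε₁ * c x) := by
      apply Real.le_sqrt_of_sq_le
      have : 0 ≤ 4 * ε₁ * c x := by positivity
      linarith
    have r2 : 2 * Real.sqrt β * Real.sqrt ε₁ ≤ Real.sqrt ((ε₂ * b x) ^ 2 + 4 * ε₁ * c x) := by
      apply Real.le_sqrt_of_sq_le
      have e : (2 * Real.sqrt β * Real.sqrt ε₁) ^ 2 = 4 * ε₁ * β := by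
        rw [mul_pow, mul_pow, Real.sq_sqrt hβ0, hss]; ring
      have := mul_le_mul_of_nonneg_left hc hε₁.le
      nlinarith [sq_nonneg (ε₂ * b x)]
    have r3 : Real.sqrt ((ε₂ * b x) ^ 2 + 4 * ε₁ * c x) ≤ ε₂ * b x + 2 * B * Real.sqrt ε₁ := by
      apply Real.sqrt_le_iff.2
      refine ⟨by positivity, ?_⟩
      have : ε₁ * c x ≤ Real.sqrt ε₁ ^ 2 * B ^ 2 := by
        rw [hss]
        exact mul_le_mul_of_nonneg_left (by nlinarith) hε₁.le
      have : 0 ≤ ε₂ * b x * (2 * B * Real.sqrt ε₁) := by positivity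
      nlinarith
    have k1 : k * ε₂ ≤ ε₂ * b x := by
      have : k ≤ b x := (min_le_left _ _).trans hb
      nlinarith
    have k2 : k * Real.sqrt ε₁ ≤ 2 * Real.sqrt β * Real.sqrt ε₁ :=
      mul_le_mul_of_nonneg_right (min_le_right _ _) hs.le
    have k3 : ε₂ * b x ≤ ε₂ * B := by gcongr
    unfold rootSum
    rw [hν]
    refine ⟨by linarith, by linarith, ?_⟩
    linarith
  have hD : ∀ x ∈ Icc (0 : ℝ) 1, 0 < (ε₂ * b x) ^ 2 + 4 * ε₁ * c x := fun x hx => by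
    have hc0 : 0 < c x := h.beta_pos.trans_le (h.c_lower x hx)
    positivity
  refine ⟨?_, fun x hx => ?_, fun x => ε₂ * b' x + (2 * (ε₂ * b x) * (ε₂ * b' x) +
      4 * ε₁ * c' x) / (2 * Real.sqrt ((ε₂ * b x) ^ 2 + 4 * ε₁ * c x)), fun x hx => ⟨?_, ?_⟩⟩
  · unfold rootSum
    have hb := h.b_cont
    have hc := h.c_cont
    fun_prop
  · obtain ⟨_, h1, h2⟩ := hr x hx
    refine ⟨?_, h2.trans (by gcongr)⟩
    refine le_trans ?_ h1
    rw [div_le_iff₀ hK0]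
    have : 1 ≤ k * K := by
      have := mul_le_mul_of_nonneg_left hKk hk0.le
      rwa [mul_one_div_cancel hk0.ne'] at this
    nlinarith
  · have hb := (h.b_deriv x hx).const_mul ε₂
    have hc := (h.c_deriv x hx).const_mul (4 * ε₁)
    have hD' := ((hb.pow 2).add hc).sqrt (hD x (Ioo_subset_Icc_self hx)).ne'
    refine (hb.add hD').congr_deriv ?_
    simp
  · have hx' := Ioo_subset_Icc_self hx
    obtain ⟨h1, _, _⟩ := hr x hx'
    have hr0 : 0 < Real.sqrt ((ε₂ * b x) ^ 2 + 4 * ε₁ * c x) := Real.sqrt_pos.2 (hD x hx')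
    have t1 : |ε₂ * b' x| ≤ B * ν := by
      rw [abs_mul, abs_of_pos hε₂]
      have := mul_le_mul_of_nonneg_left (h.b'_le x hx') hε₂.le
      nlinarith
    have t2 : |2 * (ε₂ * b x) * (ε₂ * b' x) + 4 * ε₁ * c' x| ≤ 4 * B ^ 2 * ν ^ 2 := by
      refine (abs_add_le _ _).trans ?_
      rw [abs_mul, abs_mul, abs_mul, abs_mul, abs_mul, abs_mul, abs_of_pos hε₂, abs_of_pos hε₁,
        abs_of_pos (two_pos : (0 : ℝ) < 2), abs_of_pos (four_pos : (0 : ℝ) < 4)]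
      have m1 : |b x| * |b' x| ≤ B * B :=
        mul_le_mul (h.b_le x hx') (h.b'_le x hx') (abs_nonneg _) (by linarith)
      have m2 : |c' x| ≤ B ^ 2 := (h.c'_le x hx').trans (by nlinarith)
      calc 2 * (ε₂ * |b x|) * (ε₂ * |b' x|) + 4 * ε₁ * |c' x|
          = 2 * ε₂ ^ 2 * (|b x| * |b' x|) + 4 * ε₁ * |c' x| := by ring
        _ ≤ 2 * ε₂ ^ 2 * (B * B) + 4 * ε₁ * B ^ 2 := by gcongr
        _ ≤ 4 * B ^ 2 * ν ^ 2 := by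
          rw [hν, ← hss]
          simp only [Real.sqrt_sq hs.le]
          have : 0 ≤ B ^ 2 * (ε₂ * Real.sqrt ε₁) := by positivity
          have : 0 ≤ B ^ 2 * ε₂ ^ 2 := by positivity
          nlinarith
    refine (abs_add_le _ _).trans ?_
    have t3 : |(2 * (ε₂ * b x) * (ε₂ * b' x) + 4 * ε₁ * c' x) /
        (2 * Real.sqrt ((ε₂ * b x) ^ 2 + 4 * ε₁ * c x))| ≤ 4 * B ^ 2 / k * ν := by
      rw [abs_div, abs_of_pos (by positivity : 0 < 2 * Real.sqrt ((ε₂ * b x) ^ 2 + 4 * ε₁ * c x)),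
        div_le_iff₀ (by positivity)]
      refine t2.trans ?_
      calc 4 * B ^ 2 * ν ^ 2 = 4 * B ^ 2 / k * ν * (2 * (k * ν / 2)) := by field_simp
        _ ≤ _ := by gcongr
    have : 0 ≤ 1 / k * ν := by positivity
    have : 0 ≤ B * ν := by positivity
    rw [hK]
    linarith

/-- The rationalised form of the small root has no cancellation, so size and derivative can be read
off from `rootSum`. -/
lemma CoeffBounds.charRoot0_eq (h : CoeffBounds b b' c c' lam β B) {ε₁ ε₂ x : ℝ} (hε₁ : 0 < ε₁)
    (hε₂ : 0 < ε₂) (hx : x ∈ Icc (0 : ℝ) 1) :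
    charRoot0 ε₁ ε₂ b c x = -(2 * c x / rootSum ε₁ ε₂ b c x) := by
  have hb0 : 0 < b x := h.lam_pos.trans_le (h.b_lower x hx)
  have hc0 : 0 < c x := h.beta_pos.trans_le (h.c_lower x hx)
  have hD : 0 ≤ (ε₂ * b x) ^ 2 + 4 * ε₁ * c x := by positivity
  have hsq := Real.sq_sqrt hD
  have h0 : 0 < rootSum ε₁ ε₂ b c x := by unfold rootSum; positivity
  unfold charRoot0
  rw [← neg_div, div_eq_div_iff (by positivity) h0.ne']
  unfold rootSum
  linear_combination -hsq

/-- The bounds of the characteristic root `g`, `|g| ∼ μ` and `|g'| ≲ μ`. -/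
structure RootBounds (K μ : ℝ) (g g' : ℝ → ℝ) : Prop where
  cont : ContinuousOn g (Icc 0 1)
  deriv : ∀ x ∈ Ioo (0 : ℝ) 1, HasDerivAt g (g' x) x
  le : ∀ x ∈ Icc (0 : ℝ) 1, μ ≤ g x
  ge : ∀ x ∈ Icc (0 : ℝ) 1, g x ≤ K * μ
  deriv_le : ∀ x ∈ Ioo (0 : ℝ) 1, |g' x| ≤ K * μ

/-- The substance is `μ₀ ≈ 1 / (ε₂ + √ε₁)`, obtained from `-g₀ = 2c / rootSum` and the quotient
rule. -/
lemma CoeffBounds.charRoot0_bounds (h : CoeffBounds b b' c c' lam β B) :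
    ∃ K : ℝ, 1 ≤ K ∧ ∀ ε₁ ε₂ : ℝ, 0 < ε₁ → 0 < ε₂ →
      1 ≤ K * (mu0 ε₁ ε₂ b c * (ε₂ + Real.sqrt ε₁)) ∧
      mu0 ε₁ ε₂ b c * (ε₂ + Real.sqrt ε₁) ≤ K ∧
      ∃ g' : ℝ → ℝ, RootBounds K (mu0 ε₁ ε₂ b c) (fun x => -charRoot0 ε₁ ε₂ b c x) g' := by
  obtain ⟨K, hK, hq⟩ := h.rootSum_bounds
  have hB := h.one_le
  have hβ := h.beta_pos
  have hK0 : 0 < K := by linarith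
  set K₁ := 2 * B * K + 2 * B * K ^ 3 + K / (2 * β) with hK₁
  have p1 : 0 < K / (2 * β) := by positivity
  have p2 : 0 < 2 * B * K ^ 3 := by positivity
  have hKK : 1 ≤ K₁ := by nlinarith
  refine ⟨K₁ ^ 2, by nlinarith, fun ε₁ ε₂ hε₁ hε₂ => ?_⟩
  obtain ⟨hc, hbd, q', hq'⟩ := hq ε₁ ε₂ hε₁ hε₂
  set ν := ε₂ + Real.sqrt ε₁ with hν
  have hν0 : 0 < ν := by positivity
  have hq0 : ∀ x ∈ Icc (0 : ℝ) 1, 0 < rootSum ε₁ ε₂ b c x := fun x hx =>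
    lt_of_lt_of_le (by positivity) (hbd x hx).1
  have hqinv : ∀ x ∈ Icc (0 : ℝ) 1, 1 / rootSum ε₁ ε₂ b c x ≤ K / ν := fun x hx => by
    rw [div_le_div_iff₀ (hq0 x hx) hν0]
    have := (div_le_iff₀ hK0).1 (hbd x hx).1
    linarith
  have hup : ∀ x ∈ Icc (0 : ℝ) 1, 2 * c x / rootSum ε₁ ε₂ b c x ≤ K₁ / ν := fun x hx => by
    have hcB := le_of_abs_le (h.c_le x hx)
    calc 2 * c x / rootSum ε₁ ε₂ b c x = 2 * c x * (1 / rootSum ε₁ ε₂ b c x) := by ring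
      _ ≤ 2 * B * (K / ν) :=
        mul_le_mul (by linarith) (hqinv x hx) (one_div_nonneg.2 (hq0 x hx).le) (by linarith)
      _ = 2 * B * K / ν := by ring
      _ ≤ K₁ / ν := by gcongr; linarith
  have hlow : ∀ x ∈ Icc (0 : ℝ) 1, 1 / (K₁ * ν) ≤ 2 * c x / rootSum ε₁ ε₂ b c x := fun x hx => by
    rw [div_le_div_iff₀ (by positivity) (hq0 x hx), one_mul]
    have hcβ := h.c_lower x hx
    refine (hbd x hx).2.trans ?_
    have : K = 2 * β * (K / (2 * β)) := by field_simp
    calc K * ν = 2 * β * (K / (2 * β) * ν) := by rw [← mul_assoc, ← this]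
      _ ≤ 2 * c x * (K₁ * ν) := by
        gcongr
        · linarith
        · have : 0 < 2 * B * K := by positivity
          linarith
  have himg : ∀ x ∈ Icc (0 : ℝ) 1, charRoot0 ε₁ ε₂ b c x ≤ -(1 / (K₁ * ν)) := fun x hx => by
    rw [h.charRoot0_eq hε₁ hε₂ hx]
    linarith [hlow x hx]
  have hbdd : BddAbove (charRoot0 ε₁ ε₂ b c '' Icc (0 : ℝ) 1) :=
    ⟨_, by rintro _ ⟨x, hx, rfl⟩; exact himg x hx⟩
  have hμle : ∀ x ∈ Icc (0 : ℝ) 1, mu0 ε₁ ε₂ b c ≤ -charRoot0 ε₁ ε₂ b c x := fun x hx =>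
    neg_le_neg (le_csSup hbdd (mem_image_of_mem _ hx))
  have hμge : 1 / (K₁ * ν) ≤ mu0 ε₁ ε₂ b c := by
    rw [mu0, le_neg]
    refine csSup_le ((nonempty_Icc.2 zero_le_one).image _) ?_
    rintro _ ⟨x, hx, rfl⟩
    exact himg x hx
  have hμup : mu0 ε₁ ε₂ b c ≤ K₁ / ν := by
    have h0 : (0 : ℝ) ∈ Icc (0 : ℝ) 1 := by simp
    refine (hμle 0 h0).trans ?_
    rw [h.charRoot0_eq hε₁ hε₂ h0, neg_neg]
    exact hup 0 h0
  set μ := mu0 ε₁ ε₂ b c with hμ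
  have hμν : 1 ≤ K₁ * (μ * ν) := by
    rw [div_le_iff₀ (by positivity)] at hμge
    linarith
  have hμν' : μ * ν ≤ K₁ := (le_div_iff₀ hν0).1 hμup
  have hKν : K₁ / ν ≤ K₁ ^ 2 * μ := by
    rw [div_le_iff₀ hν0]
    nlinarith
  refine ⟨?_, ?_, fun x => (2 * c' x * rootSum ε₁ ε₂ b c x - 2 * c x * q' x) /
    rootSum ε₁ ε₂ b c x ^ 2, ?_⟩
  · nlinarith
  · nlinarith
  have hfun : ∀ x ∈ Icc (0 : ℝ) 1, -charRoot0 ε₁ ε₂ b c x = 2 * c x / rootSum ε₁ ε₂ b c x :=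
    fun x hx => by rw [h.charRoot0_eq hε₁ hε₂ hx, neg_neg]
  refine ⟨?_, fun x hx => ?_, hμle, fun x hx => ?_, fun x hx => ?_⟩
  · refine ContinuousOn.congr ?_ hfun
    exact (h.c_cont.const_mul 2).div hc fun x hx => (hq0 x hx).ne'
  · have hx' := Ioo_subset_Icc_self hx
    refine (((h.c_deriv x hx).const_mul 2).div (hq' x hx).1 (hq0 x hx').ne').congr_of_eventuallyEq ?_
    filter_upwards [Icc_mem_nhds hx.1 hx.2] with y hy using hfun y hy
  · show -charRoot0 ε₁ ε₂ b c x ≤ K₁ ^ 2 * μ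
    rw [hfun x hx]
    exact (hup x hx).trans hKν
  · have hx' := Ioo_subset_Icc_self hx
    refine le_trans ?_ hKν
    have hq0' := hq0 x hx'
    have hi := hqinv x hx'
    have hi0 : 0 ≤ 1 / rootSum ε₁ ε₂ b c x := by positivity
    have e : (2 * c' x * rootSum ε₁ ε₂ b c x - 2 * c x * q' x) / rootSum ε₁ ε₂ b c x ^ 2 =
        2 * c' x * (1 / rootSum ε₁ ε₂ b c x) - 2 * c x * q' x * (1 / rootSum ε₁ ε₂ b c x) ^ 2 := by
      field_simp
    rw [e]
    refine (abs_sub _ _).trans ?_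
    rw [abs_mul, abs_mul, abs_mul, abs_mul, abs_mul, abs_of_nonneg hi0,
      abs_of_nonneg (sq_nonneg (1 / rootSum ε₁ ε₂ b c x)), abs_of_pos (two_pos : (0 : ℝ) < 2)]
    calc 2 * |c' x| * (1 / rootSum ε₁ ε₂ b c x) +
          2 * |c x| * |q' x| * (1 / rootSum ε₁ ε₂ b c x) ^ 2
        ≤ 2 * B * (K / ν) + 2 * B * (K * ν) * (K / ν) ^ 2 := by
          gcongr
          · exact h.c'_le x hx'
          · exact h.c_le x hx'
          · exact (hq' x hx).2
      _ = (2 * B * K + 2 * B * K ^ 3) / ν := by field_simp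
      _ ≤ K₁ / ν := by gcongr; linarith

/-- The substance is `μ₁ ≈ (ε₂ + √ε₁) / ε₁`, since `g₁ = rootSum / (2ε₁)`. -/
lemma CoeffBounds.charRoot1_bounds (h : CoeffBounds b b' c c' lam β B) :
    ∃ K : ℝ, 1 ≤ K ∧ ∀ ε₁ ε₂ : ℝ, 0 < ε₁ → 0 < ε₂ →
      ε₂ + Real.sqrt ε₁ ≤ K * (ε₁ * mu1 ε₁ ε₂ b c) ∧
      ε₁ * mu1 ε₁ ε₂ b c ≤ K * (ε₂ + Real.sqrt ε₁) ∧
      ∃ g' : ℝ → ℝ, RootBounds K (mu1 ε₁ ε₂ b c) (charRoot1 ε₁ ε₂ b c) g' := by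
  obtain ⟨K, hK, hq⟩ := h.rootSum_bounds
  refine ⟨2 * K ^ 2, by nlinarith, fun ε₁ ε₂ hε₁ hε₂ => ?_⟩
  obtain ⟨hc, hbd, q', hq'⟩ := hq ε₁ ε₂ hε₁ hε₂
  have hs : 0 < Real.sqrt ε₁ := Real.sqrt_pos.2 hε₁
  set ν := ε₂ + Real.sqrt ε₁ with hν
  have hν0 : 0 < ν := by positivity
  have hlow : ∀ x ∈ Icc (0 : ℝ) 1, ν / (2 * K * ε₁) ≤ charRoot1 ε₁ ε₂ b c x := fun x hx => by
    show _ ≤ rootSum ε₁ ε₂ b c x / (2 * ε₁)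
    rw [le_div_iff₀ (by positivity)]
    calc ν / (2 * K * ε₁) * (2 * ε₁) = ν / K := by field_simp
      _ ≤ _ := (hbd x hx).1
  have hup : ∀ x ∈ Icc (0 : ℝ) 1, charRoot1 ε₁ ε₂ b c x ≤ K * ν / (2 * ε₁) := fun x hx => by
    show rootSum ε₁ ε₂ b c x / (2 * ε₁) ≤ _
    gcongr
    exact (hbd x hx).2
  have hbdd : BddBelow (charRoot1 ε₁ ε₂ b c '' Icc (0 : ℝ) 1) :=
    ⟨_, by rintro _ ⟨x, hx, rfl⟩; exact hlow x hx⟩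
  have hμle : ∀ x ∈ Icc (0 : ℝ) 1, mu1 ε₁ ε₂ b c ≤ charRoot1 ε₁ ε₂ b c x := fun x hx =>
    csInf_le hbdd (mem_image_of_mem _ hx)
  have hμge : ν / (2 * K * ε₁) ≤ mu1 ε₁ ε₂ b c := by
    refine le_csInf ((nonempty_Icc.2 zero_le_one).image _) ?_
    rintro _ ⟨x, hx, rfl⟩
    exact hlow x hx
  have hμup : mu1 ε₁ ε₂ b c ≤ K * ν / (2 * ε₁) :=
    (hμle 0 (by simp)).trans (hup 0 (by simp))
  set μ := mu1 ε₁ ε₂ b c with hμ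
  have h1 : ν ≤ 2 * K * (ε₁ * μ) := by
    rw [div_le_iff₀ (by positivity)] at hμge
    linarith
  have h2 : 2 * (ε₁ * μ) ≤ K * ν := by
    rw [le_div_iff₀ (by positivity)] at hμup
    linarith
  have hεμ : 0 < ε₁ * μ := by
    have : 0 < ν / (2 * K * ε₁) := by positivity
    exact mul_pos hε₁ (this.trans_le hμge)
  have hKμ : K * ν / (2 * ε₁) ≤ 2 * K ^ 2 * μ := by
    rw [div_le_iff₀ (by positivity)]
    nlinarith
  refine ⟨?_, ?_, fun x => q' x / (2 * ε₁), ?_⟩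
  · nlinarith
  · nlinarith
  refine ⟨hc.div_const _, fun x hx => (hq' x hx).1.div_const _, hμle,
    fun x hx => (hup x hx).trans hKμ, fun x hx => ?_⟩
  rw [abs_div, abs_of_pos (by positivity : 0 < 2 * ε₁)]
  refine le_trans ?_ hKμ
  gcongr
  exact (hq' x hx).2

/-! ### Boundary layer functions -/

/-- The function `exp(-∫₀ˣ g)`. -/
lemma exists_isLayer {K μ : ℝ} {g g' : ℝ → ℝ} (hK : 1 ≤ K) (hμ : 1 ≤ μ)
    (hg : RootBounds K μ g g') :
    ∃ w : ℝ → ℝ, w 0 = 1 ∧ IsLayer (2 * K ^ 2) μ w (fun x => -g x * w x)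
      (fun x => (g x ^ 2 - g' x) * w x) := by
  -- The extension of `g` by its end values is continuous on the whole line, so its primitive is
  -- differentiable everywhere.
  have hgc : Continuous (IccExtend (zero_le_one (α := ℝ)) ((Icc 0 1).domRestrict g)) :=
    hg.cont.domRestrict.Icc_extend'
  set G := IccExtend (zero_le_one (α := ℝ)) ((Icc 0 1).domRestrict g) with hG
  have hGg : ∀ x ∈ Icc (0 : ℝ) 1, G x = g x := fun x hx => by
    rw [hG, IccExtend_of_mem _ _ hx]; rfl
  have hI : ∀ x, HasDerivAt (fun x => ∫ t in (0 : ℝ)..x, G t) (G x) x := fun x =>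
    intervalIntegral.integral_hasDerivAt_right (hgc.intervalIntegrable _ _)
      (hgc.stronglyMeasurableAtFilter _ _) hgc.continuousAt
  set w : ℝ → ℝ := fun x => Real.exp (-∫ t in (0 : ℝ)..x, G t) with hw
  have hwd : ∀ x ∈ Ioo (0 : ℝ) 1, HasDerivAt w (-g x * w x) x := fun x hx => by
    refine (hI x).neg.exp.congr_deriv ?_
    rw [hGg x (Ioo_subset_Icc_self hx), mul_comm]
    rfl
  have hw0 : ∀ x ∈ Icc (0 : ℝ) 1, |w x| ≤ Real.exp (-(μ * x)) := fun x hx => by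
    rw [hw]
    simp only
    rw [abs_of_pos (Real.exp_pos _)]
    apply Real.exp_le_exp.2
    have : ∫ t in (0 : ℝ)..x, μ ≤ ∫ t in (0 : ℝ)..x, G t := by
      apply intervalIntegral.integral_mono_on hx.1 (by simp) (hgc.intervalIntegrable _ _)
      intro t ht
      have ht' : t ∈ Icc (0 : ℝ) 1 := ⟨ht.1, ht.2.trans hx.2⟩
      rw [hGg t ht']
      exact hg.le t ht'
    rw [intervalIntegral.integral_const] at this
    simp only [sub_zero, smul_eq_mul] at this
    linarith
  have hμ0 : 0 < μ := by linarith
  have hgabs : ∀ x ∈ Icc (0 : ℝ) 1, |g x| ≤ K * μ := fun x hx => by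
    rw [abs_of_nonneg (hμ0.le.trans (hg.le x hx))]
    exact hg.ge x hx
  -- Since `K μ ≥ 1`, the term `g'` in `w'' = (g² - g') w` is dominated by the bound of `g²`; this
  -- gives the factor `2` in `2 * K ^ 2`.
  have hKμ : K * μ ≤ K ^ 2 * μ ^ 2 := by
    have := one_le_mul_of_one_le_of_one_le hK hμ
    nlinarith
  refine ⟨w, by simp [hw], ?_, hwd, fun x hx => ?_, fun x hx => ?_, fun x hx => ?_,
    fun x hx => ?_⟩
  · exact (Real.continuous_exp.comp
      (continuous_iff_continuousAt.2 fun x => (hI x).continuousAt).neg).continuousOn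
  · refine ((hg.deriv x hx).neg.mul (hwd x hx)).congr_deriv ?_
    rw [Pi.neg_apply]
    ring
  · refine (hw0 x hx).trans (le_mul_of_one_le_left (Real.exp_pos _).le ?_)
    nlinarith
  · have hx' := Ioo_subset_Icc_self hx
    rw [abs_mul, abs_neg]
    refine mul_le_mul ((hgabs x hx').trans ?_) (hw0 x hx') (abs_nonneg _) (by positivity)
    gcongr
    nlinarith
  · have hx' := Ioo_subset_Icc_self hx
    rw [abs_mul]
    refine mul_le_mul ?_ (hw0 x hx') (abs_nonneg _) (by positivity)
    refine (abs_sub _ _).trans ?_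
    rw [abs_pow]
    have h1 := pow_le_pow_left₀ (abs_nonneg _) (hgabs x hx') 2
    have h2 := hg.deriv_le x hx
    rw [mul_pow] at h1
    linarith

lemma RootBounds.reflect {K μ : ℝ} {g g' : ℝ → ℝ} (hg : RootBounds K μ g g') :
    RootBounds K μ (fun x => g (1 - x)) (fun x => -g' (1 - x)) := by
  have h1 : ∀ x ∈ Icc (0 : ℝ) 1, 1 - x ∈ Icc (0 : ℝ) 1 := fun x hx =>
    ⟨by linarith [hx.2], by linarith [hx.1]⟩
  have h2 : ∀ x ∈ Ioo (0 : ℝ) 1, 1 - x ∈ Ioo (0 : ℝ) 1 := fun x hx =>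
    ⟨by linarith [hx.2], by linarith [hx.1]⟩
  refine ⟨hg.cont.comp (continuous_const.sub continuous_id).continuousOn h1, fun x hx => ?_,
    fun x hx => hg.le _ (h1 x hx), fun x hx => hg.ge _ (h1 x hx), fun x hx => ?_⟩
  · have := (hg.deriv _ (h2 x hx)).comp x ((hasDerivAt_id x).const_sub 1)
    refine this.congr_deriv ?_
    simp
  · rw [abs_neg]; exact hg.deriv_le _ (h2 x hx)

end Roots

/-! ### Twice differentiable functions -/

/-- `U` is twice differentiable with derivatives `U'` and `U''`; `U'` is continuous on `[0,1]` and
`U''` is bounded on `(0,1)`. -/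
structure IsC2 (U U' U'' : ℝ → ℝ) : Prop where
  cont : ContinuousOn U (Icc 0 1)
  cont' : ContinuousOn U' (Icc 0 1)
  d1 : ∀ x ∈ Ioo (0 : ℝ) 1, HasDerivAt U (U' x) x
  d2 : ∀ x ∈ Ioo (0 : ℝ) 1, HasDerivAt U' (U'' x) x
  bdd : ∃ M : ℝ, ∀ x ∈ Ioo (0 : ℝ) 1, |U'' x| ≤ M

lemma ae_of_forall_Ioo {P : ℝ → Prop} (h : ∀ x ∈ Ioo (0 : ℝ) 1, P x) : ∀ᵐ x ∂volΩ, P x := by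
  filter_upwards [ae_restrict_mem measurableSet_Ioo] with x hx using h x hx

lemma one_sub_mem_Icc {x : ℝ} (hx : x ∈ Icc (0 : ℝ) 1) : 1 - x ∈ Icc (0 : ℝ) 1 :=
  ⟨by linarith [hx.2], by linarith [hx.1]⟩

lemma one_sub_mem_Ioo {x : ℝ} (hx : x ∈ Ioo (0 : ℝ) 1) : 1 - x ∈ Ioo (0 : ℝ) 1 :=
  ⟨by linarith [hx.2], by linarith [hx.1]⟩

namespace IsC2

variable {U U' U'' V V' V'' : ℝ → ℝ}

lemma piecewiseDiff (h : IsC2 U U' U'') : PiecewiseDiff U := by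
  obtain ⟨M, hM⟩ := exists_bound h.cont'
  exact PiecewiseDiff.of_hasDerivAt h.cont countable_empty (fun x hx => h.d1 x hx.1)
    fun x hx => hM x (Ioo_subset_Icc_self hx.1)

lemma piecewiseDiff' (h : IsC2 U U' U'') : PiecewiseDiff U' := by
  obtain ⟨M, hM⟩ := h.bdd
  exact PiecewiseDiff.of_hasDerivAt h.cont' countable_empty (fun x hx => h.d2 x hx.1)
    fun x hx => hM x hx.1

lemma deriv_ae (h : IsC2 U U' U'') : deriv U =ᵐ[volΩ] U' :=
  ae_of_forall_Ioo fun x hx => (h.d1 x hx).deriv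

lemma deriv_ae' (h : IsC2 U U' U'') : deriv U' =ᵐ[volΩ] U'' :=
  ae_of_forall_Ioo fun x hx => (h.d2 x hx).deriv

lemma add (h : IsC2 U U' U'') (h' : IsC2 V V' V'') :
    IsC2 (fun x => U x + V x) (fun x => U' x + V' x) (fun x => U'' x + V'' x) := by
  obtain ⟨M, hM⟩ := h.bdd
  obtain ⟨M', hM'⟩ := h'.bdd
  exact ⟨h.cont.add h'.cont, h.cont'.add h'.cont', fun x hx => (h.d1 x hx).add (h'.d1 x hx),
    fun x hx => (h.d2 x hx).add (h'.d2 x hx), M + M',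
    fun x hx => (abs_add_le _ _).trans (add_le_add (hM x hx) (hM' x hx))⟩

lemma const_mul (k : ℝ) (h : IsC2 U U' U'') :
    IsC2 (fun x => k * U x) (fun x => k * U' x) (fun x => k * U'' x) := by
  obtain ⟨M, hM⟩ := h.bdd
  refine ⟨h.cont.const_mul k, h.cont'.const_mul k, fun x hx => (h.d1 x hx).const_mul k,
    fun x hx => (h.d2 x hx).const_mul k, |k| * M, fun x hx => ?_⟩
  rw [abs_mul]
  exact mul_le_mul_of_nonneg_left (hM x hx) (abs_nonneg _)

lemma affine (m k : ℝ) : IsC2 (fun x => m * x + k) (fun _ => m) (fun _ => 0) :=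
  ⟨by fun_prop, by fun_prop,
    fun x _ => by simpa using ((hasDerivAt_id x).const_mul m).add_const k,
    fun x _ => hasDerivAt_const x m, 0, by simp⟩

lemma reflect (h : IsC2 U U' U'') :
    IsC2 (fun x => U (1 - x)) (fun x => -U' (1 - x)) (fun x => U'' (1 - x)) := by
  obtain ⟨M, hM⟩ := h.bdd
  have hc : ContinuousOn (fun x : ℝ => 1 - x) (Icc 0 1) := by fun_prop
  refine ⟨h.cont.comp hc fun x hx => one_sub_mem_Icc hx,
    (h.cont'.comp hc fun x hx => one_sub_mem_Icc hx).neg, fun x hx => ?_, fun x hx => ?_, M,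
    fun x hx => hM _ (one_sub_mem_Ioo hx)⟩
  · refine ((h.d1 _ (one_sub_mem_Ioo hx)).comp x ((hasDerivAt_id x).const_sub 1)).congr_deriv ?_
    simp
  · refine ((h.d2 _ (one_sub_mem_Ioo hx)).comp x
      ((hasDerivAt_id x).const_sub 1)).neg.congr_deriv ?_
    simp

end IsC2

lemma IsLayer.isC2 {A μ : ℝ} {w w' w'' : ℝ → ℝ} (h : IsLayer A μ w w' w'') (hA : 0 ≤ A)
    (hμ : 0 ≤ μ) (hw' : ContinuousOn w' (Icc 0 1)) : IsC2 w w' w'' :=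
  ⟨h.cont, hw', h.d1, h.d2, A * μ ^ 2, fun x hx => (h.b2 x hx).trans
    (mul_le_of_le_one_right (by positivity) (Real.exp_le_one_iff.2 (by nlinarith [hx.1])))⟩

/-! ### Norms of exponentials -/

lemma integral_reflect (f : ℝ → ℝ) :
    ∫ x in Ioo (0 : ℝ) 1, f (1 - x) = ∫ x in Ioo (0 : ℝ) 1, f x := by
  rw [← integral_Ioc_eq_integral_Ioo, ← intervalIntegral.integral_of_le zero_le_one,
    intervalIntegral.integral_comp_sub_left, ← integral_Ioc_eq_integral_Ioo,
    ← intervalIntegral.integral_of_le zero_le_one]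
  simp

lemma l2_reflect (f : ℝ → ℝ) : l2 (fun x => f (1 - x)) = l2 f := by
  unfold l2
  rw [integral_reflect fun x => f x ^ 2]

/-- A layer of width `1 / a` gains `a^(-1/2)` in `L²`. -/
lemma l2_exp_le {a : ℝ} (ha : 0 < a) : l2 (fun x => Real.exp (-(a * x))) ≤ 1 / Real.sqrt a := by
  have h : ∫ x in Ioo (0 : ℝ) 1, Real.exp (-(a * x)) ^ 2 ≤ 1 / a := by
    rw [← integral_Ioc_eq_integral_Ioo, ← intervalIntegral.integral_of_le zero_le_one]
    have e : ∀ x, Real.exp (-(a * x)) ^ 2 = Real.exp (-(2 * a) * x) := fun x => by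
      rw [← Real.exp_nat_mul]; congr 1; push_cast; ring
    simp only [e]
    rw [intervalIntegral.integral_comp_mul_left (fun x => Real.exp x) (by linarith), integral_exp]
    simp only [mul_one, mul_zero, Real.exp_zero, smul_eq_mul]
    have : (-(2 * a))⁻¹ * (Real.exp (-(2 * a)) - 1) = (1 - Real.exp (-(2 * a))) / (2 * a) := by
      field_simp; ring
    rw [this, div_le_div_iff₀ (by positivity) ha]
    nlinarith [Real.exp_pos (-(2 * a))]
  rw [l2, one_div, ← Real.sqrt_inv, ← one_div]
  exact Real.sqrt_le_sqrt h

/-- One estimate for a smooth contribution and a layer at each end. Unneeded terms are switched off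
by zero amplitudes and a dummy rate `1`. -/
lemma l2_le_of_exp_bounds {f : ℝ → ℝ} {M Q₀ Q₁ a₀ a₁ : ℝ} (hM : 0 ≤ M) (hQ₀ : 0 ≤ Q₀)
    (hQ₁ : 0 ≤ Q₁) (ha₀ : 0 < a₀) (ha₁ : 0 < a₁)
    (h : ∀ᵐ x ∂volΩ, |f x| ≤
      M + (Q₀ * Real.exp (-(a₀ * x)) + Q₁ * Real.exp (-(a₁ * (1 - x))))) :
    l2 f ≤ M + (Q₀ * (1 / Real.sqrt a₀) + Q₁ * (1 / Real.sqrt a₁)) := by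
  have hm₀ : MemLp (fun x => Q₀ * Real.exp (-(a₀ * x))) 2 volΩ :=
    ContinuousOn.memLp_two (by fun_prop)
  have hm₁ : MemLp (fun x => Q₁ * Real.exp (-(a₁ * (1 - x)))) 2 volΩ :=
    ContinuousOn.memLp_two (by fun_prop)
  have hc : MemLp (fun _ : ℝ => M) 2 volΩ := memLp_const M
  refine (l2_mono (MemLp.add_fun hc (MemLp.add_fun hm₀ hm₁)) h).trans ?_
  refine (l2_add_le hc (MemLp.add_fun hm₀ hm₁)).trans (add_le_add ?_ ?_)
  · exact l2_le_of_abs_le hM (Eventually.of_forall fun _ => (abs_of_nonneg hM).le)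
  refine (l2_add_le hm₀ hm₁).trans (add_le_add ?_ ?_)
  · rw [l2_const_mul hQ₀]
    exact mul_le_mul_of_nonneg_left (l2_exp_le ha₀) hQ₀
  · rw [l2_const_mul hQ₁, l2_reflect fun x => Real.exp (-(a₁ * x))]
    exact mul_le_mul_of_nonneg_left (l2_exp_le ha₁) hQ₁

lemma exp_neg_le_two_div_sq {x : ℝ} (hx : 0 < x) : Real.exp (-x) ≤ 2 / x ^ 2 := by
  rw [Real.exp_neg, inv_eq_one_div, div_le_div_iff₀ (Real.exp_pos _) (by positivity)]
  have := Real.quadratic_le_exp_of_nonneg hx.le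
  nlinarith

/-! ### The smooth part of the solution -/

/-- The differential operator applied to `U`. -/
def diffOp (ε₁ ε₂ : ℝ) (b c U U' U'' : ℝ → ℝ) (x : ℝ) : ℝ :=
  -ε₁ * U'' x + ε₂ * (b x * U' x) + c x * U x

lemma exists_isC2_of_contDiffOn {g : ℝ → ℝ} (hg : ContDiffOn ℝ 2 g (Icc 0 1)) :
    ∃ g' g'' : ℝ → ℝ, IsC2 g g' g'' ∧ ContinuousOn g'' (Icc 0 1) ∧
      g' = derivWithin g (Icc 0 1) := by
  obtain ⟨h1, h2⟩ := exists_deriv_of_contDiffOn (k := 1) (by exact_mod_cast hg)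
  obtain ⟨h3, h4⟩ := exists_deriv_of_contDiffOn (k := 0) (by exact_mod_cast h1)
  obtain ⟨M, hM⟩ := exists_bound h3.continuousOn
  exact ⟨_, _, ⟨hg.continuousOn, h1.continuousOn, h2, h4, M,
    fun x hx => hM x (Ioo_subset_Icc_self hx)⟩, h3.continuousOn, rfl⟩

/-- The function `f/c + ε₂ s₁`, where `c s₁ = -b (f/c)'`, solves the differential equation up to
terms of order `ε₁ + ε₂²`. -/
theorem exists_smoothPart {b c f : ℝ → ℝ} {β : ℝ} (hb : ContDiffOn ℝ 3 b (Icc 0 1))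
    (hc : ContDiffOn ℝ 3 c (Icc 0 1)) (hf : ContDiffOn ℝ 3 f (Icc 0 1)) (hβ : 0 < β)
    (hcβ : ∀ x ∈ Icc (0 : ℝ) 1, β ≤ c x) (E : ℝ) :
    ∃ M : ℝ, 0 ≤ M ∧ ∀ ε₁ ε₂ : ℝ, 0 < ε₁ → 0 < ε₂ → ε₂ ≤ E → ∃ S S' S'' : ℝ → ℝ,
      IsC2 S S' S'' ∧ (∀ x ∈ Icc (0 : ℝ) 1, |S x| ≤ M) ∧ (∀ x ∈ Ioo (0 : ℝ) 1, |S'' x| ≤ M) ∧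
      ∀ x ∈ Ioo (0 : ℝ) 1, |f x - diffOp ε₁ ε₂ b c S S' S'' x| ≤ M * (ε₁ + ε₂ ^ 2) := by
  have hc0 : ∀ x ∈ Icc (0 : ℝ) 1, c x ≠ 0 := fun x hx => (hβ.trans_le (hcβ x hx)).ne'
  have hs0 : ContDiffOn ℝ 3 (fun x => f x / c x) (Icc 0 1) := hf.div hc hc0
  obtain ⟨s', s'', hs, hsc, hse⟩ := exists_isC2_of_contDiffOn (hs0.of_le (by norm_num))
  -- Three derivatives of the data are spent here: the correction contains `s'` and must itself be
  -- twice differentiable.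
  have hs'2 : ContDiffOn ℝ 2 s' (Icc 0 1) := by
    rw [hse]
    exact_mod_cast (exists_deriv_of_contDiffOn (k := 2) (by exact_mod_cast hs0)).1
  have ht0 : ContDiffOn ℝ 2 (fun x => -(b x * s' x) / c x) (Icc 0 1) :=
    ((hb.of_le (by norm_num)).mul hs'2).neg.div (hc.of_le (by norm_num)) hc0
  obtain ⟨t', t'', ht, htc, -⟩ := exists_isC2_of_contDiffOn ht0
  obtain ⟨M0, h0⟩ := exists_bound hs.cont
  obtain ⟨M0'', h0''⟩ := exists_bound hsc
  obtain ⟨M1, h1⟩ := exists_bound ht.cont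
  obtain ⟨M1', h1'⟩ := exists_bound ht.cont'
  obtain ⟨M1'', h1''⟩ := exists_bound htc
  obtain ⟨B, hB⟩ := exists_bound hb.continuousOn
  have hz : (0 : ℝ) ∈ Icc (0 : ℝ) 1 := by simp
  have p0 := (abs_nonneg _).trans (h0 0 hz)
  have p0'' := (abs_nonneg _).trans (h0'' 0 hz)
  have p1 := (abs_nonneg _).trans (h1 0 hz)
  have p1' := (abs_nonneg _).trans (h1' 0 hz)
  have p1'' := (abs_nonneg _).trans (h1'' 0 hz)
  have pB := (abs_nonneg _).trans (hB 0 hz)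
  set M := M0 + M0'' + |E| * (M1 + M1'') + B * M1' with hM
  have pBM := mul_nonneg pB p1'
  have pE := mul_nonneg (abs_nonneg E) p1
  have pE'' := mul_nonneg (abs_nonneg E) p1''
  refine ⟨M, by rw [hM]; linarith, fun ε₁ ε₂ hε₁ hε₂ hE =>
    ⟨_, _, _, hs.add (ht.const_mul ε₂), fun x hx => ?_, fun x hx => ?_, fun x hx => ?_⟩⟩
  · have hE' : ε₂ ≤ |E| := hE.trans (le_abs_self E)
    refine (abs_add_le _ _).trans ?_
    rw [abs_mul, abs_of_pos hε₂]
    have := mul_le_mul hE' (h1 x hx) (abs_nonneg _) (abs_nonneg _)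
    linarith [h0 x hx]
  · have hx' := Ioo_subset_Icc_self hx
    have hE' : ε₂ ≤ |E| := hE.trans (le_abs_self E)
    refine (abs_add_le _ _).trans ?_
    rw [abs_mul, abs_of_pos hε₂]
    have := mul_le_mul hE' (h1'' x hx') (abs_nonneg _) (abs_nonneg _)
    linarith [h0'' x hx']
  · have hx' := Ioo_subset_Icc_self hx
    have hE' : ε₂ ≤ |E| := hE.trans (le_abs_self E)
    have hcx := hc0 x hx'
    -- `c s = f` removes order zero and `c t = -b s'` removes order `ε₂`; what remains carries `ε₁`
    -- or `ε₂²`.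
    have e : f x - diffOp ε₁ ε₂ b c (fun x => f x / c x + ε₂ * (-(b x * s' x) / c x))
        (fun x => s' x + ε₂ * t' x) (fun x => s'' x + ε₂ * t'' x) x =
        ε₁ * (s'' x + ε₂ * t'' x) - ε₂ ^ 2 * (b x * t' x) := by
      unfold diffOp
      field_simp
      ring
    rw [e]
    refine (abs_sub _ _).trans ?_
    rw [abs_mul, abs_of_pos hε₁, abs_mul (ε₂ ^ 2), abs_of_nonneg (sq_nonneg ε₂)]
    have k1 : |s'' x + ε₂ * t'' x| ≤ M := by
      refine (abs_add_le _ _).trans ?_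
      rw [abs_mul, abs_of_pos hε₂]
      have := mul_le_mul hE' (h1'' x hx') (abs_nonneg _) (abs_nonneg _)
      linarith [h0'' x hx']
    have k2 : |b x * t' x| ≤ M := by
      rw [abs_mul]
      have := mul_le_mul (hB x hx') (h1' x hx') (abs_nonneg _) pB
      linarith
    have := mul_le_mul_of_nonneg_left k1 hε₁.le
    have := mul_le_mul_of_nonneg_left k2 (sq_nonneg ε₂)
    linarith

/-! ### The approximation of the solution -/

lemma IsLayer.mono {A A' μ : ℝ} {w w' w'' : ℝ → ℝ} (h : IsLayer A μ w w' w'') (hμ : 0 ≤ μ)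
    (hA : A ≤ A') : IsLayer A' μ w w' w'' :=
  ⟨h.cont, h.d1, h.d2, fun x hx => (h.b0 x hx).trans (by gcongr),
    fun x hx => (h.b1 x hx).trans (by gcongr), fun x hx => (h.b2 x hx).trans (by gcongr)⟩

/-- At the far end `exp(-μ) ≤ 2 / μ²` is already of order `N⁻²`, hence negligible. -/
lemma IsLayer.abs_one_le {A μ N : ℝ} {w w' w'' : ℝ → ℝ} (h : IsLayer A μ w w' w'') (hA : 0 ≤ A)
    (hN : 0 < N) (hμ : N ≤ μ) : |w 1| ≤ 2 * A / N ^ 2 := by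
  have h1 := h.b0 1 (by simp)
  rw [mul_one] at h1
  calc |w 1| ≤ A * Real.exp (-μ) := h1
    _ ≤ A * (2 / μ ^ 2) := by gcongr; exact exp_neg_le_two_div_sq (hN.trans_le hμ)
    _ ≤ A * (2 / N ^ 2) := by gcongr
    _ = _ := by ring

lemma one_div_sqrt_mul_le {κ μ K : ℝ} (hκ0 : 0 < κ) (hκ : κ ≤ 1 / 5) (hK : 324 / κ ^ 2 ≤ K)
    (hμ : 0 < μ) : 1 / Real.sqrt (κ * μ) ≤ K / Real.sqrt μ := by
  have hs := Real.sqrt_pos.2 hμ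
  have hκs := Real.sqrt_pos.2 hκ0
  have h1 : 1 ≤ K * Real.sqrt κ := by
    have h2 : κ ≤ Real.sqrt κ := Real.le_sqrt_of_sq_le (by nlinarith)
    have h3 : 324 ≤ K * κ ^ 2 := (div_le_iff₀ (by positivity)).1 hK
    have hK0 : 0 ≤ K := le_trans (by positivity) hK
    have h4 : K * κ ^ 2 ≤ K * Real.sqrt κ := by
      gcongr
      nlinarith
    linarith
  rw [Real.sqrt_mul hκ0.le, div_le_div_iff₀ (by positivity) hs]
  nlinarith

lemma mul_div_sqrt {μ : ℝ} (a : ℝ) : a * μ / Real.sqrt μ = a * Real.sqrt μ := by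
  rw [mul_div_assoc, Real.div_sqrt]

section Approximation

variable {ε₁ ε₂ K κ μ₀ μ₁ : ℝ} {n : ℕ} {y : ℕ → ℝ} {b c f : ℝ → ℝ}
  {S S' S'' w w' w'' z z' z'' : ℝ → ℝ}

set_option maxHeartbeats 1000000 in
/-- An approximation `U` of the solution with a small residual, and a piecewise affine
approximation `P` of `U`. -/
theorem exists_approximation (hK : 1 ≤ K) (hε₁ : 0 < ε₁) (hε₂ : 0 < ε₂) (hκ0 : 0 < κ)
    (hκ : κ ≤ 1 / 5) (hκK : 324 / κ ^ 2 ≤ K) (hn : 4 ≤ n) (hμ₀ : 4 * (n : ℝ) ≤ μ₀)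
    (hμ₁ : 4 * (n : ℝ) ≤ μ₁) (hy : IsMesh (4 * n) y)
    (hstep : ∀ i < 4 * n, y (i + 1) - y i ≤ K / (4 * n))
    (hy₀ : ∀ i < n, Real.exp (-(κ * μ₀ * y i)) ^ 2 = 1 - (1 - μ₀⁻¹) * (i / n))
    (hy₁ : ∀ i < n, Real.exp (-(κ * μ₁ * (1 - y (4 * n - i)))) ^ 2 = 1 - (1 - μ₁⁻¹) * (i / n))
    (hb : ∀ x ∈ Icc (0 : ℝ) 1, |b x| ≤ K) (hc : ∀ x ∈ Icc (0 : ℝ) 1, |c x| ≤ K)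
    (hS : IsC2 S S' S'') (hSK : ∀ x ∈ Icc (0 : ℝ) 1, |S x| ≤ K)
    (hSK'' : ∀ x ∈ Ioo (0 : ℝ) 1, |S'' x| ≤ K)
    (hSr : ∀ x ∈ Ioo (0 : ℝ) 1, |f x - diffOp ε₁ ε₂ b c S S' S'' x| ≤ K * (ε₁ + ε₂ ^ 2))
    (hw : IsLayer K μ₀ w w' w'') (hw' : ContinuousOn w' (Icc 0 1)) (hw0 : w 0 = 1)
    (hwr : ∀ x ∈ Ioo (0 : ℝ) 1, |diffOp ε₁ ε₂ b c w w' w'' x| ≤ K * ε₁ * μ₀ * |w x|)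
    (hz : IsLayer K μ₁ z z' z'') (hz' : ContinuousOn z' (Icc 0 1)) (hz0 : z 0 = 1)
    (hzr : ∀ x ∈ Ioo (0 : ℝ) 1, |diffOp ε₁ ε₂ b c (fun x => z (1 - x)) (fun x => -z' (1 - x))
      (fun x => z'' (1 - x)) x| ≤ K * ε₁ * μ₁ * |z (1 - x)|) :
    ∃ P U U' U'' η₀ η₁ : ℝ → ℝ, PiecewiseAffine (4 * n) y P ∧ P 0 = 0 ∧ P 1 = 0 ∧
      IsC2 U U' U'' ∧ U 0 = 0 ∧ U 1 = 0 ∧ PiecewiseDiff η₀ ∧ PiecewiseDiff η₁ ∧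
      (fun x => P x - U x) = (fun x => η₀ x + η₁ x) ∧
      l2 η₀ ≤ 6 * K ^ 4 / (4 * n) ^ 2 ∧ l2 (deriv η₀) ≤ 6 * K ^ 4 * Real.sqrt μ₀ / (4 * n) ∧
      l2 η₁ ≤ 6 * K ^ 4 / (4 * n) ^ 2 / Real.sqrt μ₁ ∧
      l2 (deriv η₁) ≤ 6 * K ^ 4 * Real.sqrt μ₁ / (4 * n) ∧
      l2 (fun x => f x - diffOp ε₁ ε₂ b c U U' U'' x) ≤ K * (ε₁ + ε₂ ^ 2) +
        4 * K ^ 3 * (ε₂ + 1) / (4 * n) ^ 2 + K ^ 3 * ε₁ * (Real.sqrt μ₀ + Real.sqrt μ₁) := by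
  have hn4 : (4 : ℝ) ≤ n := by exact_mod_cast hn
  have hK0 : 0 < K := by linarith
  obtain ⟨PS, hPS, hPS0, hPS1, hPSe⟩ := exists_interp_of_mesh hy hK0.le
    (H := K / (4 * n)) hstep hS.cont hS.d1 hS.d2 hSK''
  obtain ⟨Pw, hPw, hPw0, hPw1, hPwe⟩ := hw.exists_approx hκ0 hκ hK0.le hn hμ₀ hy hy₀
  obtain ⟨Pz, hPz, hPz0, hPz1, hPze⟩ := hz.exists_approx hκ0 hκ hK0.le hn hμ₁ hy.reflect hy₁
  set N : ℝ := 4 * n with hN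
  have hN0 : 0 < N := by linarith
  have hμ₀0 : 0 < μ₀ := by linarith
  have hμ₁0 : 0 < μ₁ := by linarith
  have hwC := hw.isC2 hK0.le hμ₀0.le hw'
  have hzC := (hz.isC2 hK0.le hμ₁0.le hz').reflect
  have hPzr := hPz.reflect
  have hrefl : ∀ x ∈ Ioo (0 : ℝ) 1 \ range y,
      1 - x ∈ Ioo (0 : ℝ) 1 \ range fun i => 1 - y (4 * n - i) := fun x hx => by
    refine ⟨one_sub_mem_Ioo hx.1, ?_⟩
    rintro ⟨i, hi⟩
    exact hx.2 ⟨4 * n - i, by simp only at hi; linarith⟩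
  have hS0 := hSK 0 (by simp)
  have hS1 := hSK 1 (by simp)
  have hw1 := hw.abs_one_le hK0.le hN0 hμ₀
  have hz1 := hz.abs_one_le hK0.le hN0 hμ₁
  have hpd := fun {v : ℝ → ℝ} (h : PiecewiseAffine (4 * n) y v) => h.piecewiseDiff hy
  have hKpow : ∀ {i j : ℕ}, i ≤ j → K ^ i ≤ K ^ j := fun h => pow_le_pow_right₀ hK h
  have hK24 : K ^ 2 ≤ K ^ 4 := hKpow (by norm_num)
  have hK34 : K ^ 3 ≤ K ^ 4 := hKpow (by norm_num)
  have hNN : 1 / N ^ 2 ≤ 1 / N := one_div_le_one_div_of_le hN0 (by nlinarith)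
  have hsq0 : 1 ≤ Real.sqrt μ₀ := Real.one_le_sqrt.2 (by linarith)
  set S₀ := S 0 with hS₀
  set S₁ := S 1 with hS₁
  -- The affine function with values `S₁ z(1)` at `0` and `S₀ w(1)` at `1` cancels what each layer
  -- leaves at the opposite end.
  set A := S₀ * w 1 - S₁ * z 1 with hA
  have hp1 : |S₀ * w 1| ≤ 2 * K ^ 2 / N ^ 2 := by
    rw [abs_mul]
    calc |S₀| * |w 1| ≤ K * (2 * K / N ^ 2) := by gcongr
      _ = _ := by ring
  have hp2 : |S₁ * z 1| ≤ 2 * K ^ 2 / N ^ 2 := by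
    rw [abs_mul]
    calc |S₁| * |z 1| ≤ K * (2 * K / N ^ 2) := by gcongr
      _ = _ := by ring
  have hAle : |A| ≤ 4 * K ^ 2 / N ^ 2 := by
    refine (abs_sub _ _).trans ((add_le_add hp1 hp2).trans_eq ?_)
    ring
  have hlin : ∀ x ∈ Ioo (0 : ℝ) 1, |A * x + S₁ * z 1| ≤ 4 * K ^ 2 / N ^ 2 := fun x hx => by
    have e : A * x + S₁ * z 1 = S₀ * w 1 * x + S₁ * z 1 * (1 - x) := by rw [hA]; ring
    rw [e]
    refine (abs_add_le _ _).trans ?_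
    rw [abs_mul _ x, abs_mul _ (1 - x), abs_of_pos hx.1, abs_of_pos (sub_pos.2 hx.2)]
    have q0 : 0 ≤ 2 * K ^ 2 / N ^ 2 := by positivity
    have q1 := mul_le_mul_of_nonneg_right hp1 hx.1.le
    have q2 := mul_le_mul_of_nonneg_right hp2 (sub_pos.2 hx.2).le
    have q3 : 4 * K ^ 2 / N ^ 2 = 2 * (2 * K ^ 2 / N ^ 2) := by ring
    rw [q3]
    nlinarith
  have hUC := ((hS.add (hwC.const_mul (-S₀))).add (hzC.const_mul (-S₁))).add
    (IsC2.affine A (S₁ * z 1))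
  -- The affine part belongs to `U` but not to `P`, so it enters the error whole; it is `O(N⁻²)`.
  -- The right layer is kept apart in `η₁`, since its convection is treated differently.
  have hη₀ : PiecewiseDiff fun x => ((PS x - S x) + S₀ * (w x - Pw x)) + -1 * (A * x + S₁ * z 1) :=
    (((hpd hPS).sub hS.piecewiseDiff).add ((hwC.piecewiseDiff.sub (hpd hPw)).const_mul S₀)).add
      ((IsC2.affine A (S₁ * z 1)).piecewiseDiff.const_mul (-1))
  have hη₁ : PiecewiseDiff fun x => S₁ * (z (1 - x) - Pz (1 - x)) :=
    (hzC.piecewiseDiff.sub (hpd hPzr)).const_mul S₁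
  have hcount := countable_range y
  refine ⟨_, _, _, _, _, _, (hPS.add (hPw.const_mul (-S₀))).add (hPzr.const_mul (-S₁)),
    ?_, ?_, hUC, ?_, ?_, hη₀, hη₁, ?_, ?_, ?_, ?_, ?_, ?_⟩
  · simp only [sub_zero, hPS0, hPw0, hPz1, hw0]; ring
  · simp only [sub_self, hPS1, hPw1, hPz0, hz0]; ring
  · simp only [sub_zero, hw0, ← hS₀]; ring
  · simp only [sub_self, hz0, ← hS₁]; rw [hA]; ring
  · ext x; ring
  · refine l2_le_of_abs_le (by positivity) (ae_of_forall_diff_countable hcount fun x hx => ?_)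
    obtain ⟨e1, -⟩ := hPSe x hx
    obtain ⟨e2, -⟩ := hPwe x hx
    have e3 := hlin x hx.1
    have hexp : Real.exp (-(κ * μ₀ * x)) ≤ 1 := by
      apply Real.exp_le_one_iff.2
      have := mul_pos (mul_pos hκ0 hμ₀0) hx.1.1
      linarith
    have e2' : |S₀ * (w x - Pw x)| ≤ K ^ 3 / N ^ 2 := by
      rw [abs_mul]
      calc |S₀| * |w x - Pw x| ≤ K * (K * (K / N ^ 2) * 1) :=
            mul_le_mul hS0 (e2.trans (by gcongr)) (abs_nonneg _) hK0.le
        _ = _ := by ring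
    rw [abs_sub_comm] at e1
    have e4 : K * (K / N) ^ 2 = K ^ 3 / N ^ 2 := by ring
    rw [e4] at e1
    have e5 : 6 * K ^ 4 / N ^ 2 = 6 * (K ^ 4 / N ^ 2) := by ring
    have e6 : 4 * K ^ 2 / N ^ 2 = 4 * (K ^ 2 / N ^ 2) := by ring
    have e7 : K ^ 3 / N ^ 2 ≤ K ^ 4 / N ^ 2 := by gcongr
    have e8 : K ^ 2 / N ^ 2 ≤ K ^ 4 / N ^ 2 := by gcongr
    refine (abs_add_three _ _ _).trans ?_
    rw [neg_one_mul, abs_neg]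
    linarith
  · have hbound : ∀ᵐ x ∂volΩ, |deriv (fun x => ((PS x - S x) + S₀ * (w x - Pw x)) +
        -1 * (A * x + S₁ * z 1)) x| ≤ 5 * K ^ 2 / N +
        (K ^ 3 * μ₀ / N * Real.exp (-(κ * μ₀ * x)) + 0 * Real.exp (-(1 * (1 - x)))) := by
      filter_upwards [ae_of_forall_diff_countable hcount fun x hx => And.intro hx
        (And.intro (hPSe x hx).2 (hPwe x hx).2), (hpd hPS).ae_differentiableAt,
        (hpd hPw).ae_differentiableAt] with x h1 h2 h3
      obtain ⟨hx, e1, e2⟩ := h1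
      have hd := (((h2.hasDerivAt.sub (hS.d1 x hx.1)).add
        (((hw.d1 x hx.1).sub h3.hasDerivAt).const_mul S₀)).add
        ((((hasDerivAt_id x).const_mul A).add_const (S₁ * z 1)).const_mul (-1)))
      have hd' := hd.deriv
      simp only [id, mul_one] at hd'
      refine (congrArg abs hd').trans_le ?_
      rw [zero_mul, add_zero]
      have e2' : |S₀ * (w' x - deriv Pw x)| ≤ K ^ 3 * μ₀ / N * Real.exp (-(κ * μ₀ * x)) := by
        rw [abs_mul]
        calc |S₀| * |w' x - deriv Pw x| ≤ K * (K * (K * μ₀ / N) * Real.exp (-(κ * μ₀ * x))) :=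
              mul_le_mul hS0 (e2.trans (by gcongr)) (abs_nonneg _) hK0.le
          _ = _ := by ring
      rw [abs_sub_comm] at e1
      have e4 : K * (K / N) = K ^ 2 / N := by ring
      rw [e4] at e1
      have e5 : 4 * K ^ 2 / N ^ 2 ≤ 4 * K ^ 2 / N := by
        calc 4 * K ^ 2 / N ^ 2 = 4 * K ^ 2 * (1 / N ^ 2) := by ring
          _ ≤ 4 * K ^ 2 * (1 / N) := by gcongr
          _ = _ := by ring
      have e6 : 5 * K ^ 2 / N = K ^ 2 / N + 4 * K ^ 2 / N := by ring
      refine (abs_add_three _ _ _).trans ?_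
      rw [neg_one_mul, abs_neg]
      linarith
    refine (l2_le_of_exp_bounds (by positivity) (by positivity) le_rfl (mul_pos hκ0 hμ₀0) one_pos
      hbound).trans ?_
    rw [zero_mul, add_zero]
    have e1 := one_div_sqrt_mul_le hκ0 hκ hκK hμ₀0
    -- The derivative loses `μ₀` pointwise but only `√μ₀` in `L²`.
    have e2 : K ^ 3 * μ₀ / N * (1 / Real.sqrt (κ * μ₀)) ≤ K ^ 4 * Real.sqrt μ₀ / N := by
      calc K ^ 3 * μ₀ / N * (1 / Real.sqrt (κ * μ₀)) ≤ K ^ 3 * μ₀ / N * (K / Real.sqrt μ₀) := by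
            gcongr
        _ = K ^ 4 / N * μ₀ / Real.sqrt μ₀ := by ring
        _ = K ^ 4 * Real.sqrt μ₀ / N := by rw [mul_div_sqrt]; ring
    have e3 : 5 * K ^ 2 / N ≤ 5 * K ^ 4 * Real.sqrt μ₀ / N := by
      apply div_le_div_of_nonneg_right _ hN0.le
      nlinarith [pow_pos hK0 4]
    have e4 : 6 * K ^ 4 * Real.sqrt μ₀ / N =
      5 * K ^ 4 * Real.sqrt μ₀ / N + K ^ 4 * Real.sqrt μ₀ / N := by ring
    linarith
  · have hbound : ∀ᵐ x ∂volΩ, |S₁ * (z (1 - x) - Pz (1 - x))| ≤ 0 +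
        (0 * Real.exp (-(1 * x)) + K ^ 3 / N ^ 2 * Real.exp (-(κ * μ₁ * (1 - x)))) := by
      refine ae_of_forall_diff_countable hcount fun x hx => ?_
      obtain ⟨e2, -⟩ := hPze _ (hrefl x hx)
      rw [zero_mul, zero_add, zero_add, abs_mul]
      calc |S₁| * |z (1 - x) - Pz (1 - x)| ≤
            K * (K * (K / N ^ 2) * Real.exp (-(κ * μ₁ * (1 - x)))) :=
            mul_le_mul hS1 (e2.trans (by gcongr)) (abs_nonneg _) hK0.le
        _ = _ := by ring
    refine (l2_le_of_exp_bounds le_rfl le_rfl (by positivity) one_pos (mul_pos hκ0 hμ₁0)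
      hbound).trans ?_
    rw [zero_mul, zero_add, zero_add]
    have e1 := one_div_sqrt_mul_le hκ0 hκ hκK hμ₁0
    calc K ^ 3 / N ^ 2 * (1 / Real.sqrt (κ * μ₁)) ≤ K ^ 3 / N ^ 2 * (K / Real.sqrt μ₁) := by
          gcongr
      _ = 1 * K ^ 4 / N ^ 2 / Real.sqrt μ₁ := by ring
      _ ≤ _ := by gcongr; norm_num
  · have hbound : ∀ᵐ x ∂volΩ, |deriv (fun x => S₁ * (z (1 - x) - Pz (1 - x))) x| ≤ 0 +
        (0 * Real.exp (-(1 * x)) + K ^ 3 * μ₁ / N * Real.exp (-(κ * μ₁ * (1 - x)))) := by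
      refine ae_of_forall_diff_countable hcount fun x hx => ?_
      have hx1 := hrefl x hx
      obtain ⟨-, e2⟩ := hPze _ hx1
      obtain ⟨i, hi, hix⟩ := hy.reflect.exists_mem_Ioo (Ioo_subset_Icc_self hx1.1) hx1.2
      obtain ⟨m, k, hmk⟩ := hPz.2 i hi
      have hdz := (PiecewiseAffine.hasDerivAt hmk hix).differentiableAt.hasDerivAt
      have hd := ((((hz.d1 _ hx1.1).sub hdz).comp x
        ((hasDerivAt_id x).const_sub 1)).const_mul S₁).deriv
      refine (congrArg abs hd).trans_le ?_
      rw [zero_mul, zero_add, zero_add, mul_neg_one, mul_neg, abs_neg, abs_mul]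
      calc |S₁| * |z' (1 - x) - deriv Pz (1 - x)| ≤
            K * (K * (K * μ₁ / N) * Real.exp (-(κ * μ₁ * (1 - x)))) :=
            mul_le_mul hS1 (e2.trans (by gcongr)) (abs_nonneg _) hK0.le
        _ = _ := by ring
    refine (l2_le_of_exp_bounds le_rfl le_rfl (by positivity) one_pos (mul_pos hκ0 hμ₁0)
      hbound).trans ?_
    rw [zero_mul, zero_add, zero_add]
    have e1 := one_div_sqrt_mul_le hκ0 hκ hκK hμ₁0
    calc K ^ 3 * μ₁ / N * (1 / Real.sqrt (κ * μ₁)) ≤ K ^ 3 * μ₁ / N * (K / Real.sqrt μ₁) := by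
          gcongr
      _ = K ^ 4 / N * μ₁ / Real.sqrt μ₁ := by ring
      _ = 1 * K ^ 4 * Real.sqrt μ₁ / N := by rw [mul_div_sqrt]; ring
      _ ≤ _ := by gcongr; norm_num
  · have hbound : ∀ᵐ x ∂volΩ, |f x - diffOp ε₁ ε₂ b c
        (fun x => ((S x + -S₀ * w x) + -S₁ * z (1 - x)) + (A * x + S₁ * z 1))
        (fun x => ((S' x + -S₀ * w' x) + -S₁ * -z' (1 - x)) + A)
        (fun x => ((S'' x + -S₀ * w'' x) + -S₁ * z'' (1 - x)) + 0) x| ≤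
        (K * (ε₁ + ε₂ ^ 2) + 4 * K ^ 3 * (ε₂ + 1) / N ^ 2) +
        (K ^ 3 * ε₁ * μ₀ * Real.exp (-(μ₀ * x)) +
          K ^ 3 * ε₁ * μ₁ * Real.exp (-(μ₁ * (1 - x)))) := by
      refine ae_of_forall_Ioo fun x hx => ?_
      have hx' := Ioo_subset_Icc_self hx
      -- By linearity: the residual of `S`, the operator on the affine part, and the operator on the
      -- two layers.
      have e : f x - diffOp ε₁ ε₂ b c
          (fun x => ((S x + -S₀ * w x) + -S₁ * z (1 - x)) + (A * x + S₁ * z 1))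
          (fun x => ((S' x + -S₀ * w' x) + -S₁ * -z' (1 - x)) + A)
          (fun x => ((S'' x + -S₀ * w'' x) + -S₁ * z'' (1 - x)) + 0) x =
          ((f x - diffOp ε₁ ε₂ b c S S' S'' x) +
          -(ε₂ * (b x * A) + c x * (A * x + S₁ * z 1))) +
          (S₀ * diffOp ε₁ ε₂ b c w w' w'' x + S₁ * diffOp ε₁ ε₂ b c (fun x => z (1 - x))
            (fun x => -z' (1 - x)) (fun x => z'' (1 - x)) x) := by
        unfold diffOp; ring
      rw [e]
      refine (abs_add_le _ _).trans (add_le_add ((abs_add_le _ _).trans (add_le_add (hSr x hx) ?_))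
        ((abs_add_le _ _).trans (add_le_add ?_ ?_)))
      · rw [abs_neg]
        refine (abs_add_le _ _).trans ?_
        rw [abs_mul, abs_mul, abs_mul, abs_of_pos hε₂]
        calc ε₂ * (|b x| * |A|) + |c x| * |A * x + S₁ * z 1| ≤
              ε₂ * (K * (4 * K ^ 2 / N ^ 2)) + K * (4 * K ^ 2 / N ^ 2) := by
              gcongr
              · exact hb x hx'
              · exact hc x hx'
              · exact hlin x hx
          _ = _ := by ring
      · rw [abs_mul]
        calc |S₀| * |diffOp ε₁ ε₂ b c w w' w'' x| ≤
              K * (K * ε₁ * μ₀ * (K * Real.exp (-(μ₀ * x)))) :=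
              mul_le_mul hS0 ((hwr x hx).trans (by gcongr; exact hw.b0 x hx')) (abs_nonneg _) hK0.le
          _ = _ := by ring
      · rw [abs_mul]
        calc |S₁| * |diffOp ε₁ ε₂ b c (fun x => z (1 - x)) (fun x => -z' (1 - x))
                (fun x => z'' (1 - x)) x| ≤
              K * (K * ε₁ * μ₁ * (K * Real.exp (-(μ₁ * (1 - x))))) :=
              mul_le_mul hS1 ((hzr x hx).trans
                (by gcongr; exact hz.b0 _ (one_sub_mem_Icc hx'))) (abs_nonneg _) hK0.le
          _ = _ := by ring
    refine (l2_le_of_exp_bounds (by positivity) (by positivity) (by positivity) hμ₀0 hμ₁0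
      hbound).trans_eq ?_
    rw [mul_one_div, mul_one_div, mul_div_sqrt, mul_div_sqrt]
    ring

end Approximation

/-! ### The error estimate -/

section ParameterEstimates

variable {ε₁ ε₂ K N μ₀ μ₁ : ℝ}

lemma sqrt_mul_sqrt_mu1_le (hK : 1 ≤ K) (hε₁ : 0 < ε₁)
    (h₁ : ε₁ * μ₁ ≤ K * (ε₂ + Real.sqrt ε₁)) :
    Real.sqrt ε₁ * Real.sqrt μ₁ ≤ K * Real.sqrt (ε₂ + Real.sqrt ε₁) := by
  rw [← Real.sqrt_mul hε₁.le]
  refine (Real.sqrt_le_sqrt h₁).trans ?_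
  rw [Real.sqrt_mul (by linarith)]
  gcongr
  exact Real.sqrt_le_iff.2 ⟨by linarith, by nlinarith⟩

/-- Squared, `ε₂² μ₀ ≤ ν (ν μ₀) ≤ K ν`. This makes the direct convection estimate affordable for the
left layer. -/
lemma mul_sqrt_mu0_le (hK : 1 ≤ K) (hε₁ : 0 < ε₁) (hε₂ : 0 < ε₂) (hμ₀ : 0 < μ₀)
    (h₀ : μ₀ * (ε₂ + Real.sqrt ε₁) ≤ K) :
    ε₂ * Real.sqrt μ₀ ≤ K * Real.sqrt (ε₂ + Real.sqrt ε₁) := by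
  have hs := Real.sqrt_pos.2 hε₁
  set ν := ε₂ + Real.sqrt ε₁ with hν
  have hν0 : 0 < ν := by positivity
  refine le_of_abs_le (abs_le_of_sq_le_sq ?_ (by positivity))
  rw [mul_pow, mul_pow, Real.sq_sqrt hμ₀.le, Real.sq_sqrt hν0.le]
  have h1 : ε₂ ^ 2 ≤ ν ^ 2 := pow_le_pow_left₀ hε₂.le (by linarith) 2
  calc ε₂ ^ 2 * μ₀ ≤ ν ^ 2 * μ₀ := by gcongr
    _ = (μ₀ * ν) * ν := by ring
    _ ≤ K * ν := by gcongr
    _ ≤ K ^ 2 * ν := by gcongr; nlinarith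

/-- Squared, `ε₂² ≤ ν² ≤ K ν ≤ K² ε₁ μ₁`. This pays for the `1/√ε₁` produced by integrating the
right-layer convection by parts. -/
lemma le_mul_sqrt_mul_sqrt (hK : 1 ≤ K) (hε₁ : 0 < ε₁) (hε₂ : 0 < ε₂)
    (hνK : ε₂ + Real.sqrt ε₁ ≤ K) (h₁ : ε₂ + Real.sqrt ε₁ ≤ K * (ε₁ * μ₁)) :
    ε₂ ≤ K * (Real.sqrt μ₁ * Real.sqrt ε₁) := by
  have hs := Real.sqrt_pos.2 hε₁
  set ν := ε₂ + Real.sqrt ε₁ with hν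
  have hν0 : 0 < ν := by positivity
  have hK0 : 0 < K := by linarith
  have hεμ : 0 < ε₁ * μ₁ := pos_of_mul_pos_right (hν0.trans_le h₁) hK0.le
  rw [mul_comm (Real.sqrt μ₁), ← Real.sqrt_mul hε₁.le]
  refine le_of_abs_le (abs_le_of_sq_le_sq ?_ (by positivity))
  rw [mul_pow, Real.sq_sqrt hεμ.le]
  calc ε₂ ^ 2 ≤ ν ^ 2 := pow_le_pow_left₀ hε₂.le (by linarith) 2
    _ = ν * ν := by ring
    _ ≤ K * (K * (ε₁ * μ₁)) := by gcongr
    _ = _ := by ring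

/-- The parameter-robust bound of the terms in `abs_bilin_add_le`. -/
lemma robust_bound (hK : 1 ≤ K) (hN : 1 ≤ N) (hε₁ : 0 < ε₁) (hε₂ : 0 < ε₂) (hμ₀ : 1 ≤ μ₀)
    (hμ₀₁ : μ₀ ≤ μ₁) (hνK : ε₂ + Real.sqrt ε₁ ≤ K)
    (h₀ : μ₀ * (ε₂ + Real.sqrt ε₁) ≤ K) (h₁ : ε₂ + Real.sqrt ε₁ ≤ K * (ε₁ * μ₁))
    (h₁' : ε₁ * μ₁ ≤ K * (ε₂ + Real.sqrt ε₁)) {a₀ a₀' a₁ a₁' : ℝ} (ha₀ : a₀ ≤ K / N ^ 2)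
    (ha₀' : a₀' ≤ K * Real.sqrt μ₀ / N) (ha₁ : a₁ ≤ K / N ^ 2 / Real.sqrt μ₁)
    (ha₁' : a₁' ≤ K * Real.sqrt μ₁ / N) :
    Real.sqrt ε₁ * (a₀' + a₁') + (a₀ + a₁) ≤
      4 * K ^ 3 * (Real.sqrt (ε₂ + Real.sqrt ε₁) / N + 1 / N ^ 2) ∧
    Real.sqrt ε₁ * (a₀' + a₁') + ε₂ * K * a₀' + ε₂ * K * (a₁ * (1 / Real.sqrt ε₁ + 1)) +
      K * (a₀ + a₁) ≤ 4 * K ^ 3 * (Real.sqrt (ε₂ + Real.sqrt ε₁) / N + 1 / N ^ 2) := by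
  have f1 := sqrt_mul_sqrt_mu1_le hK hε₁ h₁'
  have f3 := mul_sqrt_mu0_le hK hε₁ hε₂ (by linarith) h₀
  have f4 := le_mul_sqrt_mul_sqrt hK hε₁ hε₂ hνK h₁
  have hs := Real.sqrt_pos.2 hε₁
  have hε₂K : ε₂ ≤ K := by linarith
  have hK0 : 0 < K := by linarith
  have m01 : Real.sqrt μ₀ ≤ Real.sqrt μ₁ := Real.sqrt_le_sqrt hμ₀₁
  have m1 : 1 ≤ Real.sqrt μ₁ := Real.one_le_sqrt.2 (by linarith)
  set s := Real.sqrt (ε₂ + Real.sqrt ε₁) with hsdef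
  set m := Real.sqrt μ₁ with hm
  set e := Real.sqrt ε₁ with he
  have t1 : e * a₁' ≤ K ^ 2 * (s / N) :=
    calc e * a₁' ≤ e * (K * m / N) := by gcongr
      _ = K * (e * m) / N := by ring
      _ ≤ K * (K * s) / N := by gcongr
      _ = _ := by ring
  have t2 : e * a₀' ≤ K ^ 2 * (s / N) :=
    calc e * a₀' ≤ e * (K * Real.sqrt μ₀ / N) := by gcongr
      -- The ordering `μ₀ ≤ μ₁` enters: the left diffusion term is dominated by the right one.
      _ ≤ e * (K * m / N) := by gcongr
      _ = K * (e * m) / N := by ring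
      _ ≤ K * (K * s) / N := by gcongr
      _ = _ := by ring
  have t3 : ε₂ * K * a₀' ≤ K ^ 3 * (s / N) :=
    calc ε₂ * K * a₀' ≤ ε₂ * K * (K * Real.sqrt μ₀ / N) := by gcongr
      _ = K ^ 2 * (ε₂ * Real.sqrt μ₀) / N := by ring
      _ ≤ K ^ 2 * (K * s) / N := by gcongr
      _ = _ := by ring
  have ha₁2 : a₁ ≤ K * (1 / N ^ 2) := by
    refine ha₁.trans ((div_le_self (by positivity) m1).trans_eq ?_)
    ring
  have ha₀2 : a₀ ≤ K * (1 / N ^ 2) := ha₀.trans_eq (by ring)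
  -- The product `√μ₁ √ε₁` cancels exactly between the bound of `ε₂` and the `L²` error of the right
  -- layer.
  have t4 : ε₂ * K * (a₁ * (1 / e)) ≤ K ^ 3 * (1 / N ^ 2) :=
    calc ε₂ * K * (a₁ * (1 / e)) ≤ ε₂ * K * (K / N ^ 2 / m * (1 / e)) := by gcongr
      _ = ε₂ * (K ^ 2 / N ^ 2 / (m * e)) := by field_simp
      _ ≤ K * (m * e) * (K ^ 2 / N ^ 2 / (m * e)) := by gcongr
      _ = _ := by field_simp
  have t5 : ε₂ * K * a₁ ≤ K ^ 3 * (1 / N ^ 2) :=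
    calc ε₂ * K * a₁ ≤ ε₂ * K * (K * (1 / N ^ 2)) := by gcongr
      _ ≤ K * K * (K * (1 / N ^ 2)) := by gcongr
      _ = _ := by ring
  have k1 : K ^ 2 * (s / N) ≤ K ^ 3 * (s / N) := by gcongr; norm_num [hK]
  have k2 : K * (1 / N ^ 2) ≤ K ^ 3 * (1 / N ^ 2) := by
    gcongr
    exact le_self_pow₀ hK (by norm_num)
  have k3 : K * (K * (1 / N ^ 2)) ≤ K ^ 3 * (1 / N ^ 2) := by
    calc K * (K * (1 / N ^ 2)) = K ^ 2 * (1 / N ^ 2) := by ring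
      _ ≤ _ := by gcongr; norm_num [hK]
  have t6 := mul_le_mul_of_nonneg_left ha₀2 hK0.le
  have t7 := mul_le_mul_of_nonneg_left ha₁2 hK0.le
  have q1 : 0 ≤ K ^ 3 * (s / N) := by positivity
  have q2 : 0 ≤ K ^ 3 * (1 / N ^ 2) := by positivity
  constructor <;> linarith

/-- The parameter-robust bound of the residual. -/
lemma robust_residual_bound (hK : 1 ≤ K) (hN : 1 ≤ N) (hε₁ : 0 < ε₁) (hε₂ : 0 < ε₂)
    (hμ₀₁ : μ₀ ≤ μ₁) (hNν : ε₂ + Real.sqrt ε₁ ≤ K / N)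
    (h₁' : ε₁ * μ₁ ≤ K * (ε₂ + Real.sqrt ε₁)) :
    K * (ε₁ + ε₂ ^ 2) + 4 * K ^ 3 * (ε₂ + 1) / N ^ 2 +
      K ^ 3 * ε₁ * (Real.sqrt μ₀ + Real.sqrt μ₁) ≤
      10 * K ^ 5 * (Real.sqrt (ε₂ + Real.sqrt ε₁) / N + 1 / N ^ 2) := by
  have f1 := sqrt_mul_sqrt_mu1_le hK hε₁ h₁'
  have hs := Real.sqrt_pos.2 hε₁
  have hss : Real.sqrt ε₁ ^ 2 = ε₁ := Real.sq_sqrt hε₁.le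
  have m01 : Real.sqrt μ₀ ≤ Real.sqrt μ₁ := Real.sqrt_le_sqrt hμ₀₁
  have hK0 : 0 < K := by linarith
  set s := Real.sqrt (ε₂ + Real.sqrt ε₁) with hsdef
  set m := Real.sqrt μ₁ with hm
  set e := Real.sqrt ε₁ with he
  have heK : e ≤ K / N := by linarith
  have hεK : ε₂ ≤ K / N := by linarith
  have hKN : K / N ≤ K := div_le_self hK0.le hN
  have t1 : K * (ε₁ + ε₂ ^ 2) ≤ 2 * K ^ 5 * (1 / N ^ 2) :=
    calc K * (ε₁ + ε₂ ^ 2) = K * (e ^ 2 + ε₂ ^ 2) := by rw [hss]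
      _ ≤ K * ((K / N) ^ 2 + (K / N) ^ 2) := by gcongr
      _ = 2 * K ^ 3 * (1 / N ^ 2) := by ring
      _ ≤ _ := by gcongr; norm_num [hK]
  have t2 : 4 * K ^ 3 * (ε₂ + 1) / N ^ 2 ≤ 8 * K ^ 5 * (1 / N ^ 2) :=
    calc 4 * K ^ 3 * (ε₂ + 1) / N ^ 2 ≤ 4 * K ^ 3 * (K + K) / N ^ 2 := by
          gcongr
          exact hεK.trans hKN
      _ = 8 * K ^ 4 * (1 / N ^ 2) := by ring
      _ ≤ _ := by gcongr; norm_num [hK]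
  -- Write `ε₁ √μ₁ = √ε₁ · √(ε₁ μ₁)`: the first factor is at most `K / N`, the second at most `K
  -- √ν`.
  have t3 : K ^ 3 * ε₁ * (Real.sqrt μ₀ + m) ≤ 2 * K ^ 5 * (s / N) :=
    calc K ^ 3 * ε₁ * (Real.sqrt μ₀ + m) ≤ K ^ 3 * ε₁ * (m + m) := by gcongr
      _ = K ^ 3 * e ^ 2 * (m + m) := by rw [hss]
      _ = 2 * K ^ 3 * e * (e * m) := by ring
      _ ≤ 2 * K ^ 3 * (K / N) * (K * s) := by gcongr
      _ = _ := by ring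
  have q1 : 0 ≤ K ^ 5 * (s / N) := by positivity
  linarith

end ParameterEstimates

/-! ### Residuals of the layer functions -/

/-- With `w' = g₀ w`, the characteristic equation cancels everything except the term from
differentiating the variable root, which is smaller than `ε₁ w''` by a factor of order `μ`. -/
lemma abs_diffOp_layer0_le {ε₁ ε₂ K μ x : ℝ} {b c w g' : ℝ → ℝ} (hε₁ : 0 < ε₁)
    (hc : 0 < c x) (hg : RootBounds K μ (fun x => -charRoot0 ε₁ ε₂ b c x) g')
    (hx : x ∈ Ioo (0 : ℝ) 1) :
    |diffOp ε₁ ε₂ b c w (fun x => -(-charRoot0 ε₁ ε₂ b c x) * w x)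
      (fun x => ((-charRoot0 ε₁ ε₂ b c x) ^ 2 - g' x) * w x) x| ≤ K * ε₁ * μ * |w x| := by
  have hroot := (charRoot_spec (ε₂ := ε₂) (b := b) hε₁ hc (charRoot0 ε₁ ε₂ b c x)).2 (Or.inl rfl)
  have e : diffOp ε₁ ε₂ b c w (fun x => -(-charRoot0 ε₁ ε₂ b c x) * w x)
      (fun x => ((-charRoot0 ε₁ ε₂ b c x) ^ 2 - g' x) * w x) x = ε₁ * g' x * w x := by
    unfold diffOp
    linear_combination w x * hroot
  rw [e, abs_mul, abs_mul, abs_of_pos hε₁]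
  calc ε₁ * |g' x| * |w x| ≤ ε₁ * (K * μ) * |w x| := by
        gcongr; exact hg.deriv_le x hx
    _ = _ := by ring

/-- The same cancellation for the positive root: the reflected function satisfies `v' = g₁ v`. -/
lemma abs_diffOp_layer1_le {ε₁ ε₂ K μ x : ℝ} {b c z g' : ℝ → ℝ} (hε₁ : 0 < ε₁)
    (hc : 0 < c x) (hg : RootBounds K μ (charRoot1 ε₁ ε₂ b c) g') (hx : x ∈ Ioo (0 : ℝ) 1) :
    |diffOp ε₁ ε₂ b c (fun x => z (1 - x))
      (fun x => -(-charRoot1 ε₁ ε₂ b c (1 - (1 - x)) * z (1 - x)))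
      (fun x => (charRoot1 ε₁ ε₂ b c (1 - (1 - x)) ^ 2 - -g' (1 - (1 - x))) * z (1 - x)) x| ≤
      K * ε₁ * μ * |z (1 - x)| := by
  have hroot := (charRoot_spec (ε₂ := ε₂) (b := b) hε₁ hc (charRoot1 ε₁ ε₂ b c x)).2 (Or.inr rfl)
  have e : diffOp ε₁ ε₂ b c (fun x => z (1 - x))
      (fun x => -(-charRoot1 ε₁ ε₂ b c (1 - (1 - x)) * z (1 - x)))
      (fun x => (charRoot1 ε₁ ε₂ b c (1 - (1 - x)) ^ 2 - -g' (1 - (1 - x))) * z (1 - x)) x =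
      -(ε₁ * g' x * z (1 - x)) := by
    unfold diffOp
    simp only [sub_sub_cancel]
    linear_combination z (1 - x) * hroot
  rw [e, abs_neg, abs_mul, abs_mul, abs_of_pos hε₁]
  calc ε₁ * |g' x| * |z (1 - x)| ≤ ε₁ * (K * μ) * |z (1 - x)| := by
        gcongr; exact hg.deriv_le x hx
    _ = _ := by ring

lemma MemFESpace.piecewiseAffine {N : ℕ} {x : ℕ → ℝ} {w : ℝ → ℝ} (h : MemFESpace N x w) :
    PiecewiseAffine N x w := ⟨h.1, h.2.2.2⟩

lemma energyNorm_le_of_add {ε : ℝ} (hε : 0 ≤ ε) {η₀ η₁ : ℝ → ℝ} (h₀ : PiecewiseDiff η₀)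
    (h₁ : PiecewiseDiff η₁) : energyNorm ε (fun x => η₀ x + η₁ x) ≤
      Real.sqrt ε * (l2 (deriv η₀) + l2 (deriv η₁)) + (l2 η₀ + l2 η₁) := by
  refine (energyNorm_le hε _).trans (add_le_add ?_ (l2_add_le h₀.memLp h₁.memLp))
  refine mul_le_mul_of_nonneg_left ?_ (Real.sqrt_nonneg _)
  have hd : weakDeriv (fun x => η₀ x + η₁ x) =ᵐ[volΩ] fun x => deriv η₀ x + deriv η₁ x := by
    filter_upwards [(h₀.add h₁).weakDeriv_ae, h₀.ae_differentiableAt, h₁.ae_differentiableAt]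
      with x h1 h2 h3
    rw [h1, deriv_fun_add h2 h3]
  rw [l2_congr hd]
  exact l2_add_le h₀.memLp_deriv h₁.memLp_deriv

end TwoParam

end

/-! ### The uniform error bound -/

open TwoParam in
set_option maxHeartbeats 1000000 in
theorem mainTheorem2 (b c f : ℝ → ℝ) (lam β γ p τ : ℝ)
    (hb : ContDiffOn ℝ 3 b (Icc 0 1)) (hc : ContDiffOn ℝ 3 c (Icc 0 1))
    (hf : ContDiffOn ℝ 3 f (Icc 0 1))
    (hlam : 0 < lam) (hβ : 0 < β) (hγ : 0 < γ)
    (hb_lower : ∀ x ∈ Icc (0 : ℝ) 1, lam ≤ b x)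
    (hc_lower : ∀ x ∈ Icc (0 : ℝ) 1, β ≤ c x)
    (hp0 : 0 < p) (hp1 : p < 1) (hτ : 5 / 2 ≤ τ) :
    ∃ C : ℝ, 0 < C ∧
      ∀ ε₁ ε₂ : ℝ, 0 < ε₁ → 0 < ε₂ →
      (∀ x ∈ Icc (0 : ℝ) 1, γ ≤ c x - 1 / 2 * ε₂ * derivWithin b (Icc 0 1) x) →
      ∀ N : ℕ, 16 ≤ N → 4 ∣ N →
      sigma τ p (mu0 ε₁ ε₂ b c) ≤ 1 / 4 →
      sigma τ p (mu1 ε₁ ε₂ b c) ≤ 1 / 4 →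
      (mu1 ε₁ ε₂ b c)⁻¹ ≤ (mu0 ε₁ ε₂ b c)⁻¹ →
      (mu0 ε₁ ε₂ b c)⁻¹ ≤ (N : ℝ)⁻¹ →
      ∀ u uN : ℝ → ℝ, IsWeakSolution ε₁ ε₂ b c f u →
      IsFESolution ε₁ ε₂ b c f N
        (meshPoint τ p (mu0 ε₁ ε₂ b c) (mu1 ε₁ ε₂ b c) N) uN →
      energyNorm ε₁ (fun x => u x - uN x) ≤
        C * Real.sqrt (ε₂ + Real.sqrt ε₁) * (N : ℝ)⁻¹ + C * ((N : ℝ) ^ 2)⁻¹ := by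
  obtain ⟨hb'c, hb'd⟩ := exists_deriv_of_contDiffOn (k := 2) (by exact_mod_cast hb)
  obtain ⟨hc'c, hc'd⟩ := exists_deriv_of_contDiffOn (k := 2) (by exact_mod_cast hc)
  set b' := derivWithin b (Icc 0 1) with hb'
  set c' := derivWithin c (Icc 0 1) with hc'
  obtain ⟨B₁, hB₁⟩ := exists_bound hb.continuousOn
  obtain ⟨B₂, hB₂⟩ := exists_bound hb'c.continuousOn
  obtain ⟨B₃, hB₃⟩ := exists_bound hc.continuousOn
  obtain ⟨B₄, hB₄⟩ := exists_bound hc'c.continuousOn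
  have hz : (0 : ℝ) ∈ Icc (0 : ℝ) 1 := by simp
  have p₁ := (abs_nonneg _).trans (hB₁ 0 hz)
  have p₂ := (abs_nonneg _).trans (hB₂ 0 hz)
  have p₃ := (abs_nonneg _).trans (hB₃ 0 hz)
  have p₄ := (abs_nonneg _).trans (hB₄ 0 hz)
  have hcoef : CoeffBounds b b' c c' lam β (1 + B₁ + B₂ + B₃ + B₄) :=
    ⟨hb.continuousOn, hc.continuousOn, hb'd, hc'd, hlam, hβ, hb_lower, hc_lower, by linarith,
      fun x hx => (hB₁ x hx).trans (by linarith), fun x hx => (hB₂ x hx).trans (by linarith),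
      fun x hx => (hB₃ x hx).trans (by linarith), fun x hx => (hB₄ x hx).trans (by linarith)⟩
  set B := 1 + B₁ + B₂ + B₃ + B₄ with hB
  obtain ⟨K₀, hK₀, hroot₀⟩ := hcoef.charRoot0_bounds
  obtain ⟨K₁, hK₁, hroot₁⟩ := hcoef.charRoot1_bounds
  -- `K₀` serves as upper bound of `ε₂`: from `μ₀ ν ≤ K₀` and `μ₀ ≥ N ≥ 1` one gets `ν ≤ K₀`.
  obtain ⟨M, hM, hsmooth⟩ := exists_smoothPart hb hc hf hβ hc_lower K₀
  have hτ0 : 0 < τ := by linarith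
  set κ := p / (2 * τ) with hκ
  have hκ0 : 0 < κ := by positivity
  -- This is `5p ≤ 2τ`, the only place where the precise lower bound of `τ` matters.
  have hκ5 : κ ≤ 1 / 5 := by
    rw [hκ, div_le_div_iff₀ (by positivity) (by norm_num)]; linarith
  -- A single constant dominating coefficients, root bounds, layer amplitudes `2 K₀ ^ 2` and `2 K₁ ^
  -- 2`, the smooth part, the local interpolation constant and `N` times the largest mesh step.
  set K := B + 2 * K₀ ^ 2 + 2 * K₁ ^ 2 + M + 324 / κ ^ 2 + 4 * (τ / p) with hK
  have k1 : 0 < 324 / κ ^ 2 := by positivity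
  have k2 : 0 < 4 * (τ / p) := by positivity
  have hBK : B ≤ K := by nlinarith
  have h0K : 2 * K₀ ^ 2 ≤ K := by nlinarith
  have h0K' : K₀ ≤ K := by nlinarith
  have h1K : 2 * K₁ ^ 2 ≤ K := by nlinarith
  have h1K' : K₁ ≤ K := by nlinarith
  have hMK : M ≤ K := by nlinarith
  have hκK : 324 / κ ^ 2 ≤ K := by nlinarith
  have hτK : 4 * (τ / p) ≤ K := by nlinarith
  have hK1 : 1 ≤ K := by linarith
  clear_value K
  set L := 6 * K ^ 4 with hL
  have hKL : K ≤ L := by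
    have : K ≤ K ^ 4 := le_self_pow₀ hK1 (by norm_num)
    linarith
  have hL1 : 1 ≤ L := by linarith
  have hL0 : 0 < L := by linarith
  -- Read off from `energyNorm_sub_le_of_approx`: `4 * L ^ 3` from `robust_bound` for both the
  -- approximation error and the bilinear form, `10 * K ^ 5` from the residual.
  refine ⟨4 * (4 * L ^ 3 + (4 * L ^ 3 + 2 * (10 * K ^ 5)) / min 1 γ), by positivity, ?_⟩
  intro ε₁ ε₂ hε₁ hε₂ hcoer N hN16 hN4 hσ₀ hσ₁ hμ₁₀ hμ₀N u uN hu huN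
  obtain ⟨n, rfl⟩ := hN4
  have hn : 4 ≤ n := by omega
  have hn4 : (4 : ℝ) ≤ n := by exact_mod_cast hn
  obtain ⟨r1, r2, g₀', hg₀⟩ := hroot₀ ε₁ ε₂ hε₁ hε₂
  obtain ⟨r3, r4, g₁', hg₁⟩ := hroot₁ ε₁ ε₂ hε₁ hε₂
  have hs := Real.sqrt_pos.2 hε₁
  set μ₀ := mu0 ε₁ ε₂ b c with hμ₀
  set μ₁ := mu1 ε₁ ε₂ b c with hμ₁
  set ν := ε₂ + Real.sqrt ε₁ with hν
  have hν0 : 0 < ν := by positivity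
  have hμ₀0 : 0 < μ₀ := by
    have : 0 < μ₀ * ν := pos_of_mul_pos_right (one_pos.trans_le r1) (by linarith)
    exact pos_of_mul_pos_left this hν0.le
  have hμ₁0 : 0 < μ₁ := by
    have : 0 < ε₁ * μ₁ := pos_of_mul_pos_right (hν0.trans_le r3) (by linarith)
    exact pos_of_mul_pos_right this hε₁.le
  have hμ₀₁ : μ₀ ≤ μ₁ := (inv_le_inv₀ hμ₁0 hμ₀0).1 hμ₁₀
  have hNμ₀ : 4 * (n : ℝ) ≤ μ₀ := by
    have := (inv_le_inv₀ hμ₀0 (by positivity)).1 hμ₀N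
    push_cast at this
    exact this
  have hNμ₁ : 4 * (n : ℝ) ≤ μ₁ := hNμ₀.trans hμ₀₁
  have hmesh := isMesh_meshPoint hτ hp0 hp1 (by omega : 0 < n) (by linarith : 1 < μ₀)
    (by linarith : 1 < μ₁) hσ₀ hσ₁
  have hstep := fun i (hi : i < 4 * n) => (meshPoint_step hτ hp0 hp1 (by omega : 0 < n)
    (by linarith : 1 < μ₀) (by linarith : 1 < μ₁) hσ₀ hσ₁ hi).2
  set y := meshPoint τ p μ₀ μ₁ (4 * n) with hy
  set N : ℝ := 4 * n with hN
  have hN1 : 1 ≤ N := by linarith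
  have hN0 : 0 < N := by linarith
  -- `N ν ≤ μ₀ ν ≤ K₀`: a layer thinner than `1/N` forces small parameters.
  have hνN : ν ≤ K₀ / N := by
    rw [le_div_iff₀ hN0]
    nlinarith
  have hνK₀ : ν ≤ K₀ := hνN.trans (div_le_self (by linarith) hN1)
  -- the three parts of the approximation
  obtain ⟨S, S', S'', hS, hSb, hSb'', hSr⟩ := hsmooth ε₁ ε₂ hε₁ hε₂ (by linarith)
  obtain ⟨w, hw0, hw⟩ := exists_isLayer hK₀ (by linarith : 1 ≤ μ₀) hg₀
  obtain ⟨z, hz0, hz'⟩ := exists_isLayer hK₁ (by linarith : 1 ≤ μ₁) hg₁.reflect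
  obtain ⟨P, U, U', U'', η₀, η₁, hP, hP0, hP1, hU, hU0, hU1, hη₀, hη₁, hPU, e₀, e₀', e₁, e₁', hres⟩ :=
    exists_approximation (f := f) hK1 hε₁ hε₂ hκ0 hκ5 hκK hn hNμ₀ hNμ₁ hmesh
    (fun i hi => (hstep i hi).trans (by
      rw [le_div_iff₀ hN0, hN]
      calc τ / p / n * (4 * n) = 4 * (τ / p) := by field_simp
        _ ≤ K := hτK))
    (fun i hi => by
      rw [hy, meshPoint_left hi.le]
      exact exp_layer_point hτ0 hp0 (by omega) (by linarith) hi.le)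
    -- Counted from the right end, the mesh is again a layer mesh, now with parameter `μ₁`.
    (fun i hi => by
      rw [hy, meshPoint_right (by omega) (by omega) (by omega), sub_sub_cancel,
        show 4 * n - (4 * n - i) = i by omega]
      exact exp_layer_point hτ0 hp0 (by omega) (by linarith) hi.le)
    (fun x hx => (hcoef.b_le x hx).trans hBK) (fun x hx => (hcoef.c_le x hx).trans hBK)
    hS (fun x hx => (hSb x hx).trans hMK) (fun x hx => (hSb'' x hx).trans hMK)
    (fun x hx => (hSr x hx).trans (by gcongr))
    (hw.mono hμ₀0.le h0K) (hg₀.cont.neg.mul hw.cont) hw0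
    (fun x hx => (abs_diffOp_layer0_le hε₁ (hβ.trans_le (hc_lower x
      (Ioo_subset_Icc_self hx))) hg₀ hx).trans (by gcongr))
    (hz'.mono hμ₁0.le h1K) (hg₁.reflect.cont.neg.mul hz'.cont) hz0
    (fun x hx => (abs_diffOp_layer1_le hε₁ (hβ.trans_le (hc_lower x
      (Ioo_subset_Icc_self hx))) hg₁ hx).trans (by gcongr))
  set T := Real.sqrt ν / N + 1 / N ^ 2 with hT
  have hrob := robust_bound hL1 hN1 hε₁ hε₂ (by linarith : 1 ≤ μ₀) hμ₀₁ (by linarith)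
    (r2.trans (by linarith)) (r3.trans (by gcongr; linarith)) (r4.trans (by gcongr; linarith))
    e₀ e₀' e₁ e₁'
  have hresT := hres.trans (robust_residual_bound hK1 hN1 hε₁ hε₂ hμ₀₁ (hνN.trans (by gcongr))
    (r4.trans (by gcongr)))
  rw [← hν, ← hT] at hrob hresT
  have hbPD : PiecewiseDiff b := PiecewiseDiff.of_hasDerivAt hb.continuousOn countable_empty
    (fun x hx => hb'd x hx.1) fun x hx => hB₂ x (Ioo_subset_Icc_self hx.1)
  have hbb' : deriv b =ᵐ[volΩ] b' := ae_of_forall_Ioo fun x hx => (hb'd x hx).deriv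
  have hPd := hP.piecewiseDiff hmesh
  have huNA := huN.1.piecewiseAffine
  have huNd := huNA.piecewiseDiff hmesh
  have hvA := hP.sub huNA
  have hvd := hPd.sub huNd
  have hv0 : P 0 - uN 0 = 0 := by rw [hP0, huN.1.2.1, sub_zero]
  have hv1 : P 1 - uN 1 = 0 := by rw [hP1, huN.1.2.2.1, sub_zero]
  have hE : energyNorm ε₁ (fun x => P x - U x) ≤ 4 * L ^ 3 * T := by
    rw [hPU]
    exact (energyNorm_le_of_add hε₁.le hη₀ hη₁).trans hrob.1
  have hmain := energyNorm_sub_le_of_approx hε₁.le hγ hbPD hb'c.continuousOn hbb' hc.continuousOn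
    hf.continuousOn hcoer hu (huNd.memH10 huN.1.2.1 huN.1.2.2.1) (hPd.memH10 hP0 hP1)
    (huN.2 _ ⟨hvA.1, hv0, hv1, hvA.2⟩) hU0 hU1 hU.piecewiseDiff hU.piecewiseDiff' hU.deriv_ae
    hU.deriv_ae' hresT (by positivity : 0 ≤ 4 * L ^ 3 * T)
    (by
      rw [hPU]
      refine (abs_bilin_add_le hε₁ hε₂.le hbPD hb'c.continuousOn hbb' hc.continuousOn hL0.le
        (fun x hx => (hcoef.b_le x hx).trans (by linarith))
        (fun x hx => (hcoef.b'_le x hx).trans (by linarith))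
        (fun x hx => (hcoef.c_le x hx).trans (by linarith)) hη₀ hη₁ hvd hv0 hv1).trans ?_
      exact mul_le_mul_of_nonneg_right hrob.2 (energyNorm_nonneg _ _))
    hE
  refine hmain.trans_eq ?_
  rw [hT, hN]
  push_cast
  ring
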